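/- Let $\Sigma$ be a compact Riemann surface without boundary, let $X$ be a complex manifold, and let $s_1,\dots,s_m\colon X\to\Sigma$ be finitely many distinct holomorphic maps. Put $D=\bigcup_i\{(z,x)\in\Sigma\times X: z=s_i(x)\}$ and $D^{(2)}=\bigcup_{i\ne j}D_{ij}$, where $D_{ij}=\{x\in X: s_i(x)=s_j(x)\}$. Let $\mathcal A^k(\Sigma\times X,\star D)$ be the space of complex-valued $k$-forms, smooth off $D$, which near every point are of the form $\alpha/g^{N}$ with $\alpha$ a smooth form, $N\ge 0$, and $g$ the product of the functions $z-s_i(x)$ over those $i$ whose graph contains the point ($z$ a local holomorphic coordinate of $\Sigma$). Let $\mathcal A^k(X,\star D^{(2)})$ be the space of $k$-forms, smooth off $D^{(2)}$, which near every point $x_0$ are of the form $\alpha/g^N$ with $\alpha$ smooth, $N\ge0$, and $g$ the product of the functions $z(s_i(x))-z(s_j(x))$ over the pairs $i\neq j$ with $s_i(x_0)=s_j(x_0)$ ($z$ a local coordinate of $\Sigma$ at $s_i(x_0)$). For a finite set $P\subset\Sigma$ and a $2$-form $\omega$ on $\Sigma$, smooth off $P$ with holomorphic poles of arbitrary order along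 $P$ (i.e. $\omega\in\mathcal A^2(\Sigma,\star P)$), the regularized integral is $\int^{\mathrm{reg}}_\Sigma\omega:=\int_\Sigma\alpha$ for any decomposition $\omega=\alpha+\partial\beta$, where $\alpha$ is a $2$-form with at most logarithmic (first order) poles along $P$ and $\beta$ is a $(0,1)$-form, smooth off $P$, with holomorphic poles of arbitrary order along $P$. For $\omega\in\mathcal A^{k+2}(\Sigma\times X,\star D)$ the push-forward $\int^{\mathrm{reg}}_\Sigma\omega$ is the $k$-form on $X\setminus D^{(2)}$ whose value at $x$ on tangent vectors $v_1,\dots,v_k\in T_xX$ is the regularized integral over $\Sigma\times\{x\}$ of the $2$-form $\omega(\cdot,\cdot,v_1,\dots,v_k)$ (with poles at the points $s_1(x),\dots,s_m(x)$); the push-forward of a form of degree $0$ or $1$ is $0$. Then these regularized integrals exist and are independent of the choice of decomposition, the holomorphic de Rham differential $\partial_{\Sigma\times X}$ maps $\mathcal A^{\bullet}(\Sigma\times X,\star D)$ to $\mathcal A^{\bullet+1}(\Sigma\times X,\star D)$, the push-forward is a map $$\int^{\mathrm{reg}}_\Sigma\colon \mathcal A^{\bullet}(\Sigma\times X,\star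 D)\to\mathcal A^{\bullet-2}(X,\star D^{(2)}),$$ and for every $\omega\in \mathcal A^{\bullet}(\Sigma\times X,\star D)$ $$\int^{\mathrm{reg}}_\Sigma\partial_{\Sigma\times X}\,\omega=\partial_X \int^{\mathrm{reg}}_\Sigma\omega \quad\text{on } X\setminus D^{(2)},$$ where $\partial_{\Sigma\times X}$ and $\partial_X$ are the holomorphic de Rham differentials. In particular $\int^{\mathrm{reg}}_\Sigma\partial_{\Sigma\times X}\,\omega=0$ for $\omega\in\mathcal A^1(\Sigma\times X,\star D)$. -/

import Mathlib

open scoped Manifold ContDiff Topology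

noncomputable section

namespace RegInt

section Forms

variable {E : Type*} [NormedAddCommGroup E] [NormedSpace ℂ E] [NormedSpace ℝ E]
  {H : Type*} [TopologicalSpace H]

/-- A (not necessarily continuous) complex-valued differential `k`-form on a manifold `M`
without boundary: for every point `p` an alternating `ℝ`-multilinear form on the real tangent space
at `p`. As everywhere in Mathlib, the tangent space at `p` is the model space `E`, a vector being
given by its coordinates in the preferred chart `extChartAt I p`. -/
abbrev DForm (_I : ModelWithCorners ℝ E H) (M : Type*) [TopologicalSpace M] [ChartedSpace H M]
    (k : ℕ) : Type _ :=
  M → E [⋀^Fin k]→L[ℝ] ℂ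

variable {M : Type*} [TopologicalSpace M] [ChartedSpace H M] {k : ℕ}

/-- The expression in the preferred chart `φ` at `p` of a form `w`, i.e. the pull-back `(φ⁻¹)^* w`
(meaningful on the target of `φ`). At `y = φ q`, the derivative of `φ⁻¹` is computed in the
coordinates that define the tangent space at `q`. -/
def inChart (I : ModelWithCorners ℝ E H) (w : DForm I M k) (p : M) : E → E [⋀^Fin k]→L[ℝ] ℂ :=
  fun y => (w ((extChartAt I p).symm y)).compContinuousLinearMap
    (fderiv ℝ (extChartAt I ((extChartAt I p).symm y) ∘ (extChartAt I p).symm) y)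

/-- The form is `C^∞` at the point `p`. -/
def SmoothFormAt (I : ModelWithCorners ℝ E H) (w : DForm I M k) (p : M) : Prop :=
  ContDiffAt ℝ ∞ (inChart I w p) (extChartAt I p p)

/-- Multiplication by `√-1` on a complex normed space, as a real-linear map. -/
def mulI (F : Type*) [NormedAddCommGroup F] [NormedSpace ℂ F] [NormedSpace ℝ F]
    [IsScalarTower ℝ ℂ F] : F →L[ℝ] F :=
  (Complex.I • ContinuousLinearMap.id ℂ F).restrictScalars ℝ

/-- The complex-linear part `v ↦ (L v - i L (i v)) / 2` of a real-linear map. Applied to a real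
derivative `Df = ∂f + ∂̄f`, it gives `∂f = ∑ j, (∂f/∂z_j) dz_j`. -/
def complexLinearPart [IsScalarTower ℝ ℂ E] {F : Type*} [NormedAddCommGroup F] [NormedSpace ℂ F]
    [NormedSpace ℝ F] [IsScalarTower ℝ ℂ F] (L : E →L[ℝ] F) : E →L[ℝ] F :=
  (1 / 2 : ℝ) • (L - (mulI F).comp (L.comp (mulI E)))

/-- The holomorphic de Rham differential `∂` on forms of total degree `k`, computed at `p` in the
chart at `p`: there `∂ w = ∑ j, dz_j ∧ ∂w/∂z_j`, which is the alternatization of the complex-linear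
part of the derivative of the coefficients (the full derivative would give the de Rham
differential). -/
def del [IsScalarTower ℝ ℂ E] (I : ModelWithCorners ℝ E H) (w : DForm I M k) : DForm I M (k + 1) :=
  fun p => ContinuousAlternatingMap.alternatizeUncurryFin
    (complexLinearPart (fderiv ℝ (inChart I w p) (extChartAt I p p)))

end Forms

section Poles

variable {E : Type*} [NormedAddCommGroup E] [NormedSpace ℂ E] [NormedSpace ℝ E]
  {H : Type*} [TopologicalSpace H] {M : Type*} [TopologicalSpace M] [ChartedSpace H M] {k : ℕ}
  {S : Type*} [TopologicalSpace S] [ChartedSpace ℂ S] {κ : Type*} [Fintype κ]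

/-- Given maps `a j, b j : M → S` to a Riemann surface, let `D j = {a j = b j}` be the pull-back of
the diagonal of `S × S`. This is the local equation near `p ∈ M` of the divisor `∑ j, D j`: the
product, over those `j` with `p ∈ D j`, of `z ∘ a j - z ∘ b j`, where `z` is the coordinate of `S`
at the point `a j p = b j p`. It is `1` if `p` lies on no `D j`. -/
def localEq (a b : κ → M → S) (p q : M) : ℂ :=
  open Classical in
  ∏ j with a j p = b j p, (chartAt ℂ (a j p) (a j q) - chartAt ℂ (a j p) (b j q))

/-- Near `p`, the form is `η / g ^ N` off `⋃ j, D j`, where `η` is a smooth form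
and `g` is the local equation of `∑ j, D j`. -/
def HasPoleLEAt (I : ModelWithCorners ℝ E H) (a b : κ → M → S) (N : ℕ) (w : DForm I M k) (p : M) : Prop :=
  ∃ η : DForm I M k, ∀ᶠ q in 𝓝 p, SmoothFormAt I η q ∧
    ((∀ j, a j q ≠ b j q) → (localEq a b p q) ^ N • w q = η q)

/-- The space `𝒜^k(M, ⋆D)`, `D = ⋃ j, {a j = b j}`, of forms that are smooth off `D` and have
holomorphic poles of arbitrary order along `D`; in particular `w` is smooth near every point
off `D`. The values of `w` on `D` are irrelevant. -/
def IsPolar (I : ModelWithCorners ℝ E H) (a b : κ → M → S) (w : DForm I M k) : Prop :=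
  ∀ p, ∃ N, HasPoleLEAt I a b N w p

end Poles

section Surface

variable {S : Type*} [TopologicalSpace S] [ChartedSpace ℂ S] {k : ℕ}

/-- `𝒜^k(S, ⋆D)` for a finite set `D` of points of a Riemann surface `S`: locally `w = α / z ^ N`
with `α` smooth, where `z` is a coordinate centred at a point of `D`. -/
def IsPolarOn (D : Finset S) (w : DForm 𝓘(ℝ, ℂ) S k) : Prop :=
  IsPolar 𝓘(ℝ, ℂ) (fun (_ : D) (q : S) => q) (fun (d : D) (_ : S) => (d : S)) w

/-- `𝒜²(S, log D)` for a finite set `D` of points of a Riemann surface `S`: `2`-forms, all of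
which are of type `(1,1)`, that are locally `α / z` with `α` smooth, i.e. `β ∧ dz / z` with `β` a
smooth `(0,1)`-form. -/
def IsLogOn (D : Finset S) (w : DForm 𝓘(ℝ, ℂ) S 2) : Prop :=
  ∀ p, HasPoleLEAt 𝓘(ℝ, ℂ) (fun (_ : D) (q : S) => q) (fun (d : D) (_ : S) => (d : S)) 1 w p

/-- A `1`-form is of type `(0,1)` off `D` if it is conjugate-linear on the tangent spaces. -/
def IsTypeZeroOneOff (D : Finset S) (w : DForm 𝓘(ℝ, ℂ) S 1) : Prop :=
  ∀ q, q ∉ D → ∀ v : ℂ, w q (fun _ => Complex.I * v) = -Complex.I * w q (fun _ => v)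

/-- `∫_S α = c`, absolutely convergent, for a `2`-form on a compact Riemann surface with the complex
orientation: for a finite smooth partition of unity `ρ` subordinate to coordinate charts, `c` is the
sum of the Lebesgue integrals of `ρ j * f j`, where `α = f j dx ∧ dy` in the `j`-th chart. -/
def HasSurfaceIntegral (α : DForm 𝓘(ℝ, ℂ) S 2) (c : ℂ) : Prop :=
  ∃ (m : ℕ) (pt : Fin m → S) (ρ : SmoothPartitionOfUnity (Fin m) 𝓘(ℝ, ℂ) S),
    ρ.IsSubordinate (fun j => (chartAt ℂ (pt j)).source) ∧
    (∀ j, MeasureTheory.IntegrableOn (fun y : ℂ =>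
      (ρ j ((chartAt ℂ (pt j)).symm y) : ℂ) * inChart 𝓘(ℝ, ℂ) α (pt j) y ![1, Complex.I])
      (chartAt ℂ (pt j)).target) ∧
    c = ∑ j, ∫ y in (chartAt ℂ (pt j)).target,
      (ρ j ((chartAt ℂ (pt j)).symm y) : ℂ) * inChart 𝓘(ℝ, ℂ) α (pt j) y ![1, Complex.I]

/-- `c` is a value of the regularized integral `⨍_S w` of `w ∈ 𝒜²(S, ⋆D)`, where `S` is a compact
Riemann surface without boundary: `w = α + ∂β` off `D` with `α ∈ 𝒜²(S, log D)`,
`β ∈ 𝒜^{0,1}(S, ⋆D)` and `c = ∫_S α`. -/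
def HasRegIntegral (D : Finset S) (w : DForm 𝓘(ℝ, ℂ) S 2) (c : ℂ) : Prop :=
  ∃ (α : DForm 𝓘(ℝ, ℂ) S 2) (β : DForm 𝓘(ℝ, ℂ) S 1),
    IsLogOn D α ∧ IsPolarOn D β ∧ IsTypeZeroOneOff D β ∧
    (∀ q, q ∉ D → w q = α q + del 𝓘(ℝ, ℂ) β q) ∧ HasSurfaceIntegral α c

end Surface

section Family

variable {E : Type*} [NormedAddCommGroup E] [NormedSpace ℂ E]
  {S : Type*} [TopologicalSpace S] [ChartedSpace ℂ S]
  {X : Type*} [TopologicalSpace X] [ChartedSpace E X] {ι : Type*} [Fintype ι] {k : ℕ}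

/-- `𝒜^k(S × X, ⋆D)`, where `D` is the union of the graphs `{(z, x) | z = s i x}`. -/
def IsPolarAlongGraphs (s : ι → X → S) (w : DForm (𝓘(ℝ, ℂ).prod 𝓘(ℝ, E)) (S × X) k) : Prop :=
  IsPolar (𝓘(ℝ, ℂ).prod 𝓘(ℝ, E)) (fun (_ : ι) (q : S × X) => q.1)
    (fun (i : ι) (q : S × X) => s i q.2) w

/-- `𝒜^k(X, ⋆D⁽²⁾)`, where `D⁽²⁾` is the union of the collision loci `{x | s i x = s j x}`,
`i ≠ j`. -/
def IsPolarAlongCollisions (s : ι → X → S) (w : DForm 𝓘(ℝ, E) X k) : Prop :=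
  open Classical in
  IsPolar 𝓘(ℝ, E) (fun (c : {c : ι × ι // c.1 ≠ c.2}) => s c.1.1)
    (fun (c : {c : ι × ι // c.1 ≠ c.2}) => s c.1.2) w

/-- The collision locus `D⁽²⁾ ⊆ X`. -/
def collisionLocus (s : ι → X → S) : Set X := {x | ∃ i j, i ≠ j ∧ s i x = s j x}

/-- The finite set `D ∩ (S × {x})` of poles in the fibre over `x`. -/
def fiberPoles (s : ι → X → S) (x : X) : Finset S :=
  open Classical in Finset.univ.image (fun i => s i x)

/-- The alternating `2`-form `(a, b) ↦ L ((a, 0), (b, 0), (0, v 0), …, (0, v (k-1)))` on `ℂ`. -/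
def sliceTwoForm (L : (ℂ × E) [⋀^Fin (k + 2)]→L[ℝ] ℂ) (v : Fin k → E) : ℂ [⋀^Fin 2]→L[ℝ] ℂ where
  toFun u := L (Fin.cons (u 0, 0) (Fin.cons (u 1, 0) fun j => (0, v j)))
  map_update_add' u i a b := by
    have h0 := fun p q (m : Fin (k + 1) → ℂ × E) => L.toMultilinearMap.cons_add m p q
    have h1 := fun p q r (m : Fin k → ℂ × E) =>
      (L.toAlternatingMap.curryLeft r).toMultilinearMap.cons_add m p q
    fin_cases i
    · simpa [Function.update] using h0 (a, 0) (b, 0) _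
    · simpa [Function.update] using h1 (a, 0) (b, 0) (u 0, 0) _
  map_update_smul' u i c a := by
    have h0 := fun p (m : Fin (k + 1) → ℂ × E) => L.toMultilinearMap.cons_smul m c p
    have h1 := fun p r (m : Fin k → ℂ × E) =>
      (L.toAlternatingMap.curryLeft r).toMultilinearMap.cons_smul m c p
    fin_cases i
    · simpa [Function.update] using h0 (a, 0) _
    · simpa [Function.update] using h1 (a, 0) (u 0, 0) _
  map_eq_zero_of_eq' u i j h hij := by
    have h01 : u 0 = u 1 := by fin_cases i <;> fin_cases j <;> simp_all
    exact L.map_eq_zero_of_eq _ (i := 0) (j := 1) (by simp [h01]) (by simp)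
  cont := by
    refine L.cont.comp (continuous_pi fun i => ?_)
    refine Fin.cases ?_ (fun i => Fin.cases ?_ (fun i => ?_) i) i
    · simp only [Fin.cons_zero]; fun_prop
    · simp only [Fin.cons_succ, Fin.cons_zero]; fun_prop
    · simp only [Fin.cons_succ]; fun_prop

/-- The `2`-form `w(·, ·, v 0, …, v (k-1))` on the fibre `S × {x}`, for tangent vectors `v j` of `X`
at `x`. If `w = dz ∧ dz̄ ∧ φ`, it is `φ(v) dz ∧ dz̄`. -/
def fiberTwoForm (w : DForm (𝓘(ℝ, ℂ).prod 𝓘(ℝ, E)) (S × X) (k + 2)) (x : X)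
    (v : Fin k → E) : DForm 𝓘(ℝ, ℂ) S 2 := fun z =>
  sliceTwoForm (w (z, x)) v

/-- The push-forward `⨍_S w` of a `(k+2)`-form on `S × X`, a `k`-form on `X`: for `x` off the
collision locus, its value on `v` is the regularized integral of the `2`-form
`w(·, ·, v 0, …, v (k-1))` over the fibre at `x`. The default `0` is taken where these values do not
exist or do not form an alternating form. -/
def fiberIntegral (s : ι → X → S) (w : DForm (𝓘(ℝ, ℂ).prod 𝓘(ℝ, E)) (S × X) (k + 2)) :
    DForm 𝓘(ℝ, E) X k := fun x =>
  open Classical in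
  if h : ∃ L : E [⋀^Fin k]→L[ℝ] ℂ, ∀ v : Fin k → E,
      HasRegIntegral (fiberPoles s x) (fiberTwoForm w x v) (L v)
  then h.choose else 0

end Family

end RegInt

end

/-! Finite parts. For `g` smooth with compact support in the plane, `∂(g dz̄ / (z-p)^(n+1))` equals
`dz ∧ dz̄` times `∂_z g / (z-p)^(n+1) - (n+1) g / (z-p)^(n+2)`. Modulo exact terms the pole order
therefore drops by one each time a derivative falls on `g`, and the regularized integral of `g /
(z-p)^(n+1)` must be `(1/n!) ∫ ∂_z^n g / (z-p)`. This absolutely convergent integral is `pf n g p`;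
`hasRegIntegral_pullChart` proves by induction on `n` that it is a value of the regularized integral
on the surface.

Independence of the decomposition amounts to Stokes: if `β` is a `(0,1)`-form with poles and `∂β` is
logarithmic, then `∫ ∂β = 0` (`hasSurfaceIntegral_del`). Cut-off functions equal to `1` near the
pole that they isolate keep each `∂(σβ)` logarithmic and reduce to one pole in the plane. There `β =
b dz̄ / (z-p)^N`, and the equation for `∂β` reads `(z-p) ∂_z b - N b = (z-p)^N g`; applying `pf N`
to both sides makes the left side vanish and turns the right side into `∫ g / (z-p)`
(`integral_eq_zero_of_wirt_log`).

Poles along collisions. Over a neighbourhood of `x₀` several poles `p_i(ξ)` may merge at one point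
of the fibre. A prime ideal containing every product that omits one of the factors `y - p_i`
contains two of these factors, hence their difference; so a power of the discriminant `∏ (p_i -
p_j)` is a combination of those products (`disc_mem_radical`, `exists_partial_fractions`).
Multiplying the form by a power of the collision equation thus leaves only terms with a single
moving pole (`exists_normal_form`). Their integrals are `pf n (g ξ) (p ξ)`, a convolution of the
kernel `-1/t` with a smooth family, evaluated at the moving pole; this is smooth in `ξ`
(`IsFamily.contDiffOn_pf`). Hence a power of the collision equation times the push-forward is
smooth.

Compatibility with `∂`. The restriction of `∂w` to a fibre, contracted with vectors `v` of `X`, has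
two parts. The derivatives along the fibre give `∂` of the `(0,1)`-part of `w(·, v)`, whose
regularized integral is zero. The derivatives along `X` give a form whose regularized integral is
the derivative of the integral of `w` (`FiberFamily.hasRegIntegral_fiberDeriv`). The latter rests on
`IsFamily.dirDel_pf`: the `(1,0)`-derivative of `pf n (g ξ) (p ξ)` is given by the naive
differentiation of `g / (z-p)^(n+1)`. Holomorphy of `p` is essential here, since it keeps the
non-holomorphic derivatives of `g` out of the formula. -/

noncomputable section

namespace RegInt

open ContinuousAlternatingMap Filter

/-! ### Smoothness of the pull-back of alternating forms. -/

section AlternatingSmooth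

variable {E E' G : Type*} [NormedAddCommGroup E] [NormedSpace ℝ E] [NormedAddCommGroup E']
  [NormedSpace ℝ E'] [NormedAddCommGroup G] [NormedSpace ℝ G] {k : ℕ}

/-- The projection of multilinear maps onto alternating maps. -/
def alternatingProj : ContinuousMultilinearMap ℝ (fun _ : Fin k => E) G →L[ℝ] E [⋀^Fin k]→L[ℝ] G :=
  LinearMap.mkContinuous
    { toFun := fun f => ((k.factorial : ℝ)⁻¹) • ContinuousMultilinearMap.alternatization f
      map_add' := fun f g => by rw [map_add, smul_add]
      map_smul' := fun c f => by
        ext v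
        simp only [ContinuousAlternatingMap.smul_apply,
          ContinuousMultilinearMap.alternatization_apply_apply, _root_.smul_apply,
          RingHom.id_apply, Finset.smul_sum]
        refine Finset.sum_congr rfl fun σ _ => ?_
        rw [smul_comm (Equiv.Perm.sign σ) c, smul_comm ((k.factorial : ℝ)⁻¹) c] } 1 fun f => by
    refine ContinuousAlternatingMap.opNorm_le_bound _ (by positivity) fun v => ?_
    simp only [LinearMap.coe_mk, AddHom.coe_mk, ContinuousAlternatingMap.smul_apply,
      ContinuousMultilinearMap.alternatization_apply_apply, norm_smul, norm_inv, one_mul]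
    have h : ‖∑ σ : Equiv.Perm (Fin k), Equiv.Perm.sign σ • f (v ∘ σ)‖
        ≤ (k.factorial : ℝ) * (‖f‖ * ∏ i, ‖v i‖) := by
      refine (norm_sum_le_of_le (f := fun _ : Equiv.Perm (Fin k) => _)
        (n := fun _ => ‖f‖ * ∏ i, ‖v i‖) _ fun σ _ => ?_).trans ?_
      · have : ‖Equiv.Perm.sign σ • f (v ∘ σ)‖ = ‖f (v ∘ σ)‖ := by
          rcases Int.units_eq_one_or (Equiv.Perm.sign σ) with h | h <;> simp [h]
        rw [this]
        refine (f.le_opNorm _).trans_eq ?_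
        rw [← Equiv.prod_comp σ (fun i => ‖v i‖)]
        rfl
      · simp [Fintype.card_perm]
    calc _ ≤ ‖(k.factorial : ℝ)‖⁻¹ * ((k.factorial : ℝ) * (‖f‖ * ∏ i, ‖v i‖)) := by gcongr
      _ = _ := by
        have : (k.factorial : ℝ) ≠ 0 := by positivity
        rw [Real.norm_of_nonneg (by positivity)]
        field_simp

theorem alternatingProj_coe (f : E [⋀^Fin k]→L[ℝ] G) :
    alternatingProj f.toContinuousMultilinearMap = f := by
  ext v
  have : (k.factorial : ℝ) ≠ 0 := by positivity
  simp only [alternatingProj, LinearMap.mkContinuous_apply, LinearMap.coe_mk, AddHom.coe_mk,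
    ContinuousAlternatingMap.smul_apply, ContinuousMultilinearMap.alternatization_apply_apply]
  have h : ∀ σ : Equiv.Perm (Fin k),
      Equiv.Perm.sign σ • f.toContinuousMultilinearMap (v ∘ σ) = f v := fun σ => by
    have := f.toAlternatingMap.map_perm v σ
    change _ • f.toAlternatingMap (v ∘ σ) = _
    rw [this, smul_smul, Int.units_mul_self, one_smul]
    rfl
  simp only [h]
  simp [Fintype.card_perm, ← Nat.cast_smul_eq_nsmul ℝ, smul_smul, this]

/-- After forgetting alternation, the pull-back is linear in the form and multilinear in copies of
the linear map, hence smooth; `alternatingProj` then returns to alternating maps without changing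
the value. This is what makes smoothness of a form independent of the chart. -/
theorem contDiff_compContinuousLinearMap {n : WithTop ℕ∞} :
    ContDiff ℝ n (fun fg : (E' [⋀^Fin k]→L[ℝ] G) × (E →L[ℝ] E') =>
      fg.1.compContinuousLinearMap fg.2) := by
  have h : (fun fg : (E' [⋀^Fin k]→L[ℝ] G) × (E →L[ℝ] E') =>
      fg.1.compContinuousLinearMap fg.2) = fun fg => alternatingProj
        (ContinuousMultilinearMap.compContinuousLinearMapContinuousMultilinear ℝ
          (fun _ : Fin k => E) (fun _ : Fin k => E') G (fun _ => fg.2)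
            (ContinuousAlternatingMap.toContinuousMultilinearMapCLM ℝ fg.1)) := by
    ext1 fg
    rw [← alternatingProj_coe (fg.1.compContinuousLinearMap fg.2)]
    rfl
  rw [h]
  refine (alternatingProj (E := E) (G := G) (k := k)).contDiff.comp (ContDiff.clm_apply ?_ ?_)
  · exact (ContinuousMultilinearMap.contDiff _).comp (contDiff_pi.2 fun _ => contDiff_snd)
  · exact (ContinuousAlternatingMap.toContinuousMultilinearMapCLM (E := E') (F := G)
      (ι := Fin k) (𝕜 := ℝ) ℝ).contDiff.comp contDiff_fst

end AlternatingSmooth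

/-! ### Algebra of the complex-linear part of a real-linear map. -/

section ComplexLinearPart

variable {E F : Type*} [NormedAddCommGroup E] [NormedSpace ℂ E] [NormedSpace ℝ E]
  [IsScalarTower ℝ ℂ E] [NormedAddCommGroup F] [NormedSpace ℂ F] [NormedSpace ℝ F]
  [IsScalarTower ℝ ℂ F]

theorem complexLinearPart_apply (L : E →L[ℝ] F) (v : E) :
    complexLinearPart L v = (1 / 2 : ℝ) • (L v - Complex.I • L (Complex.I • v)) := rfl

theorem complexLinearPart_add (L L' : E →L[ℝ] F) :
    complexLinearPart (L + L') = complexLinearPart L + complexLinearPart L' := by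
  ext v; simp only [complexLinearPart_apply, _root_.add_apply, smul_add, smul_sub]; abel

theorem complexLinearPart_zero : complexLinearPart (0 : E →L[ℝ] F) = 0 := by
  ext v; simp [complexLinearPart_apply]

theorem complexLinearPart_smul (c : ℂ) (L : E →L[ℝ] F) :
    complexLinearPart (c • L) = c • complexLinearPart L := by
  ext v
  simp only [complexLinearPart_apply, _root_.smul_apply]
  rw [smul_comm Complex.I c, ← smul_sub, smul_comm c]

theorem complexLinearPart_I_smul (L : E →L[ℝ] F) (v : E) :
    complexLinearPart L (Complex.I • v) = Complex.I • complexLinearPart L v := by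
  simp only [complexLinearPart_apply, smul_smul, Complex.I_mul_I, neg_smul, one_smul, map_neg,
    smul_neg, sub_neg_eq_add]
  rw [smul_comm Complex.I (1 / 2 : ℝ), smul_sub, smul_smul, Complex.I_mul_I]
  simp [add_comm]

/-- A complex-linear map commutes with taking complex-linear parts. -/
theorem complexLinearPart_clm_comp {F' : Type*} [NormedAddCommGroup F'] [NormedSpace ℂ F']
    [NormedSpace ℝ F'] [IsScalarTower ℝ ℂ F'] (A : F →L[ℝ] F')
    (hA : ∀ v, A (Complex.I • v) = Complex.I • A v) (L : E →L[ℝ] F) :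
    complexLinearPart (A.comp L) = A.comp (complexLinearPart L) := by
  ext v
  simp [complexLinearPart_apply, hA]

theorem complexLinearPart_comp_clm {E' : Type*} [NormedAddCommGroup E'] [NormedSpace ℂ E']
    [NormedSpace ℝ E'] [IsScalarTower ℝ ℂ E'] (L : E →L[ℝ] F) (A : E' →L[ℝ] E)
    (hA : ∀ v, A (Complex.I • v) = Complex.I • A v) :
    complexLinearPart (L.comp A) = (complexLinearPart L).comp A := by
  ext v
  simp [complexLinearPart_apply, hA]

theorem complexLinearPart_eq_self (L : E →L[ℝ] F)
    (hL : ∀ v, L (Complex.I • v) = Complex.I • L v) : complexLinearPart L = L := by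
  ext v
  rw [complexLinearPart_apply, hL, smul_smul, Complex.I_mul_I, neg_one_smul, sub_neg_eq_add,
    ← two_smul ℝ, smul_smul]
  norm_num

theorem contDiff_complexLinearPart {n : WithTop ℕ∞} :
    ContDiff ℝ n (complexLinearPart : (E →L[ℝ] F) → (E →L[ℝ] F)) := by
  unfold complexLinearPart
  fun_prop

end ComplexLinearPart

/-! ### The operator `∂` on a complex normed space and its naturality. -/

section DelAt

variable {E : Type*} [NormedAddCommGroup E] [NormedSpace ℂ E] [NormedSpace ℝ E]
  [IsScalarTower ℝ ℂ E] {E' : Type*} [NormedAddCommGroup E'] [NormedSpace ℂ E'] [NormedSpace ℝ E']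
  [IsScalarTower ℝ ℂ E'] {k : ℕ}

/-- The holomorphic de Rham differential on forms on a complex normed space. -/
def delAt (w : E → E [⋀^Fin k]→L[ℝ] ℂ) (y : E) : E [⋀^Fin (k + 1)]→L[ℝ] ℂ :=
  alternatizeUncurryFin (complexLinearPart (fderiv ℝ w y))

theorem delAt_congr {w w' : E → E [⋀^Fin k]→L[ℝ] ℂ} {y : E} (h : w =ᶠ[𝓝 y] w') :
    delAt w y = delAt w' y := by
  rw [delAt, delAt, h.fderiv_eq]

theorem delAt_add {w w' : E → E [⋀^Fin k]→L[ℝ] ℂ} {y : E} (h : DifferentiableAt ℝ w y)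
    (h' : DifferentiableAt ℝ w' y) :
    delAt (fun y => w y + w' y) y = delAt w y + delAt w' y := by
  rw [delAt, delAt, delAt, fderiv_fun_add h h', complexLinearPart_add, alternatizeUncurryFin_add]

theorem delAt_const_smul {w : E → E [⋀^Fin k]→L[ℝ] ℂ} {y : E} (h : DifferentiableAt ℝ w y) (c : ℂ) :
    delAt (fun y => c • w y) y = c • delAt w y := by
  rw [delAt, delAt, fderiv_fun_const_smul h, complexLinearPart_smul, alternatizeUncurryFin_smul]

theorem contDiffAt_delAt {w : E → E [⋀^Fin k]→L[ℝ] ℂ} {y : E} (h : ContDiffAt ℝ ∞ w y) :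
    ContDiffAt ℝ ∞ (delAt w) y := by
  have h1 : ContDiffAt ℝ ∞ (fderiv ℝ w) y := h.fderiv_right (by simp)
  exact ((alternatizeUncurryFinCLM ℝ E ℂ).contDiff.comp contDiff_complexLinearPart).contDiffAt.comp
    y h1

/-- Splits the alternatization into an untwisted half and a half twisted by `i`, so that the
vanishing for symmetric second derivatives can be applied to each separately. -/
theorem alternatizeUncurryFin_complexLinearPart (L : E →L[ℝ] E [⋀^Fin k]→L[ℝ] ℂ) :
    alternatizeUncurryFin (complexLinearPart L) = (1 / 2 : ℝ) • (alternatizeUncurryFin L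
      - Complex.I • alternatizeUncurryFin (L.comp (mulI E))) := by
  ext v
  simp only [alternatizeUncurryFin_apply, complexLinearPart_apply,
    ContinuousAlternatingMap.smul_apply, ContinuousAlternatingMap.sub_apply,
    ContinuousLinearMap.comp_apply, Finset.smul_sum]
  rw [← Finset.sum_sub_distrib, Finset.smul_sum]
  refine Finset.sum_congr rfl fun i _ => ?_
  rw [smul_comm _ (1 / 2 : ℝ), smul_sub ((-1 : ℤ) ^ (i : ℕ)), smul_comm _ Complex.I]
  rfl

theorem fderiv_real_eq {f : E → E'} {x : E} (hf : DifferentiableAt ℂ f x) :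
    fderiv ℝ f x = (fderiv ℂ f x).restrictScalars ℝ :=
  hf.fderiv_restrictScalars ℝ

theorem fderiv_real_I_smul {f : E → E'} {x : E} (hf : DifferentiableAt ℂ f x) (v : E) :
    fderiv ℝ f x (Complex.I • v) = Complex.I • fderiv ℝ f x v := by
  rw [fderiv_real_eq hf]
  exact map_smul (fderiv ℂ f x) _ _

/-- `∂` commutes with pull-back under holomorphic maps. -/
theorem delAt_pullback {w : E' → E' [⋀^Fin k]→L[ℝ] ℂ} {f : E → E'} {x : E}
    (hw : DifferentiableAt ℝ w (f x)) (hf : ContDiffAt ℂ ∞ f x) :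
    delAt (fun x => (w (f x)).compContinuousLinearMap (fderiv ℝ f x)) x =
      (delAt w (f x)).compContinuousLinearMap (fderiv ℝ f x) := by
  have hfR : ContDiffAt ℝ ∞ f x := hf.restrict_scalars ℝ
  have hdf : DifferentiableAt ℝ f x := hfR.differentiableAt (by simp)
  have hd2f : DifferentiableAt ℝ (fderiv ℝ f) x :=
    (hfR.fderiv_right (m := 1) (by norm_cast)).differentiableAt (by simp)
  have hC : ∀ᶠ y in 𝓝 x, DifferentiableAt ℂ f y :=
    ((hf.of_le (m := 1) (by norm_cast)).eventually (by simp)).mono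
      fun y hy => hy.differentiableAt (by simp)
  have hsymm : ∀ u v, fderiv ℝ (fderiv ℝ f) x u v = fderiv ℝ (fderiv ℝ f) x v u := by
    have := hfR.isSymmSndFDerivAt (n := ∞) (by simp only [minSmoothness_of_isRCLikeNormedField]; norm_cast)
    exact fun u v => this u v
  -- Differentiate the identity `Df(iv) = i Df(v)`, which holds on a whole neighbourhood of `x`.
  have hI : ∀ u v, fderiv ℝ (fderiv ℝ f) x u (Complex.I • v)
      = Complex.I • fderiv ℝ (fderiv ℝ f) x u v := by
    intro u v
    have e : (fun y => fderiv ℝ f y (Complex.I • v)) =ᶠ[𝓝 x]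
        fun y => Complex.I • fderiv ℝ f y v := hC.mono fun y hy => fderiv_real_I_smul hy v
    have h1 := e.fderiv_eq (𝕜 := ℝ)
    rw [fderiv_fun_const_smul (by fun_prop), fderiv_clm_apply hd2f (by fun_prop),
      fderiv_clm_apply hd2f (by fun_prop)] at h1
    simpa using congrArg (fun L => L u) h1
  rw [delAt, fderiv_continuousAlternatingMapCompContinuousLinearMap
    (f := fun x => w (f x)) (hw.comp x hdf) hd2f, complexLinearPart_add, alternatizeUncurryFin_add,
    show fderiv ℝ (fun x => w (f x)) x = _ from fderiv_comp x hw hdf]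
  -- The second-order term disappears: `D²f` is symmetric, and `(u, v) ↦ D²f(iu, v)` is symmetric
  -- too because `D²f` is complex-linear in each argument.
  have h2 : alternatizeUncurryFin (complexLinearPart
      ((w (f x)).fderivCompContinuousLinearMap (fderiv ℝ f x) ∘L fderiv ℝ (fderiv ℝ f) x)) = 0 := by
    rw [alternatizeUncurryFin_complexLinearPart,
      alternatizeUncurryFin_fderivCompContinuousLinearMap_eq_zero _ _ hsymm,
      ContinuousLinearMap.comp_assoc, alternatizeUncurryFin_fderivCompContinuousLinearMap_eq_zero]
    · simp
    · intro u v
      change fderiv ℝ (fderiv ℝ f) x (Complex.I • u) v = fderiv ℝ (fderiv ℝ f) x (Complex.I • v) u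
      rw [hsymm, hI, hsymm, hsymm _ u, hI, hsymm]
  rw [h2, add_zero, ← ContinuousLinearMap.comp_assoc,
    complexLinearPart_comp_clm _ _ (fderiv_real_I_smul hC.self_of_nhds),
    complexLinearPart_clm_comp _ (fun v => by rfl)]
  ext v
  simp +unfoldPartialApp [delAt, alternatizeUncurryFin_apply, Fin.removeNth, Function.comp_def]

end DelAt

end RegInt
end

noncomputable section

namespace RegInt

open ContinuousAlternatingMap Filter

/-! ### Forms on manifolds with holomorphic transition maps, read in charts. -/

section FormsOnManifolds

variable {E : Type*} [NormedAddCommGroup E] [NormedSpace ℂ E] [NormedSpace ℝ E]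
  [IsScalarTower ℝ ℂ E] {H : Type*} [TopologicalSpace H] {I : ModelWithCorners ℝ E H}
  {M : Type*} [TopologicalSpace M] [ChartedSpace H M] {k : ℕ}

/-- The changes of coordinates of the preferred charts are holomorphic. -/
def HolAtlas (I : ModelWithCorners ℝ E H) (M : Type*) [TopologicalSpace M] [ChartedSpace H M] :
    Prop :=
  ∀ p q : M, ∀ y ∈ (extChartAt I p).target, (extChartAt I p).symm y ∈ (extChartAt I q).source →
    ContDiffAt ℂ ∞ (extChartAt I q ∘ (extChartAt I p).symm) y

theorem fderiv_chart_self [I.Boundaryless] (p : M) {y : E} (hy : y ∈ (extChartAt I p).target) :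
    fderiv ℝ (extChartAt I p ∘ (extChartAt I p).symm) y = ContinuousLinearMap.id ℝ E := by
  have : (extChartAt I p ∘ (extChartAt I p).symm) =ᶠ[𝓝 y] id := by
    filter_upwards [(isOpen_extChartAt_target p).mem_nhds hy] with z hz
    exact (extChartAt I p).right_inv hz
  rw [this.fderiv_eq, fderiv_id]

theorem inChart_self [I.Boundaryless] (w : DForm I M k) (p : M) :
    inChart I w p (extChartAt I p p) = w p := by
  have h : (extChartAt I p).symm (extChartAt I p p) = p := extChartAt_to_inv p
  unfold inChart
  rw [h, fderiv_chart_self p (mem_extChartAt_target p)]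
  ext v; simp [Function.comp_def]

theorem eventually_mem_chart [I.Boundaryless] {p q : M} {y : E} (hy : y ∈ (extChartAt I p).target)
    (hq : (extChartAt I p).symm y ∈ (extChartAt I q).source) :
    ∀ᶠ z in 𝓝 y, z ∈ (extChartAt I p).target ∧
      (extChartAt I p).symm z ∈ (extChartAt I q).source := by
  refine ((isOpen_extChartAt_target p).mem_nhds hy |> fun h => ?_)
  have h2 : ContinuousAt (extChartAt I p).symm y := continuousAt_extChartAt_symm'' hy
  exact Filter.Eventually.and h (h2.eventually ((isOpen_extChartAt_source q).mem_nhds hq))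

theorem HolAtlas.differentiableAt (hM : HolAtlas I M) {p q : M} {y : E}
    (hy : y ∈ (extChartAt I p).target) (hq : (extChartAt I p).symm y ∈ (extChartAt I q).source) :
    DifferentiableAt ℝ (extChartAt I q ∘ (extChartAt I p).symm) y :=
  ((hM p q y hy hq).differentiableAt (by simp)).restrictScalars ℝ

variable [I.Boundaryless]

/-- Change of charts for forms. -/
theorem inChart_change (hM : HolAtlas I M) (w : DForm I M k) {p q : M} {y : E}
    (hy : y ∈ (extChartAt I p).target) (hq : (extChartAt I p).symm y ∈ (extChartAt I q).source) :
    inChart I w p y =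
      (inChart I w q ((extChartAt I q ∘ (extChartAt I p).symm) y)).compContinuousLinearMap
        (fderiv ℝ (extChartAt I q ∘ (extChartAt I p).symm) y) := by
  have hinv : (extChartAt I q).symm (extChartAt I q ((extChartAt I p).symm y)) =
    (extChartAt I p).symm y := (extChartAt I q).left_inv hq
  have hty : extChartAt I q ((extChartAt I p).symm y) ∈ (extChartAt I q).target :=
    (extChartAt I q).map_source hq
  unfold inChart
  rw [Function.comp_apply, hinv]
  set r := (extChartAt I p).symm y with hr
  have e : (extChartAt I r ∘ (extChartAt I p).symm) =ᶠ[𝓝 y]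
      (extChartAt I r ∘ (extChartAt I q).symm) ∘ (extChartAt I q ∘ (extChartAt I p).symm) := by
    filter_upwards [eventually_mem_chart hy hq] with z hz
    simp only [Function.comp_apply]
    rw [(extChartAt I q).left_inv hz.2]
  rw [e.fderiv_eq, fderiv_comp]
  · rfl
  · refine hM.differentiableAt hty ?_
    rw [Function.comp_apply, ← hr, hinv]
    exact mem_extChartAt_source r
  · exact hM.differentiableAt hy hq

theorem eq_comp_inChart (hM : HolAtlas I M) (w : DForm I M k) {p q : M}
    (hq : q ∈ (extChartAt I p).source) :
    w q = (inChart I w p (extChartAt I p q)).compContinuousLinearMap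
      (fderiv ℝ (extChartAt I p ∘ (extChartAt I q).symm) (extChartAt I q q)) := by
  have h : (extChartAt I q).symm (extChartAt I q q) = q := extChartAt_to_inv q
  rw [← inChart_self w q, inChart_change hM w (mem_extChartAt_target q) (q := p) (by rwa [h]),
    Function.comp_apply, h]

theorem inChart_injective (hM : HolAtlas I M) {w w' : DForm I M k} {p q : M}
    (hq : q ∈ (extChartAt I p).source)
    (h : inChart I w p (extChartAt I p q) = inChart I w' p (extChartAt I p q)) : w q = w' q := by
  rw [eq_comp_inChart hM w hq, eq_comp_inChart hM w' hq, h]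

theorem inChart_congr_point {w w' : DForm I M k} {p : M} {y : E}
    (h : w ((extChartAt I p).symm y) = w' ((extChartAt I p).symm y)) :
    inChart I w p y = inChart I w' p y := by
  unfold inChart; rw [h]

theorem contDiffAt_inChart_of (hM : HolAtlas I M) {w : DForm I M k} {p q : M} {y : E}
    (hy : y ∈ (extChartAt I p).target) (hq : (extChartAt I p).symm y ∈ (extChartAt I q).source)
    (h : ContDiffAt ℝ ∞ (inChart I w q) (extChartAt I q ((extChartAt I p).symm y))) :
    ContDiffAt ℝ ∞ (inChart I w p) y := by
  have hτ : ContDiffAt ℝ ∞ (extChartAt I q ∘ (extChartAt I p).symm) y :=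
    (hM p q y hy hq).restrict_scalars ℝ
  have e : inChart I w p =ᶠ[𝓝 y] fun y =>
      (inChart I w q ((extChartAt I q ∘ (extChartAt I p).symm) y)).compContinuousLinearMap
        (fderiv ℝ (extChartAt I q ∘ (extChartAt I p).symm) y) := by
    filter_upwards [eventually_mem_chart hy hq] with z hz
    exact inChart_change hM w hz.1 hz.2
  refine ContDiffAt.congr_of_eventuallyEq ?_ e
  exact contDiff_compContinuousLinearMap.contDiffAt.comp y
    ((h.comp y hτ).prodMk (hτ.fderiv_right (m := ∞) (by simp)))

theorem smoothFormAt_iff (hM : HolAtlas I M) {w : DForm I M k} {p q : M}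
    (hq : q ∈ (extChartAt I p).source) :
    SmoothFormAt I w q ↔ ContDiffAt ℝ ∞ (inChart I w p) (extChartAt I p q) := by
  constructor
  · intro h
    have h1 : (extChartAt I p).symm (extChartAt I p q) = q := (extChartAt I p).left_inv hq
    refine contDiffAt_inChart_of hM (q := q) ((extChartAt I p).map_source hq) ?_ ?_
    · rw [h1]; exact mem_extChartAt_source q
    · rwa [h1]
  · intro h
    have h1 : (extChartAt I q).symm (extChartAt I q q) = q := extChartAt_to_inv q
    refine contDiffAt_inChart_of hM (q := p) (mem_extChartAt_target q) ?_ ?_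
    · rwa [h1]
    · rwa [h1]

theorem contDiffAt_inChart_iff (hM : HolAtlas I M) {w : DForm I M k} {p : M} {y : E}
    (hy : y ∈ (extChartAt I p).target) :
    ContDiffAt ℝ ∞ (inChart I w p) y ↔ SmoothFormAt I w ((extChartAt I p).symm y) := by
  rw [smoothFormAt_iff hM ((extChartAt I p).map_target hy), (extChartAt I p).right_inv hy]

theorem inChart_congr {w w' : DForm I M k} {p : M} {y : E}
    (hy : y ∈ (extChartAt I p).target) (h : w =ᶠ[𝓝 ((extChartAt I p).symm y)] w') :
    inChart I w p =ᶠ[𝓝 y] inChart I w' p := by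
  have h2 : ContinuousAt (extChartAt I p).symm y := continuousAt_extChartAt_symm'' hy
  filter_upwards [h2.eventually h] with z hz
  exact inChart_congr_point hz

theorem SmoothFormAt.congr {w w' : DForm I M k} {p : M} (hw : SmoothFormAt I w p)
    (h : w =ᶠ[𝓝 p] w') : SmoothFormAt I w' p := by
  refine ContDiffAt.congr_of_eventuallyEq hw
    (inChart_congr (mem_extChartAt_target p) ?_).symm
  rwa [extChartAt_to_inv]

theorem del_eq_delAt (w : DForm I M k) (p : M) :
    del I w p = delAt (inChart I w p) (extChartAt I p p) := rfl

theorem del_congr {w w' : DForm I M k} {p : M} (h : w =ᶠ[𝓝 p] w') :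
    del I w p = del I w' p := by
  rw [del_eq_delAt, del_eq_delAt]
  refine delAt_congr (inChart_congr (mem_extChartAt_target p) ?_)
  rwa [extChartAt_to_inv]

/-- The holomorphic de Rham differential can be computed in any preferred chart. -/
theorem inChart_del (hM : HolAtlas I M) {w : DForm I M k} {p : M} {y : E}
    (hy : y ∈ (extChartAt I p).target) (hw : ContDiffAt ℝ ∞ (inChart I w p) y) :
    inChart I (del I w) p y = delAt (inChart I w p) y := by
  set r := (extChartAt I p).symm y with hr
  have hrs : (extChartAt I p).symm y ∈ (extChartAt I r).source := mem_extChartAt_source r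
  have e : inChart I w p =ᶠ[𝓝 y] fun y =>
      (inChart I w r ((extChartAt I r ∘ (extChartAt I p).symm) y)).compContinuousLinearMap
        (fderiv ℝ (extChartAt I r ∘ (extChartAt I p).symm) y) := by
    filter_upwards [eventually_mem_chart hy hrs] with z hz
    exact inChart_change hM w hz.1 hz.2
  have hwr : SmoothFormAt I w r := (contDiffAt_inChart_iff hM hy).1 hw
  have hd : DifferentiableAt ℝ (inChart I w r) ((extChartAt I r ∘ (extChartAt I p).symm) y) :=
    ContDiffAt.differentiableAt hwr (by simp)
  -- At the point `r` the operator `del` is by definition computed in the chart at `r`; naturality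
  -- of `∂` under the transition map carries it to the chart at `p`.
  rw [delAt_congr e, delAt_pullback hd (hM p r y hy hrs)]
  rfl

theorem smoothFormAt_del (hM : HolAtlas I M) {w : DForm I M k} {p : M}
    (hw : ∀ᶠ q in 𝓝 p, SmoothFormAt I w q) : SmoothFormAt I (del I w) p := by
  have h1 : ContDiffAt ℝ ∞ (delAt (inChart I w p)) (extChartAt I p p) :=
    contDiffAt_delAt hw.self_of_nhds
  refine h1.congr_of_eventuallyEq ?_
  have h2 : ContinuousAt (extChartAt I p).symm (extChartAt I p p) :=
    continuousAt_extChartAt_symm p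
  have h3 := h2.eventually (p := fun q => SmoothFormAt I w q) (by rwa [extChartAt_to_inv])
  filter_upwards [(isOpen_extChartAt_target p).mem_nhds (mem_extChartAt_target p), h3] with y hy hs
  exact inChart_del hM hy ((contDiffAt_inChart_iff hM hy).2 hs)

theorem inChart_add (w w' : DForm I M k) (p : M) (y : E) :
    inChart I (w + w') p y = inChart I w p y + inChart I w' p y := rfl

theorem inChart_smul (c : M → ℂ) (w : DForm I M k) (p : M) (y : E) :
    inChart I (fun q => c q • w q) p y = c ((extChartAt I p).symm y) • inChart I w p y := rfl

theorem inChart_sum {κ : Type*} (t : Finset κ) (w : κ → DForm I M k) (p : M) (y : E) :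
    inChart I (fun q => ∑ j ∈ t, w j q) p y = ∑ j ∈ t, inChart I (w j) p y := by
  unfold inChart
  ext v
  simp [ContinuousAlternatingMap.sum_apply]

open Classical in
/-- The pull-back of a form on the model space by the preferred chart at `p`, extended by `0`. -/
def pullChart (I : ModelWithCorners ℝ E H) (p : M) (η : E → E [⋀^Fin k]→L[ℝ] ℂ) : DForm I M k :=
  fun q => if q ∈ (extChartAt I p).source then
    (η (extChartAt I p q)).compContinuousLinearMap
      (fderiv ℝ (extChartAt I p ∘ (extChartAt I q).symm) (extChartAt I q q)) else 0

/-- The transition maps between the chart at `p` and the chart at the running point are mutually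
inverse, so their derivatives cancel by the chain rule. -/
theorem inChart_pullChart (hM : HolAtlas I M) (p : M) (η : E → E [⋀^Fin k]→L[ℝ] ℂ) {y : E}
    (hy : y ∈ (extChartAt I p).target) : inChart I (pullChart I p η) p y = η y := by
  have hs := (extChartAt I p).map_target hy
  unfold inChart
  set r := (extChartAt I p).symm y with hr
  rw [pullChart, if_pos hs, hr, (extChartAt I p).right_inv hy]
  have h1 : (extChartAt I r).symm (extChartAt I r r) = r := extChartAt_to_inv r
  have hd : DifferentiableAt ℝ (extChartAt I p ∘ (extChartAt I r).symm)
      ((extChartAt I r ∘ (extChartAt I p).symm) y) := by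
    refine hM.differentiableAt (mem_extChartAt_target r) ?_
    exact h1.symm ▸ hs
  have hd' : DifferentiableAt ℝ (extChartAt I r ∘ (extChartAt I p).symm) y :=
    hM.differentiableAt hy (mem_extChartAt_source r)
  have e : (extChartAt I p ∘ (extChartAt I r).symm) ∘ (extChartAt I r ∘ (extChartAt I p).symm)
      =ᶠ[𝓝 y] id := by
    filter_upwards [eventually_mem_chart hy (mem_extChartAt_source r)] with z hz
    simp only [Function.comp_apply]
    rw [(extChartAt I r).left_inv hz.2, (extChartAt I p).right_inv hz.1, id]
  have h2 := e.fderiv_eq (𝕜 := ℝ)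
  rw [fderiv_comp _ hd hd', fderiv_id] at h2
  ext v
  simp only [ContinuousAlternatingMap.compContinuousLinearMap_apply]
  congr 1
  ext1 i
  exact congrArg (fun L => L (v i)) h2

theorem pullChart_apply_of_notMem {p q : M} (η : E → E [⋀^Fin k]→L[ℝ] ℂ)
    (hq : q ∉ (extChartAt I p).source) : pullChart I p η q = 0 := if_neg hq

/-- A form is determined by its expression in a chart, if it vanishes off the domain. -/
theorem eq_pullChart (hM : HolAtlas I M) {w : DForm I M k} {p q : M} {η : E → E [⋀^Fin k]→L[ℝ] ℂ}
    (h0 : q ∉ (extChartAt I p).source → w q = 0)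
    (h : q ∈ (extChartAt I p).source → inChart I w p (extChartAt I p q) = η (extChartAt I p q)) :
    w q = pullChart I p η q := by
  by_cases hq : q ∈ (extChartAt I p).source
  · refine inChart_injective hM hq ?_
    rw [h hq, inChart_pullChart hM p η ((extChartAt I p).map_source hq)]
  · rw [h0 hq, pullChart_apply_of_notMem η hq]

theorem smoothFormAt_pullChart (hM : HolAtlas I M) {p q : M} {η : E → E [⋀^Fin k]→L[ℝ] ℂ}
    (hq : q ∈ (extChartAt I p).source) (hη : ContDiffAt ℝ ∞ η (extChartAt I p q)) :
    SmoothFormAt I (pullChart I p η) q := by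
  rw [smoothFormAt_iff hM hq]
  refine hη.congr_of_eventuallyEq ?_
  filter_upwards [(isOpen_extChartAt_target p).mem_nhds ((extChartAt I p).map_source hq)] with y hy
  exact inChart_pullChart hM p η hy

theorem smoothFormAt_zero (p : M) : SmoothFormAt I (0 : DForm I M k) p := by
  have : inChart I (0 : DForm I M k) p = fun _ => 0 := by
    ext y v; simp [inChart]
  rw [SmoothFormAt, this]
  exact contDiffAt_const

theorem SmoothFormAt.add {w w' : DForm I M k} {p : M} (h : SmoothFormAt I w p)
    (h' : SmoothFormAt I w' p) : SmoothFormAt I (w + w') p :=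
  ContDiffAt.add h h'

/-- A function on a manifold is smooth at `p`, read in the preferred chart at `p`. -/
def SmoothFunAt (I : ModelWithCorners ℝ E H) (c : M → ℂ) (p : M) : Prop :=
  ContDiffAt ℝ ∞ (fun y => c ((extChartAt I p).symm y)) (extChartAt I p p)

theorem SmoothFormAt.smul {w : DForm I M k} {c : M → ℂ} {p : M} (hc : SmoothFunAt I c p)
    (h : SmoothFormAt I w p) : SmoothFormAt I (fun q => c q • w q) p :=
  ContDiffAt.smul hc h

theorem SmoothFormAt.sum {κ : Type*} (t : Finset κ) {w : κ → DForm I M k} {p : M}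
    (h : ∀ j ∈ t, SmoothFormAt I (w j) p) : SmoothFormAt I (fun q => ∑ j ∈ t, w j q) p := by
  have : inChart I (fun q => ∑ j ∈ t, w j q) p = fun y => ∑ j ∈ t, inChart I (w j) p y :=
    funext fun y => inChart_sum t w p y
  rw [SmoothFormAt, this]
  exact ContDiffAt.sum h

theorem smoothFunAt_const (c : ℂ) (p : M) : SmoothFunAt I (fun _ => c) p := contDiffAt_const

theorem del_add {w w' : DForm I M k} {p : M} (h : SmoothFormAt I w p)
    (h' : SmoothFormAt I w' p) : del I (w + w') p = del I w p + del I w' p := by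
  have e : inChart I (w + w') p = fun y => inChart I w p y + inChart I w' p y := rfl
  have h1 : DifferentiableAt ℝ (inChart I w p) (extChartAt I p p) :=
    ContDiffAt.differentiableAt h (by simp)
  have h2 : DifferentiableAt ℝ (inChart I w' p) (extChartAt I p p) :=
    ContDiffAt.differentiableAt h' (by simp)
  rw [del_eq_delAt, e, delAt_add h1 h2]
  rfl

theorem del_zero (p : M) : del I (0 : DForm I M k) p = 0 := by
  have : inChart I (0 : DForm I M k) p = fun _ => 0 := by
    ext y v; simp [inChart]
  rw [del_eq_delAt, this, delAt, fderiv_const_apply, complexLinearPart_zero,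
    ← alternatizeUncurryFinCLM_apply, _root_.map_zero]

theorem del_sum {κ : Type*} (t : Finset κ) {w : κ → DForm I M k} {p : M}
    (h : ∀ j ∈ t, SmoothFormAt I (w j) p) :
    del I (fun q => ∑ j ∈ t, w j q) p = ∑ j ∈ t, del I (w j) p := by
  classical
  induction t using Finset.induction_on with
  | empty => exact del_zero p
  | insert a t ha ih =>
    rw [Finset.sum_insert ha, ← ih fun j hj => h j (Finset.mem_insert_of_mem hj),
      ← del_add (h a (Finset.mem_insert_self a t))
        (SmoothFormAt.sum t fun j hj => h j (Finset.mem_insert_of_mem hj))]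
    congr 1
    ext1 q
    simp [Finset.sum_insert ha]

theorem del_const_smul {w : DForm I M k} {p : M} (h : SmoothFormAt I w p) (c : ℂ) :
    del I (fun q => c • w q) p = c • del I w p := by
  have e : inChart I (fun q => c • w q) p = fun y => c • inChart I w p y := rfl
  have h1 : DifferentiableAt ℝ (inChart I w p) (extChartAt I p p) :=
    ContDiffAt.differentiableAt h (by simp)
  rw [del_eq_delAt, e, delAt_const_smul h1]
  rfl

end FormsOnManifolds

end RegInt
end

noncomputable section

namespace RegInt

open ContinuousAlternatingMap Filter

/-! ### Holomorphic charts of complex manifolds and of the product. -/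

section Charts

variable {E : Type*} [NormedAddCommGroup E] [NormedSpace ℂ E]
  {S : Type*} [TopologicalSpace S] [ChartedSpace ℂ S]
  {X : Type*} [TopologicalSpace X] [ChartedSpace E X]

/-- The extended charts for the real and for the complex model are the same maps, so the analytic
coordinate changes of the complex structure serve for the real one. -/
theorem holAtlas_of_isManifold [IsManifold 𝓘(ℂ, E) ω X] : HolAtlas 𝓘(ℝ, E) X := by
  intro p q y hy hq
  have h : ContDiffWithinAt ℂ ω (extChartAt 𝓘(ℂ, E) q ∘ (extChartAt 𝓘(ℂ, E) p).symm)
      (Set.range 𝓘(ℂ, E)) y := by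
    refine contDiffWithinAt_ext_coord_change q p ?_
    rw [PartialEquiv.trans_source, PartialEquiv.symm_source]
    exact ⟨hy, hq⟩
  rw [ModelWithCorners.range_eq_univ, contDiffWithinAt_univ] at h
  exact h.of_le le_top

theorem holAtlas_prod (hS : HolAtlas 𝓘(ℝ, ℂ) S) (hX : HolAtlas 𝓘(ℝ, E) X) :
    HolAtlas (𝓘(ℝ, ℂ).prod 𝓘(ℝ, E)) (S × X) := by
  intro p q y hy hq
  rw [extChartAt_prod] at hy hq
  have h1 := hS p.1 q.1 y.1 hy.1 hq.1
  have h2 := hX p.2 q.2 y.2 hy.2 hq.2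
  exact (h1.comp (g := _) (f := Prod.fst) y contDiffAt_fst).prodMk
    (h2.comp (g := _) (f := Prod.snd) y contDiffAt_snd)

theorem contDiffAt_chart_comp [IsManifold 𝓘(ℂ, E) ω X] [IsManifold 𝓘(ℂ, ℂ) ω S] {s : X → S}
    (hs : ContMDiff 𝓘(ℂ, E) 𝓘(ℂ, ℂ) ω s) (x : X) (z : S) {y : E} (hy : y ∈ (chartAt E x).target)
    (hz : s ((chartAt E x).symm y) ∈ (chartAt ℂ z).source) :
    ContDiffAt ℂ ∞ (fun y => chartAt ℂ z (s ((chartAt E x).symm y))) y := by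
  have h1 : ContMDiffAt 𝓘(ℂ, E) 𝓘(ℂ, E) ω (chartAt E x).symm y :=
    (contMDiffOn_chart_symm (n := ω) (I := 𝓘(ℂ, E)) (x := x)).contMDiffAt
      ((chartAt E x).open_target.mem_nhds hy)
  have h2 : ContMDiffAt 𝓘(ℂ, ℂ) 𝓘(ℂ, ℂ) ω (chartAt ℂ z) (s ((chartAt E x).symm y)) :=
    (contMDiffOn_chart (n := ω) (I := 𝓘(ℂ, ℂ)) (x := z)).contMDiffAt
      ((chartAt ℂ z).open_source.mem_nhds hz)
  have h3 : ContDiffAt ℂ ω (fun y => chartAt ℂ z (s ((chartAt E x).symm y))) y :=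
    (h2.comp (I' := 𝓘(ℂ, ℂ)) y ((hs ((chartAt E x).symm y)).comp y h1)).contDiffAt
  exact h3.of_le le_top

end Charts

/-! ### `∂` preserves forms with poles. -/

section PolarDel

variable {E : Type*} [NormedAddCommGroup E] [NormedSpace ℂ E] [NormedSpace ℝ E]
  [IsScalarTower ℝ ℂ E] {k : ℕ}

theorem fderiv_pow_smul {G : E → ℂ} {W : E → E [⋀^Fin k]→L[ℝ] ℂ} {y : E}
    (hG : DifferentiableAt ℝ G y) (hW : DifferentiableAt ℝ W y) (N : ℕ) :
    G y • fderiv ℝ (fun y => G y ^ N • W y) y = (G y ^ (N + 1)) • fderiv ℝ W y +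
      (N : ℂ) • (G y ^ N) • (fderiv ℝ G y).smulRight (W y) := by
  have h2 := fderiv_fun_smul (hG.pow N) hW
  have h : (fun y => G y ^ N • W y) = fun y => (G ^ N) y • W y := rfl
  rw [h, h2, fderiv_pow _ hG]
  ext v u
  simp only [ContinuousAlternatingMap.smul_apply, ContinuousLinearMap.smulRight_apply,
    _root_.add_apply, ContinuousAlternatingMap.add_apply, _root_.smul_apply, smul_eq_mul,
    Pi.pow_apply, nsmul_eq_mul]
  rcases N with _ | N
  · simp
  · simp only [Nat.add_sub_cancel, pow_succ]; ring

/-- In the Leibniz expansions of `∂(G^N W)` and `∂(G^(N+1) W)` the terms with `∂G ∧ W` carry the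
factors `N G^(N-1)` and `(N+1) G^N`; this combination cancels them. It expresses `G^(N+1) ∂W`
through `∂` of forms that are smooth when `G^N W` is, without introducing a wedge product. -/
theorem pow_smul_delAt {G : E → ℂ} {W : E → E [⋀^Fin k]→L[ℝ] ℂ} {y : E}
    (hG : DifferentiableAt ℝ G y) (hW : DifferentiableAt ℝ W y) (N : ℕ) :
    G y ^ (N + 1) • delAt W y = ((N : ℂ) + 1) • G y • delAt (fun y => G y ^ N • W y) y
      - (N : ℂ) • delAt (fun y => G y • G y ^ N • W y) y := by
  have hV : DifferentiableAt ℝ (fun y => G y ^ N • W y) y := (hG.pow N).smul hW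
  have h1 := fderiv_pow_smul hG hW N
  have h2 := fderiv_fun_smul hG hV
  unfold delAt
  simp only [← alternatizeUncurryFin_smul, ← complexLinearPart_smul]
  rw [← alternatizeUncurryFinCLM_apply, ← alternatizeUncurryFinCLM_apply,
    ← alternatizeUncurryFinCLM_apply, sub_eq_add_neg, ← _root_.map_neg, ← _root_.map_add,
    ← neg_one_smul ℂ, ← complexLinearPart_smul, ← complexLinearPart_add, h2]
  congr 2
  rw [smul_add, h1]
  ext v u
  simp only [ContinuousAlternatingMap.smul_apply, ContinuousLinearMap.smulRight_apply,
    _root_.add_apply, ContinuousAlternatingMap.add_apply, _root_.smul_apply, smul_eq_mul]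
  ring

variable {H : Type*} [TopologicalSpace H] {I : ModelWithCorners ℝ E H} [I.Boundaryless]
  {M : Type*} [TopologicalSpace M] [ChartedSpace H M]
  {S : Type*} [TopologicalSpace S] [ChartedSpace ℂ S] {κ : Type*} [Fintype κ]

theorem SmoothFunAt.prod {κ : Type*} (t : Finset κ) {c : κ → M → ℂ} {p : M}
    (h : ∀ j ∈ t, SmoothFunAt I (c j) p) : SmoothFunAt I (fun q => ∏ j ∈ t, c j q) p := by
  unfold SmoothFunAt
  exact contDiffAt_prod h

/-- Near `p` the two maps in each factor take values in one chart domain, where the chart is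
injective. -/
theorem localEq_ne_zero {a b : κ → M → S} (ha : ∀ j, Continuous (a j)) (hb : ∀ j, Continuous (b j))
    (p : M) : ∀ᶠ q in 𝓝 p, (∀ j, a j q ≠ b j q) → localEq a b p q ≠ 0 := by
  classical
  have h1 : ∀ᶠ q in 𝓝 p, ∀ j, a j q ∈ (chartAt ℂ (a j p)).source :=
    eventually_all.2 fun j => (ha j).continuousAt.eventually
      ((chartAt ℂ (a j p)).open_source.mem_nhds (mem_chart_source ℂ (a j p)))
  have h2 : ∀ᶠ q in 𝓝 p, ∀ j, b j q ∈ (chartAt ℂ (b j p)).source :=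
    eventually_all.2 fun j => (hb j).continuousAt.eventually
      ((chartAt ℂ (b j p)).open_source.mem_nhds (mem_chart_source ℂ (b j p)))
  filter_upwards [h1, h2] with q h1 h2 hq
  rw [localEq, Finset.prod_ne_zero_iff]
  intro j hj
  replace hj := (Finset.mem_filter.1 hj)
  rw [sub_ne_zero]
  intro h
  exact hq j ((chartAt ℂ (a j p)).injOn (h1 j) (by rw [hj.2]; exact h2 j) h)

theorem eventually_off [T2Space S] {a b : κ → M → S} (ha : ∀ j, Continuous (a j))
    (hb : ∀ j, Continuous (b j)) {q : M} (hq : ∀ j, a j q ≠ b j q) :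
    ∀ᶠ r in 𝓝 q, ∀ j, a j r ≠ b j r :=
  eventually_all.2 fun j =>
    (isClosed_eq (ha j) (hb j)).isOpen_compl.mem_nhds (show q ∈ {x | a j x = b j x}ᶜ from hq j)

theorem smoothFormAt_of_pole {w η : DForm I M k} {g : M → ℂ} {N : ℕ} {q : M}
    (hg : SmoothFunAt I g q) (hη : SmoothFormAt I η q) (h0 : g q ≠ 0)
    (h : ∀ᶠ r in 𝓝 q, g r ^ N • w r = η r) : SmoothFormAt I w q := by
  have h1 : SmoothFormAt I (fun r => (g r ^ N)⁻¹ • η r) q := by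
    refine SmoothFormAt.smul ?_ hη
    refine ContDiffAt.inv (hg.pow N) (pow_ne_zero _ ?_)
    rwa [extChartAt_to_inv]
  refine h1.congr ?_
  have h2 : ∀ᶠ y in 𝓝 (extChartAt I q q), g ((extChartAt I q).symm y) ≠ 0 := by
    refine ContDiffAt.continuousAt hg |>.eventually_ne ?_
    rwa [extChartAt_to_inv]
  have h3 : ∀ᶠ r in 𝓝 q, g r ≠ 0 := by
    have := (continuousAt_extChartAt (I := I) q).eventually h2
    filter_upwards [this, extChartAt_source_mem_nhds (I := I) q] with r hr hs
    rwa [(extChartAt I q).left_inv hs] at hr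
  filter_upwards [h, h3] with r hr hr0
  rw [← hr, smul_smul, inv_mul_cancel₀ (pow_ne_zero _ hr0), one_smul]

/-- `∂` preserves the forms with poles. -/
theorem isPolar_del (hM : HolAtlas I M) [T2Space S] {a b : κ → M → S}
    (ha : ∀ j, Continuous (a j)) (hb : ∀ j, Continuous (b j))
    (hg : ∀ p, ∀ᶠ q in 𝓝 p, SmoothFunAt I (localEq a b p) q) {w : DForm I M k}
    (hw : IsPolar I a b w) : IsPolar I a b (del I w) := by
  intro p
  obtain ⟨N, η, hη⟩ := hw p
  set g := localEq a b p with hgdef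
  -- The witness is the right-hand side of `pow_smul_delAt` with `g ^ N • w` replaced by its smooth
  -- extension `η`; the order of the pole grows by one.
  refine ⟨N + 1, (fun q => (((N : ℂ) + 1) * g q) • del I η q) +
    (fun q => (-(N : ℂ)) • del I (fun r => g r • η r) q), ?_⟩
  filter_upwards [hη.eventually_nhds, (hg p).eventually_nhds, localEq_ne_zero ha hb p]
    with q hq hgq hne
  have hηs : ∀ᶠ r in 𝓝 q, SmoothFormAt I η r := hq.mono fun r hr => hr.1
  refine ⟨SmoothFormAt.add ?_ ?_, fun hoff => ?_⟩
  · exact SmoothFormAt.smul (contDiffAt_const.mul hgq.self_of_nhds) (smoothFormAt_del hM hηs)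
  · refine SmoothFormAt.smul (smoothFunAt_const _ _) (smoothFormAt_del hM ?_)
    filter_upwards [hηs, hgq] with r h1 h2 using SmoothFormAt.smul h2 h1
  · have he : ∀ᶠ r in 𝓝 q, g r ^ N • w r = η r := by
      filter_upwards [hq, eventually_off ha hb hoff] with r h1 h2 using h1.2 h2
    have hws : SmoothFormAt I w q :=
      smoothFormAt_of_pole hgq.self_of_nhds hηs.self_of_nhds (hne hoff) he
    have hG : DifferentiableAt ℝ (fun y => g ((extChartAt I q).symm y)) (extChartAt I q q) :=
      ContDiffAt.differentiableAt hgq.self_of_nhds (by simp)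
    have hW : DifferentiableAt ℝ (inChart I w q) (extChartAt I q q) :=
      ContDiffAt.differentiableAt hws (by simp)
    have key := pow_smul_delAt hG hW N
    have e1 : del I η q = delAt (fun y => g ((extChartAt I q).symm y) ^ N • inChart I w q y)
        (extChartAt I q q) := by
      rw [← del_congr he]; rfl
    have e2 : del I (fun r => g r • η r) q = delAt (fun y => g ((extChartAt I q).symm y) •
        g ((extChartAt I q).symm y) ^ N • inChart I w q y) (extChartAt I q q) := by
      rw [← del_congr (w := fun r => g r • g r ^ N • w r)]
      · rfl
      · filter_upwards [he] with r hr
        rw [hr]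
    simp only [extChartAt_to_inv] at key
    change g q ^ (N + 1) • del I w q = (((N : ℂ) + 1) * g q) • del I η q +
      (-(N : ℂ)) • del I (fun r => g r • η r) q
    rw [e1, e2, mul_smul]
    refine (key.trans (sub_eq_add_neg _ _)).trans ?_
    congr 1
    exact (neg_smul _ _).symm

end PolarDel

/-! ### Poles along graphs of holomorphic maps. -/

section Family

variable {E : Type*} [NormedAddCommGroup E] [NormedSpace ℂ E]
  {S : Type*} [TopologicalSpace S] [ChartedSpace ℂ S] [T2Space S] [IsManifold 𝓘(ℂ, ℂ) ω S]
  {X : Type*} [TopologicalSpace X] [ChartedSpace E X] [IsManifold 𝓘(ℂ, E) ω X]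
  {ι : Type*} [Fintype ι] {k : ℕ}

theorem smoothFunAt_localEq_graphs {s : ι → X → S}
    (hs : ∀ i, ContMDiff 𝓘(ℂ, E) 𝓘(ℂ, ℂ) ω (s i)) (p : S × X) :
    ∀ᶠ q in 𝓝 p, SmoothFunAt (𝓘(ℝ, ℂ).prod 𝓘(ℝ, E))
      (localEq (fun (_ : ι) (q : S × X) => q.1) (fun i q => s i q.2) p) q := by
  classical
  have h1 : ∀ᶠ q in 𝓝 p, q.1 ∈ (chartAt ℂ p.1).source :=
    continuous_fst.continuousAt.eventually
      ((chartAt ℂ p.1).open_source.mem_nhds (mem_chart_source ℂ p.1))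
  have h2 : ∀ᶠ q in 𝓝 p, ∀ i, p.1 = s i p.2 → s i q.2 ∈ (chartAt ℂ p.1).source := by
    refine eventually_all.2 fun i => ?_
    by_cases hi : p.1 = s i p.2
    · have hc : Continuous fun q : S × X => s i q.2 := (hs i).continuous.comp continuous_snd
      filter_upwards [hc.continuousAt.eventually ((chartAt ℂ p.1).open_source.mem_nhds
        (show s i p.2 ∈ _ by rw [← hi]; exact mem_chart_source ℂ p.1))] with q hq _ using hq
    · exact Eventually.of_forall fun q h => absurd h hi
  filter_upwards [h1, h2] with q h1 h2
  refine SmoothFunAt.prod _ fun i hi => ?_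
  replace hi := (Finset.mem_filter.1 hi)
  refine ContDiffAt.sub ?_ ?_
  · have := (holAtlas_of_isManifold (X := S) q.1 p.1 (chartAt ℂ q.1 q.1)
      (mem_extChartAt_target (I := 𝓘(ℝ, ℂ)) q.1)
      (by simpa using h1)).restrict_scalars ℝ
    exact this.comp (g := _) (f := Prod.fst) (extChartAt (𝓘(ℝ, ℂ).prod 𝓘(ℝ, E)) q q)
      contDiffAt_fst
  · have := (contDiffAt_chart_comp (hs i) q.2 p.1 (mem_chart_target E q.2)
      (by rw [(chartAt E q.2).left_inv (mem_chart_source E q.2)]; exact h2 i hi.2)).restrict_scalars ℝ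
    exact this.comp (g := _) (f := Prod.snd) (extChartAt (𝓘(ℝ, ℂ).prod 𝓘(ℝ, E)) q q)
      contDiffAt_snd

theorem isPolarAlongGraphs_del {s : ι → X → S} (hs : ∀ i, ContMDiff 𝓘(ℂ, E) 𝓘(ℂ, ℂ) ω (s i))
    {w : DForm (𝓘(ℝ, ℂ).prod 𝓘(ℝ, E)) (S × X) k} (hw : IsPolarAlongGraphs s w) :
    IsPolarAlongGraphs s (del (𝓘(ℝ, ℂ).prod 𝓘(ℝ, E)) w) :=
  isPolar_del (holAtlas_prod holAtlas_of_isManifold holAtlas_of_isManifold)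
    (fun _ => continuous_fst) (fun i => (hs i).continuous.comp continuous_snd)
    (smoothFunAt_localEq_graphs hs) hw

end Family

end RegInt
end

noncomputable section

namespace RegInt

open Filter MeasureTheory

/-! ### Finite-part integrals in the plane. -/

section Wirtinger

variable {F : Type*} [NormedAddCommGroup F] [NormedSpace ℂ F] [NormedSpace ℝ F]
  [IsScalarTower ℝ ℂ F]

/-- The Wirtinger derivative `∂g/∂z`. -/
def wirt (g : ℂ → F) (z : ℂ) : F := complexLinearPart (fderiv ℝ g z) 1

theorem wirt_apply (g : ℂ → F) (z : ℂ) :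
    wirt g z = (1 / 2 : ℝ) • (fderiv ℝ g z 1 - Complex.I • fderiv ℝ g z Complex.I) := by
  rw [wirt, complexLinearPart_apply, smul_eq_mul, mul_one]

theorem wirt_congr {g h : ℂ → F} {z : ℂ} (e : g =ᶠ[𝓝 z] h) : wirt g z = wirt h z := by
  rw [wirt, wirt, e.fderiv_eq]

theorem wirt_add {g h : ℂ → F} {z : ℂ} (hg : DifferentiableAt ℝ g z) (hh : DifferentiableAt ℝ h z) :
    wirt (fun z => g z + h z) z = wirt g z + wirt h z := by
  rw [wirt, fderiv_fun_add hg hh, complexLinearPart_add]; rfl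

theorem wirt_const_smul {g : ℂ → F} {z : ℂ} (hg : DifferentiableAt ℝ g z) (c : ℂ) :
    wirt (fun z => c • g z) z = c • wirt g z := by
  rw [wirt, fderiv_fun_const_smul hg, complexLinearPart_smul]; rfl

theorem wirt_smul {c : ℂ → ℂ} {g : ℂ → F} {z : ℂ} (hc : DifferentiableAt ℝ c z)
    (hg : DifferentiableAt ℝ g z) :
    wirt (fun z => c z • g z) z = c z • wirt g z + wirt c z • g z := by
  simp only [wirt_apply, fderiv_fun_smul hc hg, _root_.add_apply, _root_.smul_apply,
    ContinuousLinearMap.smulRight_apply, smul_add, smul_sub, sub_smul, smul_smul, smul_assoc,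
    smul_eq_mul]
  rw [smul_comm (c z) (1 / 2 : ℝ), smul_comm (c z) (1 / 2 : ℝ), smul_smul, mul_comm (c z) Complex.I]
  abel

theorem wirt_of_holomorphic {c : ℂ → ℂ} {z : ℂ} (hc : DifferentiableAt ℂ c z) :
    wirt c z = deriv c z := by
  rw [wirt, complexLinearPart_eq_self _ (fderiv_real_I_smul hc), fderiv_real_eq hc]
  simp

theorem wirt_sub_const (p z : ℂ) : wirt (fun z => z - p) z = 1 := by
  rw [wirt_of_holomorphic (by fun_prop)]
  simp

theorem contDiff_wirt {g : ℂ → F} (hg : ContDiff ℝ ∞ g) : ContDiff ℝ ∞ (wirt g) := by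
  have h : ContDiff ℝ ∞ (fderiv ℝ g) := hg.fderiv_right (by simp)
  exact (contDiff_complexLinearPart.comp h).clm_apply contDiff_const

/-- Smooth functions of compact support on the plane. -/
structure IsTest (g : ℂ → F) : Prop where
  smooth : ContDiff ℝ ∞ g
  compact : HasCompactSupport g

theorem IsTest.wirt {g : ℂ → F} (hg : IsTest g) : IsTest (wirt g) := by
  refine ⟨contDiff_wirt hg.smooth, ?_⟩
  have := hg.compact.fderiv ℝ
  refine this.comp_left (g := fun L : ℂ →L[ℝ] F => complexLinearPart L 1) ?_
  simp [complexLinearPart_zero]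

theorem IsTest.wirt_iterate {g : ℂ → F} (hg : IsTest g) (n : ℕ) : IsTest (RegInt.wirt^[n] g) := by
  induction n generalizing g with
  | zero => exact hg
  | succ n ih => exact ih hg.wirt

theorem IsTest.differentiable {g : ℂ → F} (hg : IsTest g) : Differentiable ℝ g :=
  hg.smooth.differentiable (by simp)

theorem IsTest.smul {c : ℂ → ℂ} {g : ℂ → F} (hc : ContDiff ℝ ∞ c) (hg : IsTest g) :
    IsTest (fun z => c z • g z) :=
  ⟨hc.smul hg.smooth, hg.compact.smul_left⟩

theorem IsTest.const_smul {g : ℂ → F} (hg : IsTest g) (c : ℂ) : IsTest (fun z => c • g z) :=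
  IsTest.smul contDiff_const hg

theorem IsTest.sub {g h : ℂ → F} (hg : IsTest g) (hh : IsTest h) : IsTest (fun z => g z - h z) :=
  ⟨hg.smooth.sub hh.smooth, hg.compact.sub hh.compact⟩

theorem IsTest.clm_comp {F' : Type*} [NormedAddCommGroup F'] [NormedSpace ℂ F'] [NormedSpace ℝ F']
    [IsScalarTower ℝ ℂ F'] (A : F →L[ℝ] F') {g : ℂ → F} (hg : IsTest g) :
    IsTest (fun z => A (g z)) :=
  ⟨A.contDiff.comp hg.smooth, hg.compact.comp_left (map_zero A)⟩

theorem IsTest.integrable {g : ℂ → F} (hg : IsTest g) : Integrable g :=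
  hg.smooth.continuous.integrable_of_hasCompactSupport hg.compact

/-- Integration by parts against the constant function `1`. -/
theorem integral_fderiv_apply_eq_zero [CompleteSpace F] {g : ℂ → F} (hg : IsTest g) (v : ℂ) :
    ∫ z, fderiv ℝ g z v = 0 := by
  have hi : Integrable fun z => fderiv ℝ g z v :=
    ((hg.smooth.continuous_fderiv (by simp)).clm_apply
      continuous_const).integrable_of_hasCompactSupport
      ((hg.compact.fderiv ℝ).comp_left (g := fun L : ℂ →L[ℝ] F => L v) (by simp))
  have := integral_smul_fderiv_eq_neg_fderiv_smul_of_integrable (μ := volume)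
    (f := fun _ : ℂ => (1 : ℝ)) (g := g) (v := v) (by simp) (by simpa using hi)
    (by simpa using hg.integrable) (fun _ _ => by fun_prop) (fun x _ => hg.differentiable x)
  simpa using this

theorem integral_wirt [CompleteSpace F] {g : ℂ → F} (hg : IsTest g) : ∫ z, wirt g z = 0 := by
  have hi : ∀ v, Integrable fun z => fderiv ℝ g z v := fun v =>
    ((hg.smooth.continuous_fderiv (by simp)).clm_apply
      continuous_const).integrable_of_hasCompactSupport
      ((hg.compact.fderiv ℝ).comp_left (g := fun L : ℂ →L[ℝ] F => L v) (by simp))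
  simp only [wirt_apply]
  have hi' : Integrable fun z => Complex.I • fderiv ℝ g z Complex.I := (hi _).smul Complex.I
  rw [integral_smul, integral_sub (hi _) hi', integral_smul,
    integral_fderiv_apply_eq_zero hg, integral_fderiv_apply_eq_zero hg]
  simp

/-- The integral of `‖z‖⁻¹ exp(-‖z‖)` over the plane has a known nonzero value, so the function is
integrable; multiplying by the continuous function `exp ‖z‖` keeps local integrability. -/
theorem locallyIntegrable_inv : LocallyIntegrable (fun z : ℂ => z⁻¹) := by
  have h1 : Integrable (fun z : ℂ => ‖z‖ ^ (-1 : ℝ) * Real.exp (-‖z‖ ^ (1 : ℝ))) := by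
    refine Integrable.of_integral_ne_zero ?_
    rw [Complex.integral_rpow_mul_exp_neg_rpow le_rfl (by norm_num)]
    norm_num
  have h2 : LocallyIntegrable (fun z : ℂ => Real.exp ‖z‖ * (‖z‖ ^ (-1 : ℝ) *
      Real.exp (-‖z‖ ^ (1 : ℝ)))) := by
    rw [← locallyIntegrableOn_univ] at *
    exact (h1.locallyIntegrable.locallyIntegrableOn _).continuousOn_mul (by fun_prop)
      isOpen_univ.isLocallyClosed
  refine h2.mono (by fun_prop) (Eventually.of_forall fun z => ?_)
  have : Real.exp ‖z‖ * (‖z‖ ^ (-1 : ℝ) * Real.exp (-‖z‖ ^ (1 : ℝ))) = ‖z‖⁻¹ := by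
    rw [Real.rpow_one, Real.rpow_neg_one, mul_left_comm, ← Real.exp_add]
    simp
  rw [this, norm_inv, norm_inv, norm_norm]

theorem locallyIntegrable_inv_sub (p : ℂ) : LocallyIntegrable (fun z : ℂ => (z - p)⁻¹) := by
  intro x
  obtain ⟨s, hs, hi⟩ := locallyIntegrable_inv (x - p)
  refine ⟨(fun z => z - p) ⁻¹' s, (continuous_sub_right p).continuousAt.preimage_mem_nhds hs, ?_⟩
  exact ((measurePreserving_sub_right volume p).integrableOn_comp_preimage
    (Homeomorph.subRight p).measurableEmbedding).2 hi

theorem integrable_inv_smul {g : ℂ → F} (hg : Continuous g) (hc : HasCompactSupport g) (p : ℂ) :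
    Integrable (fun z => (z - p)⁻¹ • g z) :=
  (locallyIntegrable_inv_sub p).integrable_smul_right_of_hasCompactSupport hg hc

/-- The regularized integral of `g / (z - p) ^ (n + 1)` over the plane. -/
def pf (n : ℕ) (g : ℂ → F) (p : ℂ) : F :=
  ((n.factorial : ℂ)⁻¹) • ∫ z, (z - p)⁻¹ • (wirt^[n] g) z

theorem pf_zero (g : ℂ → F) (p : ℂ) : pf 0 g p = ∫ z, (z - p)⁻¹ • g z := by
  simp [pf]

theorem pf_succ (n : ℕ) (g : ℂ → F) (p : ℂ) :
    pf (n + 1) g p = ((n : ℂ) + 1)⁻¹ • pf n (wirt g) p := by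
  rw [pf, pf, smul_smul, Function.iterate_succ_apply, Nat.factorial_succ]
  push_cast
  rw [mul_inv]

/-- The Leibniz rule stops after two terms because `z - p` is affine with `∂_z`-derivative `1`. -/
theorem wirt_iterate_sub_smul {g : ℂ → F} (hg : IsTest g) (p : ℂ) (n : ℕ) :
    wirt^[n + 1] (fun z => (z - p) • g z) =
      fun z => (z - p) • (wirt^[n + 1] g) z + ((n : ℂ) + 1) • (wirt^[n] g) z := by
  have hl : ContDiff ℝ ∞ (fun z : ℂ => z - p) := by fun_prop
  have step : ∀ {h : ℂ → F}, IsTest h →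
      wirt (fun z => (z - p) • h z) = fun z => (z - p) • wirt h z + h z := fun {h} hh => by
    ext z
    rw [wirt_smul (by fun_prop) (hh.differentiable z), wirt_sub_const, one_smul]
  induction n with
  | zero => simpa using step hg
  | succ n ih =>
    rw [Function.iterate_succ_apply', ih]
    ext z
    have h1 := hg.wirt_iterate (n + 1)
    have h0 := hg.wirt_iterate n
    rw [wirt_add ((IsTest.smul hl h1).differentiable z) ((h0.const_smul _).differentiable z),
      wirt_const_smul (h0.differentiable z), step h1, ← Function.iterate_succ_apply' wirt n,
      ← Function.iterate_succ_apply' wirt (n + 1)]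
    push_cast
    module

/-- The finite part respects the cancellation of a factor `z - p`. In the Leibniz expansion the
first term, divided by `z - p`, is a total derivative and integrates to zero; the factor `n + 1` of
the second turns `(n+1)!` into `n!`. -/
theorem pf_sub_smul [CompleteSpace F] {g : ℂ → F} (hg : IsTest g) (p : ℂ) (n : ℕ) :
    pf (n + 1) (fun z => (z - p) • g z) p = pf n g p := by
  have h1 := hg.wirt_iterate (n + 1)
  have h0 := hg.wirt_iterate n
  have e : ∀ᵐ z : ℂ, (z - p)⁻¹ • ((z - p) • (wirt^[n + 1] g) z + ((n : ℂ) + 1) • (wirt^[n] g) z)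
      = wirt (wirt^[n] g) z + ((n : ℂ) + 1) • ((z - p)⁻¹ • (wirt^[n] g) z) := by
    have : ∀ᵐ z : ℂ, z ≠ p := by simp [ae_iff, measure_singleton]
    filter_upwards [this] with z hz
    rw [smul_add, smul_smul, inv_mul_cancel₀ (sub_ne_zero.2 hz), one_smul, smul_comm,
      Function.iterate_succ_apply']
  have hi : Integrable fun z => ((n : ℂ) + 1) • ((z - p)⁻¹ • (wirt^[n] g) z) :=
    (integrable_inv_smul h0.smooth.continuous h0.compact p).smul _
  rw [pf, wirt_iterate_sub_smul hg, integral_congr_ae e, integral_add h0.wirt.integrable hi, integral_wirt h0, zero_add,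
    integral_smul, smul_smul, pf, Nat.factorial_succ]
  congr 1
  have : (n : ℂ) + 1 ≠ 0 := by exact_mod_cast n.succ_ne_zero
  push_cast
  field_simp

theorem pf_pow_smul [CompleteSpace F] {g : ℂ → F} (hg : IsTest g) (p : ℂ) (n : ℕ) :
    pf n (fun z => (z - p) ^ n • g z) p = pf 0 g p := by
  induction n with
  | zero => simp
  | succ n ih =>
    have e : (fun z => (z - p) ^ (n + 1) • g z) = fun z => (z - p) • ((z - p) ^ n • g z) :=
      funext fun z => by rw [smul_smul, pow_succ']
    rw [e, pf_sub_smul (IsTest.smul (by fun_prop) hg), ih]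

theorem pf_sub [CompleteSpace F] {g h : ℂ → F} (hg : IsTest g) (hh : IsTest h) (n : ℕ) (p : ℂ) :
    pf n (fun z => g z - h z) p = pf n g p - pf n h p := by
  have e : ∀ n : ℕ, wirt^[n] (fun z => g z - h z) = fun z => (wirt^[n] g) z - (wirt^[n] h) z := by
    intro n
    induction n with
    | zero => rfl
    | succ n ih =>
      rw [Function.iterate_succ_apply', ih]
      ext z
      have h1 := (hg.wirt_iterate n).differentiable z
      have h2 := (hh.wirt_iterate n).differentiable z
      rw [wirt_apply, fderiv_fun_sub h1 h2, Function.iterate_succ_apply',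
        Function.iterate_succ_apply']
      simp only [wirt_apply, _root_.sub_apply, smul_sub]
      abel
  have h1 := hg.wirt_iterate n
  have h2 := hh.wirt_iterate n
  simp only [pf, e, smul_sub]
  rw [integral_sub (integrable_inv_smul h1.smooth.continuous h1.compact p)
    (integrable_inv_smul h2.smooth.continuous h2.compact p), smul_sub]

theorem pf_const_smul (g : ℂ → F) (hg : IsTest g) (n : ℕ) (p c : ℂ) :
    pf n (fun z => c • g z) p = c • pf n g p := by
  have e : ∀ n : ℕ, wirt^[n] (fun z => c • g z) = fun z => c • (wirt^[n] g) z := by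
    intro n
    induction n with
    | zero => rfl
    | succ n ih =>
      rw [Function.iterate_succ_apply', ih]
      ext z
      rw [wirt_const_smul ((hg.wirt_iterate n).differentiable z), Function.iterate_succ_apply']
  simp only [pf, e]
  have h : ∫ z, (z - p)⁻¹ • c • (wirt^[n] g) z = c • ∫ z, (z - p)⁻¹ • (wirt^[n] g) z := by
    rw [← integral_smul]
    exact integral_congr_ae (Eventually.of_forall fun z => smul_comm (z - p)⁻¹ c ((wirt^[n] g) z))
  rw [h, smul_comm]

/-- If the `∂`-derivative of `b / (z - p) ^ N` is `g / (z - p)`, the integral of the latter is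
zero. -/
theorem integral_eq_zero_of_wirt_log [CompleteSpace F] {b g : ℂ → F} (hb : IsTest b) (hg : IsTest g)
    (p : ℂ) (N : ℕ)
    (h : ∀ z, z ≠ p → (z - p) • wirt b z - (N : ℂ) • b z = (z - p) ^ N • g z) :
    ∫ z, (z - p)⁻¹ • g z = 0 := by
  have hl : ContDiff ℝ ∞ (fun z : ℂ => z - p) := by fun_prop
  have t1 : IsTest fun z => (z - p) • wirt b z := IsTest.smul hl hb.wirt
  have t2 : IsTest fun z => (N : ℂ) • b z := hb.const_smul _
  have t3 : IsTest fun z => (z - p) ^ N • g z := IsTest.smul (hl.pow N) hg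
  -- The equation is needed at `p` too, since `pf` differentiates both sides as functions on the
  -- plane; both sides are continuous and the complement of `p` is dense.
  have e : (fun z => (z - p) • wirt b z - (N : ℂ) • b z) = fun z => (z - p) ^ N • g z :=
    (t1.sub t2).smooth.continuous.ext_on (dense_compl_singleton p) t3.smooth.continuous h
  -- Evaluate `pf N` on both sides. For `N > 0`, cancelling `z - p` in the first term on the left
  -- and integrating the second by parts both give `pf (N - 1)` of `∂_z b`; for `N = 0` only a total
  -- derivative remains.
  rw [← pf_zero, ← pf_pow_smul hg p N, ← e, pf_sub t1 t2, pf_const_smul _ hb]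
  rcases N with _ | N
  · rw [pf_zero, ← integral_wirt hb]
    simp only [Nat.cast_zero, zero_smul, sub_zero]
    refine integral_congr_ae ?_
    have : ∀ᵐ z : ℂ, z ≠ p := by simp [ae_iff, measure_singleton]
    filter_upwards [this] with z hz
    rw [smul_smul, inv_mul_cancel₀ (sub_ne_zero.2 hz), one_smul]
  · rw [pf_sub_smul hb.wirt, pf_succ, smul_smul]
    have : (N : ℂ) + 1 ≠ 0 := by exact_mod_cast N.succ_ne_zero
    push_cast
    rw [mul_inv_cancel₀ this, one_smul, sub_self]

/-- Allows the finite part to be taken of form-valued functions and evaluated on tangent vectors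
afterwards. -/
theorem pf_clm [CompleteSpace F] {F' : Type*} [NormedAddCommGroup F'] [NormedSpace ℂ F']
    [NormedSpace ℝ F'] [IsScalarTower ℝ ℂ F'] [CompleteSpace F'] (A : F →L[ℂ] F') {g : ℂ → F}
    (hg : IsTest g) (n : ℕ) (p : ℂ) : A (pf n g p) = pf n (fun z => A (g z)) p := by
  have e : ∀ n : ℕ, wirt^[n] (fun z => A (g z)) = fun z => A ((wirt^[n] g) z) := by
    intro n
    induction n with
    | zero => rfl
    | succ n ih =>
      rw [Function.iterate_succ_apply', ih, Function.iterate_succ_apply']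
      ext z
      have hd := (hg.wirt_iterate n).differentiable z
      have : fderiv ℝ (fun z => A ((wirt^[n] g) z)) z =
          (A.restrictScalars ℝ).comp (fderiv ℝ (wirt^[n] g) z) :=
        ((A.restrictScalars ℝ).hasFDerivAt.comp z hd.hasFDerivAt).fderiv
      rw [wirt, this, complexLinearPart_clm_comp _ (fun v => map_smul A _ _)]
      rfl
  have h1 := hg.wirt_iterate n
  have hi := integrable_inv_smul h1.smooth.continuous h1.compact p
  simp only [pf, e, map_smul]
  congr 1
  have := (A.restrictScalars ℝ).integral_comp_comm hi
  simp only [ContinuousLinearMap.coe_restrictScalars', map_smul] at this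
  exact this.symm

end Wirtinger

end RegInt
end

noncomputable section

namespace RegInt

open Filter MeasureTheory

/-! ### Differentiation of finite parts with respect to parameters and a moving pole. -/

section Parametric

variable {E : Type*} [NormedAddCommGroup E] [NormedSpace ℂ E] [NormedSpace ℝ E]
  [IsScalarTower ℝ ℂ E] {F : Type*} [NormedAddCommGroup F] [NormedSpace ℂ F] [NormedSpace ℝ F]
  [IsScalarTower ℝ ℂ F]

/-- The derivative of type `(1,0)` in the direction `a`. -/
def dirDel (G : E → F) (a y : E) : F := complexLinearPart (fderiv ℝ G y) a

theorem dirDel_congr {G G' : E → F} {y : E} (a : E) (h : G =ᶠ[𝓝 y] G') :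
    dirDel G a y = dirDel G' a y := by
  rw [dirDel, dirDel, h.fderiv_eq]

theorem dirDel_add {G G' : E → F} {y : E} (a : E) (h : DifferentiableAt ℝ G y)
    (h' : DifferentiableAt ℝ G' y) :
    dirDel (fun y => G y + G' y) a y = dirDel G a y + dirDel G' a y := by
  rw [dirDel, fderiv_fun_add h h', complexLinearPart_add]; rfl

theorem dirDel_const_smul {G : E → F} {y : E} (a : E) (h : DifferentiableAt ℝ G y) (c : ℂ) :
    dirDel (fun y => c • G y) a y = c • dirDel G a y := by
  rw [dirDel, fderiv_fun_const_smul h, complexLinearPart_smul]; rfl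

theorem dirDel_smul {c : E → ℂ} {G : E → F} {y : E} (a : E) (hc : DifferentiableAt ℝ c y)
    (hG : DifferentiableAt ℝ G y) :
    dirDel (fun y => c y • G y) a y = c y • dirDel G a y + dirDel c a y • G y := by
  simp only [dirDel, complexLinearPart_apply, fderiv_fun_smul hc hG, _root_.add_apply,
    _root_.smul_apply, ContinuousLinearMap.smulRight_apply, smul_add, smul_sub, sub_smul, smul_smul,
    smul_assoc, smul_eq_mul]
  rw [smul_comm (c y) (1 / 2 : ℝ), smul_comm (c y) (1 / 2 : ℝ), smul_smul, mul_comm (c y) Complex.I]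
  abel

theorem dirDel_of_holomorphic {c : E → F} {y : E} (a : E) (hc : DifferentiableAt ℂ c y) :
    dirDel c a y = fderiv ℝ c y a := by
  rw [dirDel, complexLinearPart_eq_self _ (fderiv_real_I_smul hc)]

theorem dirDel_sum {κ : Type*} (t : Finset κ) {G : κ → E → F} {y : E} (a : E)
    (h : ∀ j ∈ t, DifferentiableAt ℝ (G j) y) :
    dirDel (fun y => ∑ j ∈ t, G j y) a y = ∑ j ∈ t, dirDel (G j) a y := by
  simp only [dirDel, complexLinearPart_apply, fderiv_fun_sum h, _root_.sum_apply,
    Finset.smul_sum, ← Finset.sum_sub_distrib]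

theorem contDiffAt_dirDel {G : E → F} {y : E} (h : ContDiffAt ℝ ∞ G y) (a : E) :
    ContDiffAt ℝ ∞ (dirDel G a) y := by
  have h1 : ContDiffAt ℝ ∞ (fderiv ℝ G) y := h.fderiv_right (by simp)
  exact (contDiff_complexLinearPart.contDiffAt.comp y h1).clm_apply contDiffAt_const

/-- The derivatives of type `(1,0)` are combinations with constant coefficients of real directional
derivatives, so this is the symmetry of the second derivative. -/
theorem dirDel_comm {G : E → F} {y : E} (h : ContDiffAt ℝ ∞ G y) (a b : E) :
    dirDel (dirDel G a) b y = dirDel (dirDel G b) a y := by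
  have hd : DifferentiableAt ℝ (fderiv ℝ G) y :=
    (h.fderiv_right (m := 1) (by norm_cast)).differentiableAt (by simp)
  have hs : ∀ u v, fderiv ℝ (fderiv ℝ G) y u v = fderiv ℝ (fderiv ℝ G) y v u := fun u v =>
    (h.isSymmSndFDerivAt (by simp only [minSmoothness_of_isRCLikeNormedField]; norm_cast)) u v
  have key : ∀ a u, fderiv ℝ (dirDel G a) y u = (1 / 2 : ℝ) • (fderiv ℝ (fderiv ℝ G) y u a -
      Complex.I • fderiv ℝ (fderiv ℝ G) y u (Complex.I • a)) := by
    intro a u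
    have e : dirDel G a = fun y => (1 / 2 : ℝ) • (fderiv ℝ G y a -
      Complex.I • fderiv ℝ G y (Complex.I • a)) := rfl
    have d : ∀ a, DifferentiableAt ℝ (fun y => fderiv ℝ G y a) y := fun a =>
      hd.clm_apply (differentiableAt_const a)
    have f : ∀ a u, fderiv ℝ (fun y => fderiv ℝ G y a) y u = fderiv ℝ (fderiv ℝ G) y u a := by
      intro a u
      rw [fderiv_clm_apply hd (differentiableAt_const a)]
      simp
    have d1 : DifferentiableAt ℝ (fun y => Complex.I • fderiv ℝ G y (Complex.I • a)) y :=
      (d _).const_smul Complex.I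
    have d2 : DifferentiableAt ℝ (fun y => fderiv ℝ G y a -
      Complex.I • fderiv ℝ G y (Complex.I • a)) y := (d _).sub d1
    rw [e, fderiv_fun_const_smul d2, fderiv_fun_sub (d _) d1, fderiv_fun_const_smul (d _)]
    simp [f]
  rw [dirDel, dirDel, complexLinearPart_apply, complexLinearPart_apply, key, key, key, key]
  rw [hs b a, hs b (Complex.I • a), hs (Complex.I • b) a, hs (Complex.I • b) (Complex.I • a)]
  simp only [smul_sub, smul_comm Complex.I (1 / 2 : ℝ)]
  abel

/-- Smooth families of functions on the plane, parametrized by `U`, with supports in `K`. -/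
structure IsFamily (U : Set E) (K : Set ℂ) (g : E → ℂ → F) : Prop where
  smooth : ContDiffOn ℝ ∞ (Function.uncurry g) (U ×ˢ Set.univ)
  zero : ∀ x ∈ U, ∀ z ∉ K, g x z = 0

variable {U : Set E} {K : Set ℂ} {g : E → ℂ → F}

theorem IsFamily.contDiffAt (hU : IsOpen U) (hg : IsFamily U K g) {x : E} (hx : x ∈ U) (z : ℂ) :
    ContDiffAt ℝ ∞ (Function.uncurry g) (x, z) :=
  hg.smooth.contDiffAt ((hU.prod isOpen_univ).mem_nhds ⟨hx, trivial⟩)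

theorem IsFamily.isTest (hU : IsOpen U) (hK : IsCompact K) (hg : IsFamily U K g) {x : E}
    (hx : x ∈ U) : IsTest (g x) := by
  refine ⟨contDiff_iff_contDiffAt.2 fun z => ?_, HasCompactSupport.intro hK (hg.zero x hx)⟩
  exact (hg.contDiffAt hU hx z).comp (f := fun z => (x, z)) z (by fun_prop)

/-- Reading the slice derivative as a directional derivative in the product gives its joint
smoothness and lets it commute with derivatives in the parameter. -/
theorem wirt_eq_dirDel {x : E} {z : ℂ} (h : DifferentiableAt ℝ (Function.uncurry g) (x, z)) :
    wirt (g x) z = dirDel (Function.uncurry g) (0, 1) (x, z) := by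
  have : fderiv ℝ (g x) z = (fderiv ℝ (Function.uncurry g) (x, z)).comp
      (ContinuousLinearMap.inr ℝ E ℂ) := by
    have h1 : HasFDerivAt (fun z : ℂ => (x, z)) (ContinuousLinearMap.inr ℝ E ℂ) z :=
      hasFDerivAt_prodMk_right x z
    exact (h.hasFDerivAt.comp z h1).fderiv
  rw [wirt, this, complexLinearPart_comp_clm _ _ (fun v => by simp)]
  simp [dirDel]

theorem dirDel_slice_eq {x : E} {z : ℂ} (h : DifferentiableAt ℝ (Function.uncurry g) (x, z))
    (v : E) : dirDel (fun x => g x z) v x = dirDel (Function.uncurry g) (v, 0) (x, z) := by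
  have : fderiv ℝ (fun x => g x z) x = (fderiv ℝ (Function.uncurry g) (x, z)).comp
      (ContinuousLinearMap.inl ℝ E ℂ) := by
    have h1 : HasFDerivAt (fun x : E => (x, z)) (ContinuousLinearMap.inl ℝ E ℂ) x :=
      hasFDerivAt_prodMk_left x z
    exact (h.hasFDerivAt.comp x h1).fderiv
  rw [dirDel, this, complexLinearPart_comp_clm _ _ (fun v => by simp)]
  simp [dirDel]

theorem IsFamily.dirDel_uncurry (hU : IsOpen U) (hg : IsFamily U K g) (a : E × ℂ) :
    ContDiffOn ℝ ∞ (dirDel (Function.uncurry g) a) (U ×ˢ Set.univ) := fun y hy =>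
  (contDiffAt_dirDel (hg.contDiffAt hU hy.1 y.2) a).contDiffWithinAt

theorem IsFamily.wirt (hU : IsOpen U) (hK : IsCompact K) (hg : IsFamily U K g) :
    IsFamily U K (fun x => RegInt.wirt (g x)) := by
  refine ⟨(hg.dirDel_uncurry hU (0, 1)).congr fun y hy => ?_, fun x hx z hz => ?_⟩
  · exact wirt_eq_dirDel ((hg.contDiffAt hU hy.1 y.2).differentiableAt (by simp))
  · have : g x =ᶠ[𝓝 z] fun _ => 0 := by
      filter_upwards [hK.isClosed.isOpen_compl.mem_nhds hz] with y hy using hg.zero x hx y hy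
    rw [wirt_congr this, RegInt.wirt, fderiv_const_apply, complexLinearPart_zero]; rfl

theorem IsFamily.dirDel (hU : IsOpen U) (hg : IsFamily U K g) (v : E) :
    IsFamily U K (fun x z => dirDel (fun x => g x z) v x) := by
  refine ⟨(hg.dirDel_uncurry hU (v, 0)).congr fun y hy => ?_, fun x hx z hz => ?_⟩
  · exact dirDel_slice_eq ((hg.contDiffAt hU hy.1 y.2).differentiableAt (by simp)) v
  · have : (fun x => g x z) =ᶠ[𝓝 x] fun _ => 0 := by
      filter_upwards [hU.mem_nhds hx] with y hy using hg.zero y hy z hz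
    rw [dirDel_congr v this, RegInt.dirDel, fderiv_const_apply, complexLinearPart_zero]; rfl

theorem IsFamily.wirt_iterate (hU : IsOpen U) (hK : IsCompact K) (hg : IsFamily U K g) (n : ℕ) :
    IsFamily U K (fun x => RegInt.wirt^[n] (g x)) := by
  induction n with
  | zero => exact hg
  | succ n ih =>
    simp only [Function.iterate_succ_apply']
    exact ih.wirt hU hK

theorem IsFamily.dirDel_wirt (hU : IsOpen U) (hg : IsFamily U K g) {x : E}
    (hx : x ∈ U) (z : ℂ) (v : E) :
    RegInt.dirDel (fun x => RegInt.wirt (g x) z) v x =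
      RegInt.wirt (fun z => RegInt.dirDel (fun x => g x z) v x) z := by
  have hd : ∀ x' ∈ U, ∀ z', DifferentiableAt ℝ (Function.uncurry g) (x', z') := fun x' hx' z' =>
    (hg.contDiffAt hU hx' z').differentiableAt (by simp)
  have hc := hg.contDiffAt hU hx z
  have hd2 : ∀ a, DifferentiableAt ℝ (RegInt.dirDel (Function.uncurry g) a) (x, z) := fun a =>
    (contDiffAt_dirDel hc a).differentiableAt (by simp)
  have e1 : (fun x => RegInt.wirt (g x) z) =ᶠ[𝓝 x]
      fun x => RegInt.dirDel (Function.uncurry g) (0, 1) (x, z) := by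
    filter_upwards [hU.mem_nhds hx] with x' hx' using wirt_eq_dirDel (hd x' hx' z)
  have e2 : (fun z => RegInt.dirDel (fun x => g x z) v x) =
      fun z => RegInt.dirDel (Function.uncurry g) (v, 0) (x, z) :=
    funext fun z' => dirDel_slice_eq (hd x hx z') v
  rw [dirDel_congr v e1, e2]
  have h3 := dirDel_slice_eq (g := fun x z => RegInt.dirDel (Function.uncurry g) (0, 1) (x, z))
    (hd2 (0, 1)) v
  have h4 := wirt_eq_dirDel (g := fun x z => RegInt.dirDel (Function.uncurry g) (v, 0) (x, z))
    (hd2 (v, 0))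
  rw [h3, h4]
  exact dirDel_comm hc _ _

theorem IsFamily.dirDel_wirt_iterate (hU : IsOpen U) (hK : IsCompact K) (hg : IsFamily U K g)
    {x : E} (hx : x ∈ U) (v : E) (n : ℕ) (z : ℂ) :
    RegInt.dirDel (fun x => (RegInt.wirt^[n] (g x)) z) v x =
      (RegInt.wirt^[n] (fun z => RegInt.dirDel (fun x => g x z) v x)) z := by
  induction n generalizing z with
  | zero => rfl
  | succ n ih =>
    simp only [Function.iterate_succ_apply']
    rw [(hg.wirt_iterate hU hK n).dirDel_wirt hU hx]
    congr 1
    exact funext ih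

variable [CompleteSpace F]

/-- The substitution `z = p - t` moves the singularity to the origin: the kernel no longer depends
on the pole, which becomes the point at which the convolution is evaluated. Derivatives in the pole
then fall on `g`. -/
theorem cauchy_eq_convolution (g : ℂ → F) (p : ℂ) :
    ∫ z, (z - p)⁻¹ • g z =
      convolution (fun t : ℂ => -t⁻¹) g (ContinuousLinearMap.lsmul ℝ ℂ) volume p := by
  rw [convolution_def, ← integral_sub_left_eq_self (fun z => (z - p)⁻¹ • g z) volume p]
  refine integral_congr_ae (Eventually.of_forall fun t => ?_)
  change (p - t - p)⁻¹ • g (p - t) = _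
  rw [show p - t - p = -t by ring, inv_neg]
  rfl

theorem locallyIntegrable_neg_inv : LocallyIntegrable (fun z : ℂ => -z⁻¹) :=
  locallyIntegrable_inv.neg

theorem IsFamily.contDiffOn_cauchy (hU : IsOpen U) (hK : IsCompact K) (hg : IsFamily U K g)
    {p : E → ℂ} (hp : ContDiffOn ℝ ∞ p U) :
    ContDiffOn ℝ ∞ (fun x => ∫ z, (z - p x)⁻¹ • g x z) U := by
  simp only [cauchy_eq_convolution]
  exact contDiffOn_convolution_right_with_param_comp (n := ⊤) (ContinuousLinearMap.lsmul ℝ ℂ) hp hU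
    hK (fun x z hx hz => hg.zero x hx z hz) locallyIntegrable_neg_inv hg.smooth

/-- In convolution form this is the chain rule along `x ↦ (x, p x)`. Since `p` is holomorphic, the
derivative of this map is complex-linear and the type `(1,0)` is preserved: the motion of the pole
contributes `∂_z g` and no conjugate derivative of `g`. -/
theorem IsFamily.dirDel_cauchy (hU : IsOpen U) (hK : IsCompact K) (hg : IsFamily U K g)
    {p : E → ℂ} {x : E} (hx : x ∈ U) (hp : DifferentiableAt ℂ p x) (v : E) :
    RegInt.dirDel (fun x => ∫ z, (z - p x)⁻¹ • g x z) v x =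
      (∫ z, (z - p x)⁻¹ • RegInt.dirDel (fun x => g x z) v x) +
        (fderiv ℝ p x v) • ∫ z, (z - p x)⁻¹ • RegInt.wirt (g x) z := by
  have h1 := hasFDerivAt_convolution_right_with_param (μ := volume)
    (ContinuousLinearMap.lsmul ℝ ℂ (E := F)) hU hK (fun x z hx hz => hg.zero x hx z hz)
    locallyIntegrable_neg_inv (hg.smooth.of_le (by norm_cast)) (x, p x) hx
  have e : convolution (fun z : ℂ => -z⁻¹) (fun z => fderiv ℝ (Function.uncurry g) (x, z))
      (ContinuousLinearMap.precompR (E × ℂ) (ContinuousLinearMap.lsmul ℝ ℂ (E := F))) volume (p x)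
      = ∫ z, (z - p x)⁻¹ • fderiv ℝ (Function.uncurry g) (x, z) := by
    rw [cauchy_eq_convolution]
    rfl
  have hpR := hp.restrictScalars ℝ
  have h2 : HasFDerivAt (fun x => (x, p x)) ((ContinuousLinearMap.id ℝ E).prod (fderiv ℝ p x)) x :=
    (hasFDerivAt_id x).prodMk hpR.hasFDerivAt
  have h3 := h1.comp x h2
  have h4 : HasFDerivAt (fun x => ∫ z, (z - p x)⁻¹ • g x z)
      ((∫ z, (z - p x)⁻¹ • fderiv ℝ (Function.uncurry g) (x, z)).comp
        ((ContinuousLinearMap.id ℝ E).prod (fderiv ℝ p x))) x := by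
    simp only [cauchy_eq_convolution (F := F)]
    rw [← e]
    exact h3
  have hcont : Continuous fun z => fderiv ℝ (Function.uncurry g) (x, z) :=
    continuous_iff_continuousAt.2 fun z =>
      ContinuousAt.comp (f := fun z => (x, z)) (g := fderiv ℝ (Function.uncurry g))
        (((hg.contDiffAt hU hx z).fderiv_right (m := 0) (by simp)).continuousAt) (by fun_prop)
  have hcomp : HasCompactSupport fun z => fderiv ℝ (Function.uncurry g) (x, z) := by
    refine HasCompactSupport.intro hK fun z hz => ?_
    have : Function.uncurry g =ᶠ[𝓝 (x, z)] fun _ => 0 := by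
      filter_upwards [(hU.prod hK.isClosed.isOpen_compl).mem_nhds ⟨hx, hz⟩] with y hy
      exact hg.zero y.1 hy.1 y.2 hy.2
    rw [this.fderiv_eq, fderiv_const_apply]
  have hint := integrable_inv_smul hcont hcomp (p x)
  have h5 : ∀ a : E × ℂ, complexLinearPart
      (∫ z, (z - p x)⁻¹ • fderiv ℝ (Function.uncurry g) (x, z)) a =
      ∫ z, (z - p x)⁻¹ • RegInt.dirDel (Function.uncurry g) a (x, z) := by
    intro a
    have hia : ∀ a, Integrable fun z => (z - p x)⁻¹ • fderiv ℝ (Function.uncurry g) (x, z) a :=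
      fun a => hint.apply_continuousLinearMap a
    have hia' : ∀ a, Integrable fun z =>
        Complex.I • (z - p x)⁻¹ • fderiv ℝ (Function.uncurry g) (x, z) a := fun a =>
      (hia a).smul Complex.I
    rw [complexLinearPart_apply, ContinuousLinearMap.integral_apply hint,
      ContinuousLinearMap.integral_apply hint]
    simp only [_root_.smul_apply]
    rw [← integral_smul, ← integral_sub (hia a) (hia' _), ← integral_smul]
    refine integral_congr_ae (Eventually.of_forall fun z => ?_)
    simp only [RegInt.dirDel, complexLinearPart_apply]
    rw [smul_comm Complex.I, ← smul_sub, smul_comm]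
  have hd : ∀ z, DifferentiableAt ℝ (Function.uncurry g) (x, z) := fun z =>
    (hg.contDiffAt hU hx z).differentiableAt (by simp)
  rw [RegInt.dirDel, h4.fderiv, complexLinearPart_comp_clm _ _ (fun v => by
    simp [fderiv_real_I_smul hp])]
  -- The split of the tangent vector into its part along the parameters and the velocity of the
  -- pole; the two summands yield the two integrals.
  have h6 : ((ContinuousLinearMap.id ℝ E).prod (fderiv ℝ p x)) v =
      ((v, 0) : E × ℂ) + (fderiv ℝ p x v) • ((0, 1) : E × ℂ) := by simp
  have hclin : ∀ (L : E × ℂ →L[ℝ] F) (c : ℂ) (u : E × ℂ),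
      complexLinearPart L (c • u) = c • complexLinearPart L u := by
    intro L c u
    have hr : ∀ (r : ℝ) (x : E × ℂ), (r : ℂ) • x = r • x := fun r x => algebraMap_smul ℂ r x
    have hr' : ∀ (r : ℝ) (x : F), (r : ℂ) • x = r • x := fun r x => algebraMap_smul ℂ r x
    rw [← Complex.re_add_im c, add_smul, mul_smul, hr, hr, map_add, map_smul, map_smul,
      complexLinearPart_I_smul, add_smul, mul_smul, hr', hr']
  rw [ContinuousLinearMap.comp_apply, h6, map_add, hclin, h5, h5]
  simp only [dirDel_slice_eq (hd _), wirt_eq_dirDel (hd _)]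

theorem IsFamily.contDiffOn_pf (hU : IsOpen U) (hK : IsCompact K) (hg : IsFamily U K g)
    {p : E → ℂ} (hp : ContDiffOn ℝ ∞ p U) (n : ℕ) :
    ContDiffOn ℝ ∞ (fun x => pf n (g x) (p x)) U :=
  contDiffOn_const.smul ((hg.wirt_iterate hU hK n).contDiffOn_cauchy hU hK hp)

/-- The second term is the finite part of `g` times the derivative of `(z - p)^(-(n+1))` with
respect to `p`. The factor `n + 1` compensates the passage from `n!` to `(n+1)!`. -/
theorem IsFamily.dirDel_pf (hU : IsOpen U) (hK : IsCompact K) (hg : IsFamily U K g)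
    {p : E → ℂ} {x : E} (hx : x ∈ U) (hp' : ContDiffOn ℝ ∞ p U) (hp : DifferentiableAt ℂ p x)
    (v : E) (n : ℕ) :
    RegInt.dirDel (fun x => pf n (g x) (p x)) v x =
      pf n (fun z => RegInt.dirDel (fun x => g x z) v x) (p x) +
        (((n : ℂ) + 1) * fderiv ℝ p x v) • pf (n + 1) (g x) (p x) := by
  have hf := hg.wirt_iterate hU hK n
  have hd : DifferentiableAt ℝ (fun x => ∫ z, (z - p x)⁻¹ • (RegInt.wirt^[n] (g x)) z) x :=
    ((hf.contDiffOn_cauchy hU hK hp').contDiffAt (hU.mem_nhds hx)).differentiableAt (by simp)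
  simp only [pf]
  rw [dirDel_const_smul v hd, hf.dirDel_cauchy hU hK hx hp, smul_add]
  simp only [hg.dirDel_wirt_iterate hU hK hx, Function.iterate_succ_apply']
  congr 1
  rw [smul_smul, smul_smul, Nat.factorial_succ]
  congr 1
  have : (n : ℂ) + 1 ≠ 0 := by exact_mod_cast n.succ_ne_zero
  push_cast
  field_simp

/-- Integrals of smooth families without poles. -/
theorem IsFamily.contDiffOn_integral (hU : IsOpen U) (hK : IsCompact K) (hg : IsFamily U K g) :
    ContDiffOn ℝ ∞ (fun x => ∫ z, g x z) U := by
  -- A fictitious pole at `0`, cancelled by the factor `z`, reduces the claim to the Cauchy integral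
  -- with a constant pole.
  have h : IsFamily U K (fun x z => z • g x z) :=
    ⟨contDiffOn_snd.smul hg.smooth, fun x hx z hz => by rw [hg.zero x hx z hz, smul_zero]⟩
  refine (h.contDiffOn_cauchy hU hK (contDiffOn_const (c := 0))).congr fun x hx => ?_
  refine integral_congr_ae ?_
  have : ∀ᵐ z : ℂ, z ≠ 0 := by simp [ae_iff, measure_singleton]
  filter_upwards [this] with z hz
  rw [smul_smul, sub_zero, inv_mul_cancel₀ hz, one_smul]

theorem IsFamily.dirDel_integral (hU : IsOpen U) (hK : IsCompact K) (hg : IsFamily U K g)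
    {x : E} (hx : x ∈ U) (v : E) :
    RegInt.dirDel (fun x => ∫ z, g x z) v x = ∫ z, RegInt.dirDel (fun x => g x z) v x := by
  have h : IsFamily U K (fun x z => z • g x z) :=
    ⟨contDiffOn_snd.smul hg.smooth, fun x hx z hz => by rw [hg.zero x hx z hz, smul_zero]⟩
  have key : ∀ f : ℂ → F, ∫ z, f z = ∫ z : ℂ, (z - 0)⁻¹ • z • f z := by
    intro f
    refine integral_congr_ae ?_
    have : ∀ᵐ z : ℂ, z ≠ 0 := by simp [ae_iff, measure_singleton]
    filter_upwards [this] with z hz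
    rw [smul_smul, sub_zero, inv_mul_cancel₀ hz, one_smul]
  have hd : ∀ z, DifferentiableAt ℝ (fun x => g x z) x := fun z =>
    ((hg.contDiffAt hU hx z).comp (f := fun x => (x, z)) x (by fun_prop)).differentiableAt (by simp)
  have e : (fun x => ∫ z, g x z) = fun x => ∫ z : ℂ, (z - 0)⁻¹ • z • g x z :=
    funext fun x => key (g x)
  rw [e, key fun z => RegInt.dirDel (fun x => g x z) v x, h.dirDel_cauchy hU hK hx (differentiableAt_const (0 : ℂ)), fderiv_const_apply,
    _root_.zero_apply, zero_smul, add_zero]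
  simp only [dirDel_const_smul v (hd _)]

end Parametric

end RegInt
end

noncomputable section

namespace RegInt

open Filter MeasureTheory

/-! ### Real `2`-forms on the complex line. -/

section TwoForms

variable {V : Type*} [AddCommGroup V] [Module ℝ V]

/-- Multiplication by `c` has real determinant `|c|²`. Expanding in the basis `1, i`, the diagonal
terms vanish and the mixed terms combine by antisymmetry. -/
theorem alternating_two_complex_mul (A : ℂ [⋀^Fin 2]→ₗ[ℝ] V) (c : ℂ) :
    A ![c, c * Complex.I] = Complex.normSq c • A ![1, Complex.I] := by
  let B : ℂ →ₗ[ℝ] ℂ →ₗ[ℝ] V :=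
    LinearMap.mk₂ ℝ (fun u v => A ![u, v])
      (fun u u' v => A.toMultilinearMap.cons_add ![v] u u')
      (fun r u v => A.toMultilinearMap.cons_smul ![v] r u)
      (fun u v v' => (A.curryLeft u).toMultilinearMap.cons_add ![] v v')
      (fun r u v => (A.curryLeft u).toMultilinearMap.cons_smul ![] r v)
  have hB : ∀ u v, A ![u, v] = B u v := fun _ _ => rfl
  have h0 : ∀ u, B u u = 0 := fun u =>
    A.map_eq_zero_of_eq ![u, u] (i := 0) (j := 1) rfl (by decide)
  have hs : B Complex.I 1 = -B 1 Complex.I := by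
    have := h0 (1 + Complex.I)
    simp only [map_add, LinearMap.add_apply, h0, zero_add, add_zero] at this
    exact eq_neg_of_add_eq_zero_left (by rw [add_comm]; rw [add_comm] at this; exact this)
  have hc : c = c.re • (1 : ℂ) + c.im • Complex.I := by
    apply Complex.ext <;> simp
  have hcI : c * Complex.I = (-c.im) • (1 : ℂ) + c.re • Complex.I := by
    apply Complex.ext <;> simp
  rw [hB, hB, hcI]
  nth_rewrite 1 [hc]
  simp only [map_add, map_smul, LinearMap.add_apply, LinearMap.smul_apply, h0, hs,
    Complex.normSq_apply]
  module

theorem det_of_complex_linear (L : ℂ →L[ℝ] ℂ) (hL : L Complex.I = L 1 * Complex.I) :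
    L.det = Complex.normSq (L 1) := by
  have h1 := Complex.basisOneI.det_comp (L : ℂ →ₗ[ℝ] ℂ) Complex.basisOneI
  have h2 := alternating_two_complex_mul Complex.basisOneI.det (L 1)
  have e1 : ((L : ℂ →ₗ[ℝ] ℂ) ∘ Complex.basisOneI) = ![L 1, L 1 * Complex.I] := by
    ext i; fin_cases i <;> simp [hL]
  have e2 : (Complex.basisOneI : Fin 2 → ℂ) = ![1, Complex.I] := by
    ext i; fin_cases i <;> simp
  rw [e1, h2, ← e2, Module.Basis.det_self, smul_eq_mul, mul_one, mul_one] at h1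
  exact h1.symm

theorem alternating_two_ext {A B : ℂ [⋀^Fin 2]→L[ℝ] ℂ}
    (h : A ![1, Complex.I] = B ![1, Complex.I]) : A = B := by
  apply ContinuousAlternatingMap.toAlternatingMap_injective
  have e2 : (Complex.basisOneI : Fin 2 → ℂ) = ![1, Complex.I] := by
    ext i; fin_cases i <;> simp
  have hs : ∀ C : ℂ [⋀^Fin 2]→ₗ[ℝ] ℂ, C ![Complex.I, 1] = -C ![1, Complex.I] := fun C => by
    rw [← C.map_swap ![1, Complex.I] (i := 0) (j := 1) (by decide)]
    congr 1
    ext i; fin_cases i <;> rfl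
  refine Module.Basis.ext_alternating Complex.basisOneI fun v hv => ?_
  have hv' : v 0 ≠ v 1 := fun h => absurd (hv h) (by decide)
  have h' : A.toAlternatingMap ![1, Complex.I] = B.toAlternatingMap ![1, Complex.I] := h
  rcases Fin.exists_fin_two.1 ⟨v 0, rfl⟩ with h0 | h0
  · have h1 : v 1 = 1 := by omega
    have : (fun i => Complex.basisOneI (v i)) = ![1, Complex.I] := by
      ext i; fin_cases i <;> simp [h0, h1]
    rw [this, h']
  · have h1 : v 1 = 0 := by omega
    have : (fun i => Complex.basisOneI (v i)) = ![Complex.I, 1] := by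
      ext i; fin_cases i <;> simp [h0, h1]
    rw [this, hs, hs, h']

end TwoForms

/-! ### Complex scalars acting on complex-valued real forms. -/

section Scalars

variable {V : Type*} [NormedAddCommGroup V] [NormedSpace ℝ V] {k : ℕ}

theorem form_zero_smul (A : V [⋀^Fin k]→L[ℝ] ℂ) : (0 : ℂ) • A = 0 := by
  ext v; exact zero_mul _

theorem form_add_smul (a b : ℂ) (A : V [⋀^Fin k]→L[ℝ] ℂ) : a • A + b • A = (a + b) • A := by
  ext v; exact (add_mul a b (A v)).symm

theorem form_sum_smul {κ : Type*} (t : Finset κ) (a : κ → ℂ) (A : V [⋀^Fin k]→L[ℝ] ℂ) :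
    (∑ i ∈ t, a i) • A = ∑ i ∈ t, a i • A := by
  ext v
  simp only [ContinuousAlternatingMap.smul_apply, ContinuousAlternatingMap.sum_apply, smul_eq_mul,
    Finset.sum_mul]

theorem form_neg_one_smul (A : V [⋀^Fin k]→L[ℝ] ℂ) : (-1 : ℂ) • A = -A := by
  ext v; exact neg_one_mul _

theorem form_smul_smul (a b : ℂ) (A : V [⋀^Fin k]→L[ℝ] ℂ) : a • b • A = (a * b) • A := by
  ext v; exact (mul_assoc a b (A v)).symm

theorem form_smul_zero (c : ℂ) : c • (0 : V [⋀^Fin k]→L[ℝ] ℂ) = 0 := by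
  ext v; exact mul_zero _

end Scalars

/-! ### Integration of `2`-forms on a compact Riemann surface. -/

section Surface

variable {S : Type*} [TopologicalSpace S] [ChartedSpace ℂ S]

theorem extChartAt_source_plane (p : S) :
    (extChartAt 𝓘(ℝ, ℂ) p).source = (chartAt ℂ p).source := by simp [mfld_simps]

theorem extChartAt_target_plane (p : S) :
    (extChartAt 𝓘(ℝ, ℂ) p).target = (chartAt ℂ p).target := by simp [mfld_simps]

/-- The coefficient of a `2`-form with respect to `dx ∧ dy` in the chart at `p`. -/
def coeff (u : DForm 𝓘(ℝ, ℂ) S 2) (p : S) (y : ℂ) : ℂ := inChart 𝓘(ℝ, ℂ) u p y ![1, Complex.I]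

/-- The change of coordinates from the chart at `p` to the chart at `q`. -/
def trans (p q : S) : ℂ → ℂ := chartAt ℂ q ∘ (chartAt ℂ p).symm

/-- The domain of `trans p q`. -/
def transDomain (p q : S) : Set ℂ :=
  (chartAt ℂ p).target ∩ (chartAt ℂ p).symm ⁻¹' (chartAt ℂ q).source

theorem isOpen_transDomain (p q : S) : IsOpen (transDomain p q) :=
  (chartAt ℂ p).isOpen_inter_preimage_symm (chartAt ℂ q).open_source

variable [IsManifold 𝓘(ℂ, ℂ) ω S]

theorem holAtlas_surface : HolAtlas 𝓘(ℝ, ℂ) S := holAtlas_of_isManifold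

theorem contDiffAt_trans {p q : S} {y : ℂ} (hy : y ∈ transDomain p q) :
    ContDiffAt ℂ ∞ (trans p q) y :=
  holAtlas_surface p q y (by rw [extChartAt_target_plane]; exact hy.1)
    (by rw [extChartAt_source_plane]; exact hy.2)

theorem injOn_trans (p q : S) : Set.InjOn (trans p q) (transDomain p q) := by
  intro x hx y hy h
  exact (chartAt ℂ p).symm.injOn hx.1 hy.1 ((chartAt ℂ q).injOn hx.2 hy.2 h)

theorem image_trans (p q : S) : trans p q '' transDomain p q = transDomain q p := by
  ext y
  constructor
  · rintro ⟨x, hx, rfl⟩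
    refine ⟨(chartAt ℂ q).map_source hx.2, ?_⟩
    simp only [trans, Set.mem_preimage, Function.comp_apply]
    rw [(chartAt ℂ q).left_inv hx.2]
    exact (chartAt ℂ p).map_target hx.1
  · intro hy
    refine ⟨chartAt ℂ p ((chartAt ℂ q).symm y), ⟨(chartAt ℂ p).map_source hy.2, ?_⟩, ?_⟩
    · simp only [Set.mem_preimage]
      rw [(chartAt ℂ p).left_inv hy.2]
      exact (chartAt ℂ q).map_target hy.1
    · simp only [trans, Function.comp_apply]
      rw [(chartAt ℂ p).left_inv hy.2, (chartAt ℂ q).right_inv hy.1]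

/-- Holomorphic coordinate changes preserve orientation: their Jacobian is the square of a modulus.
The absolute value is therefore harmless, and it gives the formula the shape required by the change
of variables for Lebesgue integrals. -/
theorem coeff_change (u : DForm 𝓘(ℝ, ℂ) S 2) {p q : S} {y : ℂ} (hy : y ∈ transDomain p q) :
    coeff u p y = |(fderiv ℝ (trans p q) y).det| • coeff u q (trans p q y) := by
  have hd : DifferentiableAt ℂ (trans p q) y := (contDiffAt_trans hy).differentiableAt (by simp)
  have hL : fderiv ℝ (trans p q) y Complex.I = fderiv ℝ (trans p q) y 1 * Complex.I := by
    have := fderiv_real_I_smul hd 1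
    rw [smul_eq_mul, mul_one] at this
    rw [this, smul_eq_mul, mul_comm]
  have hch := inChart_change holAtlas_surface u (p := p) (q := q) (y := y)
    (by rw [extChartAt_target_plane]; exact hy.1) (by rw [extChartAt_source_plane]; exact hy.2)
  rw [coeff, hch, det_of_complex_linear _ hL, abs_of_nonneg (Complex.normSq_nonneg _), coeff]
  refine Eq.trans ?_ (alternating_two_complex_mul
    (inChart 𝓘(ℝ, ℂ) u q (trans p q y)).toAlternatingMap _)
  rw [← hL]
  change (inChart 𝓘(ℝ, ℂ) u q (trans p q y)) _ = (inChart 𝓘(ℝ, ℂ) u q (trans p q y)) _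
  congr 1
  ext i; fin_cases i <;> rfl

theorem integrableOn_coeff_change (u : DForm 𝓘(ℝ, ℂ) S 2) {p q : S} {A : Set ℂ}
    (hA : MeasurableSet A) (hAs : A ⊆ transDomain p q) :
    IntegrableOn (coeff u q) (trans p q '' A) ↔ IntegrableOn (coeff u p) A := by
  rw [integrableOn_image_iff_integrableOn_abs_det_fderiv_smul volume hA
    (f' := fderiv ℝ (trans p q)) (fun x hx => (((contDiffAt_trans (hAs hx)).differentiableAt
      (by simp)).restrictScalars ℝ).hasFDerivAt.hasFDerivWithinAt) ((injOn_trans p q).mono hAs)]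
  exact integrableOn_congr_fun (fun x hx => (coeff_change u (hAs hx)).symm) hA

theorem setIntegral_coeff_change (u : DForm 𝓘(ℝ, ℂ) S 2) (p q : S) :
    ∫ y in transDomain q p, coeff u q y = ∫ y in transDomain p q, coeff u p y := by
  have hA := (isOpen_transDomain p q).measurableSet
  rw [← image_trans p q, integral_image_eq_integral_abs_det_fderiv_smul volume hA
    (f' := fderiv ℝ (trans p q)) (fun x hx => (((contDiffAt_trans hx).differentiableAt
      (by simp)).restrictScalars ℝ).hasFDerivAt.hasFDerivWithinAt) (injOn_trans p q)]
  exact setIntegral_congr_fun hA fun x hx => (coeff_change u hx).symm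

theorem coeff_eq_zero {u : DForm 𝓘(ℝ, ℂ) S 2} {p : S} {y : ℂ} (h : u ((chartAt ℂ p).symm y) = 0) :
    coeff u p y = 0 := by
  have h' : u ((extChartAt 𝓘(ℝ, ℂ) p).symm y) = 0 := h
  unfold coeff inChart
  rw [h']
  rfl

/-- The integral of a form supported in two chart domains does not depend on the chart. -/
theorem integral_coeff_change {u : DForm 𝓘(ℝ, ℂ) S 2} {p q : S}
    (hp : ∀ r, r ∉ (chartAt ℂ p).source → u r = 0) (hq : ∀ r, r ∉ (chartAt ℂ q).source → u r = 0) :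
    ∫ y in (chartAt ℂ p).target, coeff u p y = ∫ y in (chartAt ℂ q).target, coeff u q y := by
  have key : ∀ {p q : S}, (∀ r, r ∉ (chartAt ℂ q).source → u r = 0) →
      ∫ y in (chartAt ℂ p).target, coeff u p y = ∫ y in transDomain p q, coeff u p y := by
    intro p q hq
    refine setIntegral_eq_of_subset_of_forall_sdiff_eq_zero
      (chartAt ℂ p).open_target.measurableSet Set.inter_subset_left fun y hy => ?_
    exact coeff_eq_zero (hq _ fun h => hy.2 ⟨hy.1, h⟩)
  rw [key hq, key hp, setIntegral_coeff_change]

/-- Local integrability of a `2`-form, tested in centred charts. -/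
def LocInt (u : DForm 𝓘(ℝ, ℂ) S 2) : Prop :=
  ∀ q, IntegrableAtFilter (coeff u q) (𝓝 (chartAt ℂ q q))

theorem LocInt.locallyIntegrableOn {u : DForm 𝓘(ℝ, ℂ) S 2} (hu : LocInt u) (p : S) :
    LocallyIntegrableOn (coeff u p) (chartAt ℂ p).target := by
  intro y hy
  rw [(chartAt ℂ p).open_target.nhdsWithin_eq hy]
  set q := (chartAt ℂ p).symm y with hq
  have hyD : y ∈ transDomain p q := ⟨hy, mem_chart_source ℂ q⟩
  obtain ⟨V, hV, hVi⟩ := hu q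
  have hc : ContinuousAt (trans p q) y := (contDiffAt_trans hyD).continuousAt
  have h1 : trans p q ⁻¹' V ∩ transDomain p q ∈ 𝓝 y :=
    inter_mem (hc.preimage_mem_nhds hV) ((isOpen_transDomain p q).mem_nhds hyD)
  obtain ⟨A, hA, hAo, hyA⟩ := mem_nhds_iff.1 h1
  refine ⟨A, hAo.mem_nhds hyA, ?_⟩
  rw [← integrableOn_coeff_change u hAo.measurableSet (fun x hx => (hA hx).2)]
  refine hVi.mono_set ?_
  rintro _ ⟨x, hx, rfl⟩
  exact (hA hx).1

theorem LocInt.add {u v : DForm 𝓘(ℝ, ℂ) S 2} (hu : LocInt u) (hv : LocInt v) : LocInt (u + v) :=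
  fun q => (hu q).add (hv q)

theorem LocInt.smul {u : DForm 𝓘(ℝ, ℂ) S 2} (hu : LocInt u) (c : ℂ) :
    LocInt (fun q => c • u q) := fun q => by
  obtain ⟨V, hV, hVi⟩ := hu q
  exact ⟨V, hV, hVi.smul c⟩

variable [T2Space S] [CompactSpace S]

theorem LocInt.integrableOn_cut {u : DForm 𝓘(ℝ, ℂ) S 2} (hu : LocInt u) {p : S} {f : S → ℂ}
    (hf : Continuous f) (hfs : tsupport f ⊆ (chartAt ℂ p).source) :
    IntegrableOn (coeff (fun q => f q • u q) p) (chartAt ℂ p).target := by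
  set K := chartAt ℂ p '' tsupport f with hK
  have hKc : IsCompact K := ((isClosed_tsupport f).isCompact).image_of_continuousOn
    ((chartAt ℂ p).continuousOn.mono hfs)
  have hKt : K ⊆ (chartAt ℂ p).target := by
    rintro _ ⟨x, hx, rfl⟩
    exact (chartAt ℂ p).map_source (hfs hx)
  have h1 : IntegrableOn (coeff u p) K := (hu.locallyIntegrableOn p).integrableOn_compact_subset
    hKt hKc
  have h2 : IntegrableOn (coeff (fun q => f q • u q) p) K :=
    h1.continuousOn_mul (g := fun y => f ((chartAt ℂ p).symm y))
      (hf.comp_continuousOn ((chartAt ℂ p).continuousOn_symm.mono hKt)) hKc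
  refine h2.of_forall_sdiff_eq_zero (chartAt ℂ p).open_target.measurableSet fun y hy => ?_
  refine coeff_eq_zero ?_
  have : (chartAt ℂ p).symm y ∉ tsupport f := fun h => hy.2 ⟨_, h, (chartAt ℂ p).right_inv hy.1⟩
  rw [image_eq_zero_of_notMem_tsupport this]
  exact form_zero_smul _

/-- The sum that defines the integral of a form by means of a partition of unity. -/
def surfSum {m : ℕ} (pt : Fin m → S) (ρ : SmoothPartitionOfUnity (Fin m) 𝓘(ℝ, ℂ) S)
    (u : DForm 𝓘(ℝ, ℂ) S 2) : ℂ :=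
  ∑ j, ∫ y in (chartAt ℂ (pt j)).target, coeff (fun q => (ρ j q : ℂ) • u q) (pt j) y

/-- For locally integrable forms the integrability clause is automatic, because each cut-off has
compact support inside its chart. -/
theorem hasSurfaceIntegral_iff (u : DForm 𝓘(ℝ, ℂ) S 2) (hu : LocInt u) (c : ℂ) :
    HasSurfaceIntegral u c ↔ ∃ (m : ℕ) (pt : Fin m → S)
      (ρ : SmoothPartitionOfUnity (Fin m) 𝓘(ℝ, ℂ) S),
      ρ.IsSubordinate (fun j => (chartAt ℂ (pt j)).source) ∧ c = surfSum pt ρ u := by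
  constructor
  · rintro ⟨m, pt, ρ, h1, -, h3⟩
    exact ⟨m, pt, ρ, h1, h3⟩
  · rintro ⟨m, pt, ρ, h1, h3⟩
    refine ⟨m, pt, ρ, h1, fun j => ?_, h3⟩
    have hc : Continuous fun q => ((ρ j q : ℝ) : ℂ) :=
      Complex.continuous_ofReal.comp (ρ j).contMDiff.continuous
    refine hu.integrableOn_cut hc (subset_trans ?_ (h1 j))
    exact closure_mono fun x hx => by
      simpa using hx

theorem tsupport_ofReal (f : S → ℝ) : tsupport (fun q => ((f q : ℝ) : ℂ)) = tsupport f := by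
  unfold tsupport
  congr 1
  ext x
  simp

theorem sum_smul_partition {m : ℕ} (ρ : SmoothPartitionOfUnity (Fin m) 𝓘(ℝ, ℂ) S) {k : ℕ}
    (u : DForm 𝓘(ℝ, ℂ) S k) (q : S) : ∑ j, (ρ j q : ℂ) • u q = u q := by
  rw [← Finset.sum_smul, ← Complex.ofReal_sum]
  have := ρ.sum_eq_one (Set.mem_univ q)
  rw [finsum_eq_sum_of_fintype] at this
  rw [this, Complex.ofReal_one, one_smul]

theorem coeff_sum {κ : Type*} (t : Finset κ) (u : κ → DForm 𝓘(ℝ, ℂ) S 2) (p : S) (y : ℂ) :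
    coeff (fun q => ∑ j ∈ t, u j q) p y = ∑ j ∈ t, coeff (u j) p y := by
  simp [coeff, inChart_sum, ContinuousAlternatingMap.sum_apply]

theorem continuous_partition {m : ℕ} (ρ : SmoothPartitionOfUnity (Fin m) 𝓘(ℝ, ℂ) S) (j : Fin m) :
    Continuous fun q => ((ρ j q : ℝ) : ℂ) :=
  Complex.continuous_ofReal.comp (ρ j).contMDiff.continuous

/-- Insert the other partition of unity on each side. Both sums become the double sum over the
products `ρ j * ρ' k`, whose pieces are supported in two charts at once and may be integrated in
either. -/
theorem surfSum_eq {u : DForm 𝓘(ℝ, ℂ) S 2} (hu : LocInt u) {m m' : ℕ} {pt : Fin m → S}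
    {pt' : Fin m' → S} {ρ : SmoothPartitionOfUnity (Fin m) 𝓘(ℝ, ℂ) S}
    {ρ' : SmoothPartitionOfUnity (Fin m') 𝓘(ℝ, ℂ) S}
    (h : ρ.IsSubordinate (fun j => (chartAt ℂ (pt j)).source))
    (h' : ρ'.IsSubordinate (fun j => (chartAt ℂ (pt' j)).source)) :
    surfSum pt ρ u = surfSum pt' ρ' u := by
  have hs : ∀ j, tsupport (fun q => ((ρ j q : ℝ) : ℂ)) ⊆ (chartAt ℂ (pt j)).source := fun j => by
    rw [tsupport_ofReal]; exact h j
  have hs' : ∀ j, tsupport (fun q => ((ρ' j q : ℝ) : ℂ)) ⊆ (chartAt ℂ (pt' j)).source := fun j => by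
    rw [tsupport_ofReal]; exact h' j
  have e1 : ∀ j, ∫ y in (chartAt ℂ (pt j)).target, coeff (fun q => (ρ j q : ℂ) • u q) (pt j) y =
      ∑ k, ∫ y in (chartAt ℂ (pt j)).target,
        coeff (fun q => ((ρ j q : ℂ) * (ρ' k q : ℂ)) • u q) (pt j) y := by
    intro j
    rw [← integral_finsetSum]
    · refine setIntegral_congr_fun (chartAt ℂ (pt j)).open_target.measurableSet fun y _ => ?_
      beta_reduce
      rw [← coeff_sum]
      congr 1
      ext1 q
      simp only [mul_smul, ← Finset.smul_sum, sum_smul_partition]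
    · intro k _
      refine hu.integrableOn_cut ((continuous_partition ρ j).mul (continuous_partition ρ' k)) ?_
      exact (tsupport_mul_subset_left (f := fun q => ((ρ j q : ℝ) : ℂ))).trans (hs j)
  have e2 : ∀ k, ∫ y in (chartAt ℂ (pt' k)).target, coeff (fun q => (ρ' k q : ℂ) • u q) (pt' k) y =
      ∑ j, ∫ y in (chartAt ℂ (pt' k)).target,
        coeff (fun q => ((ρ j q : ℂ) * (ρ' k q : ℂ)) • u q) (pt' k) y := by
    intro k
    rw [← integral_finsetSum]
    · refine setIntegral_congr_fun (chartAt ℂ (pt' k)).open_target.measurableSet fun y _ => ?_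
      beta_reduce
      rw [← coeff_sum]
      congr 1
      ext1 q
      simp only [mul_comm (ρ _ q : ℂ), mul_smul, ← Finset.smul_sum, sum_smul_partition]
    · intro j _
      refine hu.integrableOn_cut ((continuous_partition ρ j).mul (continuous_partition ρ' k)) ?_
      exact (tsupport_mul_subset_right (f := fun q => ((ρ j q : ℝ) : ℂ))).trans (hs' k)
  rw [surfSum, surfSum, Finset.sum_congr rfl fun j _ => e1 j, Finset.sum_congr rfl fun k _ => e2 k,
    Finset.sum_comm]
  refine Finset.sum_congr rfl fun k _ => Finset.sum_congr rfl fun j _ => integral_coeff_change ?_ ?_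
  · intro r hr
    rw [image_eq_zero_of_notMem_tsupport (f := fun q => ((ρ j q : ℝ) : ℂ)) fun h => hr (hs j h),
      zero_mul]
    exact form_zero_smul _
  · intro r hr
    rw [image_eq_zero_of_notMem_tsupport (f := fun q => ((ρ' k q : ℝ) : ℂ)) fun h => hr (hs' k h),
      mul_zero]
    exact form_zero_smul _

theorem isManifold_real : IsManifold 𝓘(ℝ, ℂ) ∞ S := by
  refine isManifold_of_contDiffOn _ _ _ fun e e' he he' => ?_
  have h := (contDiffGroupoid ω 𝓘(ℂ, ℂ)).compatible (M := S) he he'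
  have h2 := ((mem_groupoid_of_pregroupoid).1 h).1
  have h3 : ContDiffOn ℂ ω (𝓘(ℂ, ℂ) ∘ (e.symm.trans e') ∘ 𝓘(ℂ, ℂ).symm)
    (𝓘(ℂ, ℂ).symm ⁻¹' (e.symm.trans e').source ∩ Set.range 𝓘(ℂ, ℂ)) := h2
  exact (h3.restrict_scalars ℝ).of_le le_top

/-- Compactness gives a finite subcover. Injectivity of the centres is what later ensures that a
given pole lies in the support of at most one cut-off, when the sets of the cover avoid all poles
but their centre. -/
theorem exists_partition (V : S → Set S) (hV : ∀ z, IsOpen (V z)) (hz : ∀ z, z ∈ V z) :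
    ∃ (m : ℕ) (pt : Fin m → S) (ρ : SmoothPartitionOfUnity (Fin m) 𝓘(ℝ, ℂ) S),
      Function.Injective pt ∧ ρ.IsSubordinate (fun j => V (pt j)) := by
  obtain ⟨t, -, ht⟩ := isCompact_univ.elim_nhds_subcover (X := S) V
    (fun z _ => (hV z).mem_nhds (hz z))
  have := isManifold_real (S := S)
  obtain ⟨ρ, hρ⟩ := SmoothPartitionOfUnity.exists_isSubordinate 𝓘(ℝ, ℂ) (isClosed_univ (X := S))
    (fun j : Fin t.card => V (t.equivFin.symm j)) (fun j => hV _) (by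
      intro x hx
      obtain ⟨z, hz, hxz⟩ := Set.mem_iUnion₂.1 (ht hx)
      exact Set.mem_iUnion.2 ⟨t.equivFin ⟨z, hz⟩, by simpa using hxz⟩)
  exact ⟨t.card, fun j => t.equivFin.symm j, ρ,
    Subtype.val_injective.comp t.equivFin.symm.injective, hρ⟩

theorem exists_chart_partition :
    ∃ (m : ℕ) (pt : Fin m → S) (ρ : SmoothPartitionOfUnity (Fin m) 𝓘(ℝ, ℂ) S),
      ρ.IsSubordinate (fun j => (chartAt ℂ (pt j)).source) := by
  obtain ⟨m, pt, ρ, -, h⟩ := exists_partition (fun z : S => (chartAt ℂ z).source)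
    (fun z => (chartAt ℂ z).open_source) (fun z => mem_chart_source ℂ z)
  exact ⟨m, pt, ρ, h⟩

theorem HasSurfaceIntegral.unique {u : DForm 𝓘(ℝ, ℂ) S 2} (hu : LocInt u) {c c' : ℂ}
    (h : HasSurfaceIntegral u c) (h' : HasSurfaceIntegral u c') : c = c' := by
  obtain ⟨m, pt, ρ, hρ, rfl⟩ := (hasSurfaceIntegral_iff u hu c).1 h
  obtain ⟨m', pt', ρ', hρ', rfl⟩ := (hasSurfaceIntegral_iff u hu c').1 h'
  exact surfSum_eq hu hρ hρ'

theorem surfSum_sum {κ : Type*} (t : Finset κ) {u : κ → DForm 𝓘(ℝ, ℂ) S 2}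
    (hu : ∀ i ∈ t, LocInt (u i)) {m : ℕ} {pt : Fin m → S}
    {ρ : SmoothPartitionOfUnity (Fin m) 𝓘(ℝ, ℂ) S}
    (h : ρ.IsSubordinate (fun j => (chartAt ℂ (pt j)).source)) :
    surfSum pt ρ (fun q => ∑ i ∈ t, u i q) = ∑ i ∈ t, surfSum pt ρ (u i) := by
  unfold surfSum
  rw [Finset.sum_comm]
  refine Finset.sum_congr rfl fun j _ => ?_
  rw [← integral_finsetSum]
  · refine setIntegral_congr_fun (chartAt ℂ (pt j)).open_target.measurableSet fun y _ => ?_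
    beta_reduce
    rw [← coeff_sum]
    simp only [Finset.smul_sum]
  · intro i hi
    refine (hu i hi).integrableOn_cut (continuous_partition ρ j) ?_
    rw [tsupport_ofReal]; exact h j

theorem LocInt.sum {κ : Type*} (t : Finset κ) {u : κ → DForm 𝓘(ℝ, ℂ) S 2}
    (hu : ∀ i ∈ t, LocInt (u i)) : LocInt (fun q => ∑ i ∈ t, u i q) := by
  classical
  induction t using Finset.induction_on with
  | empty =>
    intro q
    refine ⟨Set.univ, univ_mem, ?_⟩
    have : coeff (fun q : S => ∑ i ∈ (∅ : Finset κ), u i q) q = fun _ => 0 :=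
      funext fun y => by rw [coeff_sum]; rfl
    rw [this]
    exact integrableOn_zero
  | insert a t ha ih =>
    have := (hu a (Finset.mem_insert_self a t)).add
      (ih fun i hi => hu i (Finset.mem_insert_of_mem hi))
    convert this using 1
    ext1 q
    simp [Finset.sum_insert ha]

theorem HasSurfaceIntegral.sum {κ : Type*} (t : Finset κ) {u : κ → DForm 𝓘(ℝ, ℂ) S 2} {c : κ → ℂ}
    (hu : ∀ i ∈ t, LocInt (u i)) (h : ∀ i ∈ t, HasSurfaceIntegral (u i) (c i)) :
    HasSurfaceIntegral (fun q => ∑ i ∈ t, u i q) (∑ i ∈ t, c i) := by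
  obtain ⟨m, pt, ρ, hρ⟩ := exists_chart_partition (S := S)
  rw [hasSurfaceIntegral_iff _ (LocInt.sum t hu)]
  refine ⟨m, pt, ρ, hρ, ?_⟩
  rw [surfSum_sum t hu hρ]
  refine Finset.sum_congr rfl fun i hi => ?_
  exact (h i hi).unique (hu i hi) ((hasSurfaceIntegral_iff _ (hu i hi) _).2 ⟨m, pt, ρ, hρ, rfl⟩)

theorem HasSurfaceIntegral.const_smul {u : DForm 𝓘(ℝ, ℂ) S 2} {c : ℂ} (hu : LocInt u) (a : ℂ)
    (h : HasSurfaceIntegral u c) : HasSurfaceIntegral (fun q => a • u q) (a * c) := by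
  rw [hasSurfaceIntegral_iff _ hu] at h
  obtain ⟨m, pt, ρ, hρ, rfl⟩ := h
  rw [hasSurfaceIntegral_iff _ (hu.smul a)]
  refine ⟨m, pt, ρ, hρ, ?_⟩
  rw [surfSum, surfSum, Finset.mul_sum]
  refine Finset.sum_congr rfl fun j _ => ?_
  rw [← integral_const_mul]
  refine integral_congr_ae (Eventually.of_forall fun y => ?_)
  change a * ((ρ j _ : ℂ) * coeff u (pt j) y) = (ρ j _ : ℂ) * (a * coeff u (pt j) y)
  ring

theorem ae_chart_notMem (D : Finset S) (p : S) :
    ∀ᵐ y ∂(volume.restrict (chartAt ℂ p).target), (chartAt ℂ p).symm y ∉ D := by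
  rw [ae_restrict_iff' (chartAt ℂ p).open_target.measurableSet]
  have h : (chartAt ℂ p '' (D : Set S)).Countable := (D.countable_toSet).image _
  filter_upwards [compl_mem_ae_iff.2 (h.measure_zero volume)] with y hy hyt hD
  exact hy ⟨_, hD, (chartAt ℂ p).right_inv hyt⟩

/-- The integral does not see the values at finitely many points. -/
theorem HasSurfaceIntegral.congr {u v : DForm 𝓘(ℝ, ℂ) S 2} (D : Finset S)
    (h : ∀ q, q ∉ D → u q = v q) {c : ℂ} (hu : HasSurfaceIntegral u c) :
    HasSurfaceIntegral v c := by
  obtain ⟨m, pt, ρ, h1, h2, rfl⟩ := hu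
  have e : ∀ j, ∀ᵐ y ∂(volume.restrict (chartAt ℂ (pt j)).target),
      (ρ j ((chartAt ℂ (pt j)).symm y) : ℂ) * inChart 𝓘(ℝ, ℂ) u (pt j) y ![1, Complex.I] =
      (ρ j ((chartAt ℂ (pt j)).symm y) : ℂ) * inChart 𝓘(ℝ, ℂ) v (pt j) y ![1, Complex.I] := by
    intro j
    filter_upwards [ae_chart_notMem D (pt j)] with y hy
    rw [inChart_congr_point (h _ hy)]
  refine ⟨m, pt, ρ, h1, fun j => (integrable_congr (e j)).1 (h2 j), ?_⟩
  exact Finset.sum_congr rfl fun j _ => integral_congr_ae (e j)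

/-- The integral of a form supported in a chart. -/
theorem hasSurfaceIntegral_of_chart {u : DForm 𝓘(ℝ, ℂ) S 2} (hu : LocInt u) {z : S}
    (h0 : ∀ q, q ∉ (chartAt ℂ z).source → u q = 0)
    (hi : IntegrableOn (coeff u z) (chartAt ℂ z).target) :
    HasSurfaceIntegral u (∫ y in (chartAt ℂ z).target, coeff u z y) := by
  obtain ⟨m, pt, ρ, hρ⟩ := exists_chart_partition (S := S)
  rw [hasSurfaceIntegral_iff _ hu]
  refine ⟨m, pt, ρ, hρ, ?_⟩
  -- Each piece is supported both in its own chart and in the chart at `z`; moving all of them to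
  -- the latter lets the partition of unity be summed under one integral.
  have e : ∀ j, ∫ y in (chartAt ℂ (pt j)).target, coeff (fun q => (ρ j q : ℂ) • u q) (pt j) y =
      ∫ y in (chartAt ℂ z).target, coeff (fun q => (ρ j q : ℂ) • u q) z y := by
    intro j
    refine integral_coeff_change (fun r hr => ?_) fun r hr => by rw [h0 r hr]; exact form_smul_zero _
    rw [image_eq_zero_of_notMem_tsupport (f := fun q => ((ρ j q : ℝ) : ℂ))
      (by rw [tsupport_ofReal]; exact fun h => hr (hρ j h))]
    exact form_zero_smul _
  rw [surfSum, Finset.sum_congr rfl fun j _ => e j, ← integral_finsetSum]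
  · refine setIntegral_congr_fun (chartAt ℂ z).open_target.measurableSet fun y _ => ?_
    beta_reduce
    rw [← coeff_sum]
    simp only [sum_smul_partition]
  · intro j _
    have hb : ∀ y, ‖(ρ j ((chartAt ℂ z).symm y) : ℂ)‖ ≤ 1 := fun y => by
      rw [Complex.norm_real, Real.norm_of_nonneg (ρ.nonneg j _)]
      exact ρ.le_one j _
    refine Integrable.bdd_mul (c := 1) hi ?_ (Eventually.of_forall hb)
    refine ContinuousOn.aestronglyMeasurable ?_ (chartAt ℂ z).open_target.measurableSet
    exact (continuous_partition ρ j).comp_continuousOn (chartAt ℂ z).continuousOn_symm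

end Surface

end RegInt
end

noncomputable section

namespace RegInt

open Filter MeasureTheory

/-! ### Poles at points of a surface, independently of the chart. -/

section LocalPoles

variable {S : Type*} [TopologicalSpace S] [ChartedSpace ℂ S] {k : ℕ}

/-- Poles of order at most `N` at `p` along a finite set of points of a surface. -/
abbrev HasPoleOn (D : Finset S) (N : ℕ) (w : DForm 𝓘(ℝ, ℂ) S k) (p : S) : Prop :=
  HasPoleLEAt 𝓘(ℝ, ℂ) (fun (_ : D) (q : S) => q) (fun (d : D) (_ : S) => (d : S)) N w p

open Classical in
/-- The local equation of `D` at the point `p`, in a coordinate in which `p` is `y₀`. -/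
def pointEq (D : Finset S) (p : S) (y₀ y : ℂ) : ℂ := if p ∈ D then y - y₀ else 1

theorem contDiff_pointEq (D : Finset S) (p : S) (y₀ : ℂ) : ContDiff ℝ ∞ (pointEq D p y₀) := by
  unfold pointEq
  split_ifs <;> fun_prop

/-- The points of `D` are distinct, so at most one factor of the product is present at `p`. -/
theorem localEq_points (D : Finset S) (p q : S) :
    localEq (fun (_ : D) (q : S) => q) (fun (d : D) (_ : S) => (d : S)) p q =
      pointEq D p (chartAt ℂ p p) (chartAt ℂ p q) := by
  classical
  unfold localEq pointEq
  by_cases hp : p ∈ D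
  · rw [if_pos hp]
    refine (Finset.prod_eq_single (⟨p, hp⟩ : D) ?_ ?_).trans rfl
    · intro d hd hne
      exact absurd (Subtype.ext (Finset.mem_filter.1 hd).2.symm) hne
    · intro h
      exact (h (Finset.mem_filter.2 ⟨Finset.mem_univ _, rfl⟩)).elim
  · rw [if_neg hp]
    refine Finset.prod_eq_one fun d hd => ?_
    have h : p = (d : S) := (Finset.mem_filter.1 hd).2
    exact absurd (h ▸ d.2) hp

theorem off_points (D : Finset S) (q : S) : (∀ j : D, q ≠ (j : S)) ↔ q ∉ D :=
  ⟨fun h hq => h ⟨q, hq⟩ rfl, fun h j hj => h (hj ▸ j.2)⟩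

variable [IsManifold 𝓘(ℂ, ℂ) ω S]

/-- A change of coordinates divided by the linear coordinate is an invertible function. -/
theorem exists_unit_trans {z p : S} (hp : p ∈ (chartAt ℂ z).source) :
    ∃ u : ℂ → ℂ, (∀ᶠ y in 𝓝 (chartAt ℂ z p), ContDiffAt ℝ ∞ u y ∧ u y ≠ 0) ∧
      ∀ y, trans z p y - chartAt ℂ p p = (y - chartAt ℂ z p) * u y := by
  set y₀ := chartAt ℂ z p with hy₀
  have hinv : (chartAt ℂ z).symm y₀ = p := (chartAt ℂ z).left_inv hp
  have hyD : y₀ ∈ transDomain z p := ⟨(chartAt ℂ z).map_source hp, by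
    simp only [Set.mem_preimage, hinv]; exact mem_chart_source ℂ p⟩
  have hτ : trans z p y₀ = chartAt ℂ p p := by simp [trans, hinv]
  have hDo := (isOpen_transDomain z p).mem_nhds hyD
  have hd : DifferentiableOn ℂ (trans z p) (transDomain z p) := fun y hy =>
    ((contDiffAt_trans hy).differentiableAt (by simp)).differentiableWithinAt
  -- The difference quotient extends holomorphically over `y₀` by the removable singularity theorem;
  -- it is the required function.
  have hds : DifferentiableOn ℂ (dslope (trans z p) y₀) (transDomain z p) :=
    (Complex.differentiableOn_dslope hDo).2 hd
  have hsm : ∀ y ∈ transDomain z p, ContDiffAt ℝ ∞ (dslope (trans z p) y₀) y := fun y hy =>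
    ((hds.analyticAt ((isOpen_transDomain z p).mem_nhds hy)).contDiffAt (n := ∞)).restrict_scalars ℝ
  -- Its value at `y₀` is the derivative of the transition map, invertible because the opposite
  -- transition is a local inverse.
  have hne : dslope (trans z p) y₀ y₀ ≠ 0 := by
    rw [dslope_same]
    intro h0
    have hmem : trans z p y₀ ∈ transDomain p z := by
      rw [← image_trans z p]; exact ⟨_, hyD, rfl⟩
    have h1 : HasDerivAt (trans p z ∘ trans z p) (deriv (trans p z) (trans z p y₀) *
        deriv (trans z p) y₀) y₀ :=
      (((contDiffAt_trans hmem).differentiableAt (by simp)).hasDerivAt).comp y₀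
        (((contDiffAt_trans hyD).differentiableAt (by simp)).hasDerivAt)
    have h2 : trans p z ∘ trans z p =ᶠ[𝓝 y₀] id := by
      filter_upwards [hDo] with y hy
      simp only [trans, Function.comp_apply]
      rw [(chartAt ℂ p).left_inv hy.2, (chartAt ℂ z).right_inv hy.1, id]
    have h3 := (h1.congr_of_eventuallyEq h2.symm).unique (hasDerivAt_id y₀)
    rw [h0, mul_zero] at h3
    exact zero_ne_one h3
  refine ⟨dslope (trans z p) y₀, ?_, fun y => ?_⟩
  · filter_upwards [hDo, (hsm y₀ hyD).continuousAt.eventually_ne hne] with y h1 h2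
      using ⟨hsm y h1, h2⟩
  · rw [← hτ, ← smul_eq_mul, sub_smul_dslope]

/-- Poles at a point can be read in any chart. -/
theorem hasPoleOn_iff {D : Finset S} {N : ℕ} {w : DForm 𝓘(ℝ, ℂ) S k} {z p : S}
    (hp : p ∈ (chartAt ℂ z).source) :
    HasPoleOn D N w p ↔ ∃ f : ℂ → ℂ [⋀^Fin k]→L[ℝ] ℂ, ∀ᶠ y in 𝓝 (chartAt ℂ z p),
      ContDiffAt ℝ ∞ f y ∧ ((chartAt ℂ z).symm y ∉ D →
        pointEq D p (chartAt ℂ z p) y ^ N • inChart 𝓘(ℝ, ℂ) w z y = f y) := by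
  classical
  obtain ⟨u, hu, huy⟩ := exists_unit_trans hp
  -- The ratio of the local equations of `D` in the two charts, a unit that can be absorbed into the
  -- smooth numerator.
  set v : ℂ → ℂ := fun y => if p ∈ D then u y else 1 with hv
  have hv1 : ∀ᶠ y in 𝓝 (chartAt ℂ z p), ContDiffAt ℝ ∞ v y ∧ v y ≠ 0 := by
    by_cases h : p ∈ D
    · simpa only [hv, if_pos h] using hu
    · simp only [hv, if_neg h]
      exact Eventually.of_forall fun y => ⟨contDiffAt_const, one_ne_zero⟩
  have hvy : ∀ y, pointEq D p (chartAt ℂ p p) (trans z p y) =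
      v y * pointEq D p (chartAt ℂ z p) y := fun y => by
    unfold pointEq
    by_cases h : p ∈ D
    · simp only [hv, if_pos h, huy, mul_comm]
    · simp only [hv, if_neg h, mul_one]
  have ht : ∀ᶠ y in 𝓝 (chartAt ℂ z p), y ∈ (chartAt ℂ z).target :=
    (chartAt ℂ z).open_target.mem_nhds ((chartAt ℂ z).map_source hp)
  constructor
  · rintro ⟨η, hη⟩
    have hc : ContinuousAt (chartAt ℂ z).symm (chartAt ℂ z p) :=
      (chartAt ℂ z).continuousAt_symm ((chartAt ℂ z).map_source hp)
    have hη' := hc.eventually (by rw [(chartAt ℂ z).left_inv hp]; exact hη)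
    refine ⟨fun y => (v y ^ N)⁻¹ • inChart 𝓘(ℝ, ℂ) η z y, ?_⟩
    filter_upwards [hη', hv1, ht] with y h1 h2 h3
    refine ⟨((h2.1.pow N).inv (pow_ne_zero _ h2.2)).smul
      ((contDiffAt_inChart_iff holAtlas_surface (by rwa [extChartAt_target_plane])).2 h1.1), ?_⟩
    intro hD
    have h4 := h1.2 ((off_points D _).2 hD)
    rw [localEq_points] at h4
    have h5 : inChart 𝓘(ℝ, ℂ) (fun q => pointEq D p (chartAt ℂ p p) (chartAt ℂ p q) ^ N • w q) z y
        = inChart 𝓘(ℝ, ℂ) η z y := inChart_congr_point h4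
    rw [inChart_smul] at h5
    change pointEq D p (chartAt ℂ p p) (trans z p y) ^ N • _ = _ at h5
    rw [← h5, hvy, mul_pow, mul_smul, smul_smul, inv_mul_cancel₀ (pow_ne_zero _ h2.2), one_smul]
  · rintro ⟨f, hf⟩
    refine ⟨pullChart 𝓘(ℝ, ℂ) z fun y => v y ^ N • f y, ?_⟩
    have hc : ContinuousAt (chartAt ℂ z) p := (chartAt ℂ z).continuousAt hp
    filter_upwards [hc.eventually hf, hc.eventually hv1, (chartAt ℂ z).open_source.mem_nhds hp]
      with q h1 h2 h3
    refine ⟨smoothFormAt_pullChart holAtlas_surface (by rwa [extChartAt_source_plane])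
      ((h2.1.pow N).smul h1.1), fun hD => ?_⟩
    rw [off_points] at hD
    refine inChart_injective holAtlas_surface (p := z)
      (w := fun q => localEq (fun (_ : D) (q : S) => q) (fun (d : D) (_ : S) => (d : S)) p q ^ N • w q)
      (by rwa [extChartAt_source_plane]) ?_
    rw [inChart_pullChart holAtlas_surface _ _
      (by rw [extChartAt_target_plane]; exact (chartAt ℂ z).map_source h3), inChart_smul]
    change localEq (fun (_ : D) (q : S) => q) (fun (d : D) (_ : S) => (d : S)) p
      ((chartAt ℂ z).symm (chartAt ℂ z q)) ^ N • inChart _ _ _ (chartAt ℂ z q) =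
      v (chartAt ℂ z q) ^ N • f (chartAt ℂ z q)
    have h4 := h1.2 (by rwa [(chartAt ℂ z).left_inv h3])
    rw [← h4, localEq_points]
    change pointEq D p (chartAt ℂ p p) (trans z p (chartAt ℂ z q)) ^ N • _ = _
    rw [hvy, mul_pow, mul_smul]

theorem HasPoleOn.mono {D : Finset S} {N N' : ℕ} {w : DForm 𝓘(ℝ, ℂ) S k} {p : S} (h : N ≤ N')
    (hw : HasPoleOn D N w p) : HasPoleOn D N' w p := by
  rw [hasPoleOn_iff (mem_chart_source ℂ p)] at hw ⊢
  obtain ⟨f, hf⟩ := hw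
  refine ⟨fun y => pointEq D p (chartAt ℂ p p) y ^ (N' - N) • f y, ?_⟩
  filter_upwards [hf] with y hy
  refine ⟨((contDiff_pointEq D p _).contDiffAt.pow _).smul hy.1, fun hD => ?_⟩
  rw [← hy.2 hD, smul_smul, ← pow_add, Nat.sub_add_cancel h]

theorem HasPoleOn.congr [T1Space S] {D : Finset S} {N : ℕ} {w w' : DForm 𝓘(ℝ, ℂ) S k} {p : S}
    (hw : HasPoleOn D N w p) (h : ∀ᶠ q in 𝓝 p, q ∉ D → w q = w' q) : HasPoleOn D N w' p := by
  obtain ⟨η, hη⟩ := hw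
  refine ⟨η, ?_⟩
  filter_upwards [hη, h] with q h1 h2
  exact ⟨h1.1, fun hq => by rw [← h2 ((off_points D q).1 hq)]; exact h1.2 hq⟩

theorem HasPoleOn.add {D : Finset S} {N : ℕ} {w w' : DForm 𝓘(ℝ, ℂ) S k} {p : S}
    (hw : HasPoleOn D N w p) (hw' : HasPoleOn D N w' p) : HasPoleOn D N (w + w') p := by
  obtain ⟨η, hη⟩ := hw
  obtain ⟨η', hη'⟩ := hw'
  refine ⟨η + η', ?_⟩
  filter_upwards [hη, hη'] with q h1 h2
  refine ⟨h1.1.add h2.1, fun hq => ?_⟩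
  rw [Pi.add_apply, Pi.add_apply, smul_add, h1.2 hq, h2.2 hq]

theorem HasPoleOn.smul {D : Finset S} {N : ℕ} {w : DForm 𝓘(ℝ, ℂ) S k} {p : S} {c : S → ℂ}
    (hc : ∀ᶠ q in 𝓝 p, SmoothFunAt 𝓘(ℝ, ℂ) c q) (hw : HasPoleOn D N w p) :
    HasPoleOn D N (fun q => c q • w q) p := by
  obtain ⟨η, hη⟩ := hw
  refine ⟨fun q => c q • η q, ?_⟩
  filter_upwards [hη, hc] with q h1 h2
  refine ⟨SmoothFormAt.smul h2 h1.1, fun hq => ?_⟩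
  rw [smul_comm, h1.2 hq]

theorem hasPoleOn_of_smooth {D : Finset S} (N : ℕ) {w : DForm 𝓘(ℝ, ℂ) S k} {p : S}
    (h : ∀ᶠ q in 𝓝 p, SmoothFormAt 𝓘(ℝ, ℂ) w q) : HasPoleOn D N w p := by
  refine HasPoleOn.mono (Nat.zero_le N) ⟨w, ?_⟩
  filter_upwards [h] with q hq
  exact ⟨hq, fun _ => by rw [pow_zero, one_smul]⟩

theorem HasPoleOn.smoothFormAt [T1Space S] {D : Finset S} {N : ℕ} {w : DForm 𝓘(ℝ, ℂ) S k} {p : S}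
    (hw : HasPoleOn D N w p) (hp : p ∉ D) : SmoothFormAt 𝓘(ℝ, ℂ) w p := by
  obtain ⟨f, hf⟩ := (hasPoleOn_iff (mem_chart_source ℂ p)).1 hw
  have hD : ∀ᶠ q in 𝓝 p, q ∉ D := D.finite_toSet.isClosed.isOpen_compl.mem_nhds hp
  have hc : ContinuousAt (chartAt ℂ p).symm (chartAt ℂ p p) :=
    (chartAt ℂ p).continuousAt_symm (mem_chart_target ℂ p)
  have hD' := hc.eventually (by rw [(chartAt ℂ p).left_inv (mem_chart_source ℂ p)]; exact hD)
  refine hf.self_of_nhds.1.congr_of_eventuallyEq ?_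
  filter_upwards [hf, hD'] with y h1 h2
  rw [← h1.2 h2, pointEq, if_neg hp, one_pow, one_smul]

/-- In a chart centred anywhere, a form with a pole at `p` is a smooth form divided by a power of
the coordinate. -/
theorem HasPoleOn.exists_smooth {D : Finset S} {N : ℕ} {w : DForm 𝓘(ℝ, ℂ) S k} {z p : S}
    (hw : HasPoleOn D N w p) (hp : p ∈ (chartAt ℂ z).source) :
    ∃ f : ℂ → ℂ [⋀^Fin k]→L[ℝ] ℂ, ∀ᶠ y in 𝓝 (chartAt ℂ z p),
      ContDiffAt ℝ ∞ f y ∧ ((chartAt ℂ z).symm y ∉ D →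
        (y - chartAt ℂ z p) ^ N • inChart 𝓘(ℝ, ℂ) w z y = f y) := by
  obtain ⟨f, hf⟩ := (hasPoleOn_iff hp).1 hw
  by_cases h : p ∈ D
  · simp only [pointEq, if_pos h] at hf
    exact ⟨f, hf⟩
  · simp only [pointEq, if_neg h, one_pow, one_smul] at hf
    refine ⟨fun y => (y - chartAt ℂ z p) ^ N • f y, ?_⟩
    filter_upwards [hf] with y hy
    exact ⟨((contDiffAt_id.sub contDiffAt_const).pow N).smul hy.1, fun hD => by rw [hy.2 hD]⟩

theorem ae_ne_point (p : ℂ) : ∀ᵐ z : ℂ, z ≠ p := by simp [ae_iff, measure_singleton]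

/-- In real dimension two a first-order pole is integrable, and the smooth numerator is bounded on a
small closed disc. The uncontrolled values at the points of `D` form a null set. -/
theorem IsLogOn.locInt [T2Space S] [CompactSpace S] {D : Finset S} {w : DForm 𝓘(ℝ, ℂ) S 2} (hw : IsLogOn D w) : LocInt w := by
  intro q
  obtain ⟨f, hf⟩ := HasPoleOn.exists_smooth (hw q) (mem_chart_source ℂ q)
  have ht : ∀ᶠ y in 𝓝 (chartAt ℂ q q), y ∈ (chartAt ℂ q).target :=
    (chartAt ℂ q).open_target.mem_nhds (mem_chart_target ℂ q)
  obtain ⟨r, hr, hball⟩ := Metric.nhds_basis_closedBall.mem_iff.1 (hf.and ht)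
  set K := Metric.closedBall (chartAt ℂ q q) r
  refine ⟨K, Metric.closedBall_mem_nhds _ hr, ?_⟩
  have hK : IsCompact K := isCompact_closedBall _ _
  have hi : IntegrableOn (fun y => (y - chartAt ℂ q q)⁻¹) K :=
    (locallyIntegrable_inv_sub _).integrableOn_isCompact hK
  have hfc : ContinuousOn (fun y => f y ![1, Complex.I]) K := fun y hy =>
    (((ContinuousAlternatingMap.apply ℝ ℂ ℂ ![1, Complex.I]).continuous.continuousAt).comp
      (hball hy).1.1.continuousAt).continuousWithinAt
  refine (hi.mul_continuousOn hfc hK).congr_fun_ae ?_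
  have h1 := ae_restrict_of_ae_restrict_of_subset (fun y hy => (hball hy).2) (ae_chart_notMem D q)
  filter_upwards [h1, ae_restrict_of_ae (ae_ne_point (chartAt ℂ q q)),
    ae_restrict_mem hK.measurableSet] with y h1 h2 h3
  rw [← (hball h3).1.2 h1, coeff, pow_one, ContinuousAlternatingMap.smul_apply, smul_eq_mul,
    ← mul_assoc, inv_mul_cancel₀ (sub_ne_zero.2 h2), one_mul]

end LocalPoles

end RegInt
end

noncomputable section

namespace RegInt

open Filter MeasureTheory

/-! ### `∂` of `(0,1)`-forms in a coordinate. -/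

section Plane

/-- A form of type `(0,1)` is `b dz̄` with `b` its value at `1`, so `∂` gives `∂_z b dz ∧ dz̄`, and
`dz ∧ dz̄ = -2i dx ∧ dy`. The type condition is needed on a neighbourhood because it is
differentiated. -/
theorem delAt_zero_one_apply {B : ℂ → ℂ [⋀^Fin 1]→L[ℝ] ℂ} {y : ℂ} (hB : DifferentiableAt ℝ B y)
    (h : ∀ᶠ y in 𝓝 y, B y (fun _ => Complex.I) = -Complex.I * B y (fun _ => 1)) :
    delAt B y ![1, Complex.I] = -2 * Complex.I * wirt (fun y => B y (fun _ => 1)) y := by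
  have hev : ∀ a v : ℂ, complexLinearPart (fderiv ℝ B y) a (fun _ => v) =
      complexLinearPart (fderiv ℝ (fun y => B y (fun _ => v)) y) a := by
    intro a v
    have h1 : fderiv ℝ (fun y => B y (fun _ => v)) y =
        ((ContinuousAlternatingMap.apply ℝ ℂ ℂ (fun _ : Fin 1 => v))).comp (fderiv ℝ B y) :=
      (((ContinuousAlternatingMap.apply ℝ ℂ ℂ
        (fun _ : Fin 1 => v)).hasFDerivAt).comp y hB.hasFDerivAt).fderiv
    rw [h1, complexLinearPart_apply, complexLinearPart_apply]
    rfl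
  have e1 : Fin.removeNth 0 ![(1 : ℂ), Complex.I] = fun _ => Complex.I := by
    ext i; fin_cases i; rfl
  have e2 : Fin.removeNth 1 ![(1 : ℂ), Complex.I] = fun _ => 1 := by
    ext i; fin_cases i; rfl
  rw [delAt, ContinuousAlternatingMap.alternatizeUncurryFin_apply, Fin.sum_univ_two, e1, e2]
  simp only [Fin.val_zero, pow_zero, one_smul, Fin.val_one, pow_one, Matrix.cons_val_zero,
    Matrix.cons_val_one]
  have hI : complexLinearPart (fderiv ℝ B y) Complex.I =
      Complex.I • complexLinearPart (fderiv ℝ B y) 1 := by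
    rw [← complexLinearPart_I_smul, smul_eq_mul, mul_one]
  have hd : DifferentiableAt ℝ (fun y => B y (fun _ => 1)) y :=
    ((ContinuousAlternatingMap.apply ℝ ℂ ℂ
        (fun _ : Fin 1 => (1 : ℂ))).differentiableAt).comp y hB
  rw [hI, ContinuousAlternatingMap.smul_apply, hev, hev, ← wirt, ← wirt, wirt_congr h]
  have := wirt_const_smul hd (-Complex.I)
  simp only [smul_eq_mul] at this
  rw [this]
  simp only [smul_eq_mul, neg_smul, one_smul]
  ring

/-- The form `dz̄`. -/
def dzbar : ℂ [⋀^Fin 1]→L[ℝ] ℂ :=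
  ContinuousAlternatingMap.ofSubsingleton ℝ ℂ ℂ (0 : Fin 1) (Complex.conjCLE : ℂ →L[ℝ] ℂ)

theorem dzbar_apply (v : Fin 1 → ℂ) : dzbar v = (starRingEnd ℂ) (v 0) := rfl

/-- The area form `dx ∧ dy`. -/
def area : ℂ [⋀^Fin 2]→L[ℝ] ℂ :=
  ((-2 * Complex.I)⁻¹) • delAt (fun y => y • dzbar) 0

theorem wirt_id : wirt (fun y => y) (0 : ℂ) = 1 := by
  rw [wirt_of_holomorphic (by fun_prop)]; simp

theorem delAt_smul_dzbar_apply {b : ℂ → ℂ} {y : ℂ} (hb : DifferentiableAt ℝ b y) :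
    delAt (fun y => b y • dzbar) y ![1, Complex.I] = -2 * Complex.I * wirt b y := by
  rw [delAt_zero_one_apply (hb.smul_const dzbar)]
  · congr 2
    ext y
    simp [dzbar_apply]
  · refine Eventually.of_forall fun y => ?_
    simp [dzbar_apply]
    ring

theorem area_apply : area ![1, Complex.I] = 1 := by
  rw [area, ContinuousAlternatingMap.smul_apply, delAt_smul_dzbar_apply (by fun_prop), wirt_id]
  rw [mul_one, smul_eq_mul, inv_mul_cancel₀ (by simp [Complex.I_ne_zero])]

theorem eq_smul_area (A : ℂ [⋀^Fin 2]→L[ℝ] ℂ) : A = A ![1, Complex.I] • area := by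
  refine alternating_two_ext ?_
  rw [ContinuousAlternatingMap.smul_apply, area_apply, smul_eq_mul, mul_one]

theorem delAt_smul_dzbar {b : ℂ → ℂ} {y : ℂ} (hb : DifferentiableAt ℝ b y) :
    delAt (fun y => b y • dzbar) y = (-2 * Complex.I * wirt b y) • area := by
  rw [eq_smul_area (delAt _ _), delAt_smul_dzbar_apply hb]

end Plane

/-! ### Linearity of the regularized integral. -/

section Algebra

variable {S : Type*} [TopologicalSpace S] [ChartedSpace ℂ S] [IsManifold 𝓘(ℂ, ℂ) ω S]

theorem IsPolarOn.exists_le {D : Finset S} {k : ℕ} {w w' : DForm 𝓘(ℝ, ℂ) S k} (hw : IsPolarOn D w)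
    (hw' : IsPolarOn D w') (p : S) : ∃ N, HasPoleOn D N w p ∧ HasPoleOn D N w' p := by
  obtain ⟨N, h⟩ := hw p
  obtain ⟨N', h'⟩ := hw' p
  exact ⟨max N N', HasPoleOn.mono (le_max_left _ _) h, HasPoleOn.mono (le_max_right _ _) h'⟩

theorem IsPolarOn.add {D : Finset S} {k : ℕ} {w w' : DForm 𝓘(ℝ, ℂ) S k} (hw : IsPolarOn D w)
    (hw' : IsPolarOn D w') : IsPolarOn D (w + w') := fun p => by
  obtain ⟨N, h, h'⟩ := hw.exists_le hw' p
  exact ⟨N, HasPoleOn.add h h'⟩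

theorem IsPolarOn.const_smul {D : Finset S} {k : ℕ} {w : DForm 𝓘(ℝ, ℂ) S k} (hw : IsPolarOn D w)
    (c : ℂ) : IsPolarOn D (fun q => c • w q) := fun p => by
  obtain ⟨N, h⟩ := hw p
  exact ⟨N, HasPoleOn.smul (Eventually.of_forall fun q => smoothFunAt_const c q) h⟩

theorem IsPolarOn.smoothFormAt [T1Space S] {D : Finset S} {k : ℕ} {w : DForm 𝓘(ℝ, ℂ) S k}
    (hw : IsPolarOn D w) {p : S} (hp : p ∉ D) : SmoothFormAt 𝓘(ℝ, ℂ) w p := by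
  obtain ⟨N, h⟩ := hw p
  exact HasPoleOn.smoothFormAt h hp

theorem isPolarOn_zero (D : Finset S) (k : ℕ) : IsPolarOn D (0 : DForm 𝓘(ℝ, ℂ) S k) := fun _ =>
  ⟨0, hasPoleOn_of_smooth 0 (Eventually.of_forall fun q => smoothFormAt_zero q)⟩

theorem isLogOn_zero (D : Finset S) : IsLogOn D (0 : DForm 𝓘(ℝ, ℂ) S 2) := fun _ =>
  hasPoleOn_of_smooth 1 (Eventually.of_forall fun q => smoothFormAt_zero q)

theorem HasRegIntegral.congr {D : Finset S} {w w' : DForm 𝓘(ℝ, ℂ) S 2} {c : ℂ}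
    (hw : HasRegIntegral D w c) (h : ∀ q, q ∉ D → w q = w' q) : HasRegIntegral D w' c := by
  obtain ⟨α, β, h1, h2, h3, h4, h5⟩ := hw
  exact ⟨α, β, h1, h2, h3, fun q hq => by rw [← h q hq, h4 q hq], h5⟩

variable [T2Space S] [CompactSpace S]

theorem hasSurfaceIntegral_zero : HasSurfaceIntegral (0 : DForm 𝓘(ℝ, ℂ) S 2) 0 := by
  have := HasSurfaceIntegral.sum (∅ : Finset ℕ) (u := fun _ => (0 : DForm 𝓘(ℝ, ℂ) S 2))
    (c := fun _ => 0) (by simp) (by simp)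
  exact this

theorem HasSurfaceIntegral.add {u u' : DForm 𝓘(ℝ, ℂ) S 2} {c c' : ℂ} (hu : LocInt u)
    (hu' : LocInt u') (h : HasSurfaceIntegral u c) (h' : HasSurfaceIntegral u' c') :
    HasSurfaceIntegral (u + u') (c + c') := by
  have := HasSurfaceIntegral.sum (Finset.univ : Finset (Fin 2)) (u := ![u, u']) (c := ![c, c'])
    (fun i _ => by fin_cases i; exacts [hu, hu']) (fun i _ => by fin_cases i; exacts [h, h'])
  simp only [Fin.sum_univ_two] at this
  exact this

theorem HasRegIntegral.add {D : Finset S} {w w' : DForm 𝓘(ℝ, ℂ) S 2} {c c' : ℂ}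
    (hw : HasRegIntegral D w c) (hw' : HasRegIntegral D w' c') :
    HasRegIntegral D (w + w') (c + c') := by
  obtain ⟨α, β, h1, h2, h3, h4, h5⟩ := hw
  obtain ⟨α', β', h1', h2', h3', h4', h5'⟩ := hw'
  refine ⟨α + α', β + β', fun p => HasPoleOn.add (h1 p) (h1' p), h2.add h2', fun q hq v => ?_,
    fun q hq => ?_, h5.add (IsLogOn.locInt h1) (IsLogOn.locInt h1') h5'⟩
  · simp only [Pi.add_apply, ContinuousAlternatingMap.add_apply, h3 q hq, h3' q hq, mul_add]
  · rw [del_add (h2.smoothFormAt hq) (h2'.smoothFormAt hq), Pi.add_apply, Pi.add_apply, h4 q hq,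
      h4' q hq]
    exact add_add_add_comm _ _ _ _

theorem HasRegIntegral.const_smul {D : Finset S} {w : DForm 𝓘(ℝ, ℂ) S 2} {c : ℂ}
    (hw : HasRegIntegral D w c) (a : ℂ) : HasRegIntegral D (fun q => a • w q) (a * c) := by
  obtain ⟨α, β, h1, h2, h3, h4, h5⟩ := hw
  refine ⟨fun q => a • α q, fun q => a • β q, fun p => HasPoleOn.smul
    (Eventually.of_forall fun q => smoothFunAt_const a q) (h1 p), h2.const_smul a,
    fun q hq v => ?_, fun q hq => ?_, h5.const_smul (IsLogOn.locInt h1) a⟩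
  · simp only [ContinuousAlternatingMap.smul_apply, h3 q hq, smul_eq_mul]; ring
  · rw [del_const_smul (h2.smoothFormAt hq)]
    beta_reduce
    rw [h4 q hq]
    exact smul_add _ _ _

theorem hasRegIntegral_del {D : Finset S} {β : DForm 𝓘(ℝ, ℂ) S 1} (h : IsPolarOn D β)
    (h' : IsTypeZeroOneOff D β) : HasRegIntegral D (del 𝓘(ℝ, ℂ) β) 0 :=
  ⟨0, β, isLogOn_zero D, h, h', fun q _ => (zero_add _).symm, hasSurfaceIntegral_zero⟩

theorem hasRegIntegral_zero (D : Finset S) : HasRegIntegral D 0 0 := by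
  refine (hasRegIntegral_del (isPolarOn_zero D 1) fun q _ v => ?_).congr fun q _ => del_zero q
  simp

theorem HasRegIntegral.sum {D : Finset S} {κ : Type*} (t : Finset κ)
    {u : κ → DForm 𝓘(ℝ, ℂ) S 2} {c : κ → ℂ} (h : ∀ i ∈ t, HasRegIntegral D (u i) (c i)) :
    HasRegIntegral D (fun q => ∑ i ∈ t, u i q) (∑ i ∈ t, c i) := by
  classical
  induction t using Finset.induction_on with
  | empty => exact hasRegIntegral_zero D
  | insert a t ha ih =>
    rw [Finset.sum_insert ha]
    refine ((h a (Finset.mem_insert_self a t)).add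
      (ih fun i hi => h i (Finset.mem_insert_of_mem hi))).congr fun q _ => ?_
    rw [Finset.sum_insert ha]
    rfl

end Algebra

/-! ### Stokes' theorem with one pole in a chart. -/

section Stokes

variable {S : Type*} [TopologicalSpace S] [ChartedSpace ℂ S] [IsManifold 𝓘(ℂ, ℂ) ω S]
  [T2Space S] [CompactSpace S]

/-- A form with compact support in a chart and at most one pole becomes, after multiplication by
a power of the coordinate, a smooth form on the plane. -/
theorem exists_test_of_pole {D : Finset S} {k N : ℕ} {w : DForm 𝓘(ℝ, ℂ) S k} {z : S} {T : Set S}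
    (hT : IsClosed T) (hTz : T ⊆ (chartAt ℂ z).source) (hTD : ∀ q ∈ T, q ∈ D → q = z)
    (h0 : ∀ q, q ∉ T → w q = 0) (hs : ∀ q, q ∉ D → SmoothFormAt 𝓘(ℝ, ℂ) w q)
    (hp : HasPoleOn D N w z) (A : (ℂ [⋀^Fin k]→L[ℝ] ℂ) →L[ℝ] ℂ) :
    ∃ b : ℂ → ℂ, IsTest b ∧ (∀ y, y ∉ chartAt ℂ z '' T → b y = 0) ∧
      ∀ y ∈ (chartAt ℂ z).target, y ≠ chartAt ℂ z z →
        b y = A ((y - chartAt ℂ z z) ^ N • inChart 𝓘(ℝ, ℂ) w z y) := by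
  classical
  set p := chartAt ℂ z z
  set K := chartAt ℂ z '' T with hK
  have hKc : IsCompact K := hT.isCompact.image_of_continuousOn
    ((chartAt ℂ z).continuousOn.mono hTz)
  obtain ⟨f, hf⟩ := hp.exists_smooth (mem_chart_source ℂ z)
  have hKt : K ⊆ (chartAt ℂ z).target := by
    rintro _ ⟨x, hx, rfl⟩
    exact (chartAt ℂ z).map_source (hTz hx)
  have hoff : ∀ y ∈ (chartAt ℂ z).target, y ∉ K → inChart 𝓘(ℝ, ℂ) w z y = 0 := by
    intro y hy hyK
    have : w ((extChartAt 𝓘(ℝ, ℂ) z).symm y) = 0 :=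
      h0 _ fun h => hyK ⟨_, h, (chartAt ℂ z).right_inv hy⟩
    unfold inChart
    rw [this]
    rfl
  have hpt : p ∈ (chartAt ℂ z).target := mem_chart_target ℂ z
  -- The form has no meaningful value at the pole, so `b p` is taken from the smooth local numerator
  -- `f` when `p` lies in `K`; near `p` the function then agrees with `A ∘ f`.
  set b : ℂ → ℂ := fun y => if y ∈ K then
    (if y = p then A (f p) else A ((y - p) ^ N • inChart 𝓘(ℝ, ℂ) w z y)) else 0 with hb
  have hb0 : ∀ y, y ∉ K → b y = 0 := fun y hy => if_neg hy
  have hbe : ∀ y ∈ (chartAt ℂ z).target, y ≠ p →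
      b y = A ((y - p) ^ N • inChart 𝓘(ℝ, ℂ) w z y) := by
    intro y hy hyp
    by_cases h : y ∈ K
    · simp only [hb, if_pos h, if_neg hyp]
    · rw [hb0 y h, hoff y hy h, form_smul_zero, map_zero]
  refine ⟨b, ⟨contDiff_iff_contDiffAt.2 fun y => ?_, HasCompactSupport.intro hKc hb0⟩, hb0, hbe⟩
  by_cases hyK : y ∈ K
  swap
  · refine (contDiffAt_const (c := (0 : ℂ))).congr_of_eventuallyEq ?_
    filter_upwards [hKc.isClosed.isOpen_compl.mem_nhds hyK] with y hy using hb0 y hy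
  by_cases hyp : y = p
  · rw [hyp] at hyK ⊢
    have hzT : z ∈ T := by
      obtain ⟨q, hq, hqp⟩ := hyK
      rwa [(chartAt ℂ z).injOn (hTz hq) (mem_chart_source ℂ z) hqp] at hq
    have hfd : ContDiffAt ℝ ∞ (fun y => A (f y)) p :=
      A.contDiff.contDiffAt.comp p hf.self_of_nhds.1
    refine hfd.congr_of_eventuallyEq ?_
    have hD : ∀ᶠ y in 𝓝 p, (chartAt ℂ z).symm y ∉ (D.erase z : Finset S) := by
      have hc := (chartAt ℂ z).continuousAt_symm hpt
      refine hc.eventually (p := fun q => q ∉ D.erase z) ?_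
      rw [(chartAt ℂ z).left_inv (mem_chart_source ℂ z)]
      exact (D.erase z).finite_toSet.isClosed.isOpen_compl.mem_nhds (by simp)
    filter_upwards [hf, hD, (chartAt ℂ z).open_target.mem_nhds hpt] with y h1 h2 h3
    by_cases h : y = p
    · rw [h]
      simp only [hb, if_pos hyK, if_true]
    · rw [hbe y h3 h, ← h1.2]
      intro h4
      refine h2 (Finset.mem_erase.2 ⟨fun h5 => h ?_, h4⟩)
      rw [← (chartAt ℂ z).right_inv h3, h5]
  · have hyt := hKt hyK
    have hyD : (chartAt ℂ z).symm y ∉ D := by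
      intro h
      obtain ⟨q, hq, rfl⟩ := hyK
      rw [(chartAt ℂ z).left_inv (hTz hq)] at h
      exact hyp (by rw [hTD q hq h])
    have hw : ContDiffAt ℝ ∞ (inChart 𝓘(ℝ, ℂ) w z) y :=
      (contDiffAt_inChart_iff holAtlas_surface (by rwa [extChartAt_target_plane])).2 (hs _ hyD)
    have h1 : ContDiffAt ℝ ∞ (fun y => A ((y - p) ^ N • inChart 𝓘(ℝ, ℂ) w z y)) y :=
      A.contDiff.contDiffAt.comp y (((contDiffAt_id.sub contDiffAt_const).pow N).smul hw)
    refine h1.congr_of_eventuallyEq ?_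
    filter_upwards [(chartAt ℂ z).open_target.mem_nhds hyt, isOpen_ne.mem_nhds hyp] with y h1 h2
      using hbe y h1 h2

/-- The pull-back is taken along a holomorphic transition map, whose derivative commutes with
multiplication by `i`. -/
theorem inChart_type {D : Finset S} {β : DForm 𝓘(ℝ, ℂ) S 1} (hβ : IsTypeZeroOneOff D β) {z : S}
    {y : ℂ} (hy : y ∈ (chartAt ℂ z).target) (hD : (chartAt ℂ z).symm y ∉ D) :
    inChart 𝓘(ℝ, ℂ) β z y (fun _ => Complex.I) =
      -Complex.I * inChart 𝓘(ℝ, ℂ) β z y (fun _ => 1) := by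
  set q := (chartAt ℂ z).symm y with hq
  have hyD : y ∈ transDomain z q := ⟨hy, mem_chart_source ℂ q⟩
  have hd : DifferentiableAt ℂ (trans z q) y := (contDiffAt_trans hyD).differentiableAt (by simp)
  have hL : fderiv ℝ (trans z q) y Complex.I = Complex.I * fderiv ℝ (trans z q) y 1 := by
    have := fderiv_real_I_smul hd 1
    rwa [smul_eq_mul, mul_one] at this
  have := hβ q hD (fderiv ℝ (trans z q) y 1)
  rw [← hL] at this
  exact this

/-- Stokes' theorem for a form supported in a chart, with one pole. -/
theorem hasSurfaceIntegral_del_of_chart {D : Finset S} {β : DForm 𝓘(ℝ, ℂ) S 1} (z : S) {T : Set S}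
    (hT : IsClosed T) (hTz : T ⊆ (chartAt ℂ z).source) (hTD : ∀ q ∈ T, q ∈ D → q = z)
    (h0 : ∀ q, q ∉ T → β q = 0) (hβ : IsPolarOn D β) (htype : IsTypeZeroOneOff D β)
    (hlog : IsLogOn D (del 𝓘(ℝ, ℂ) β)) : HasSurfaceIntegral (del 𝓘(ℝ, ℂ) β) 0 := by
  set α := del 𝓘(ℝ, ℂ) β with hα
  set p := chartAt ℂ z z
  obtain ⟨N, hN⟩ := hβ z
  have hα0 : ∀ q, q ∉ T → α q = 0 := by
    intro q hq
    have h : β =ᶠ[𝓝 q] 0 := by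
      filter_upwards [hT.isOpen_compl.mem_nhds hq] with r hr
      exact h0 r hr
    rw [hα, del_congr h, del_zero]
  have hpolα : IsPolarOn D α := fun p => ⟨1, hlog p⟩
  obtain ⟨b, hb, hb0, hbe⟩ := exists_test_of_pole hT hTz hTD h0 (fun q hq => hβ.smoothFormAt hq) hN
    (ContinuousAlternatingMap.apply ℝ ℂ ℂ (fun _ : Fin 1 => (1 : ℂ)))
  obtain ⟨g, hg, hg0, hge⟩ := exists_test_of_pole hT hTz hTD hα0
    (fun q hq => hpolα.smoothFormAt hq) (hlog z)
    (ContinuousAlternatingMap.apply ℝ ℂ ℂ ![1, Complex.I])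
  set K := chartAt ℂ z '' T with hK
  have hKc : IsCompact K := hT.isCompact.image_of_continuousOn
    ((chartAt ℂ z).continuousOn.mono hTz)
  have hge' : ∀ y ∈ (chartAt ℂ z).target, y ≠ p → g y = (y - p) * coeff α z y := by
    intro y h1 h2
    rw [hge y h1 h2, pow_one]; rfl
  have hI : (-2 * Complex.I : ℂ) ≠ 0 := by simp [Complex.I_ne_zero]
  -- With `β = β₁ dz̄` one has `b = (y - p)^N β₁`, while `g` is `y - p` times the coefficient `-2i
  -- ∂_z β₁` of `∂β`. The factor `(-2i)⁻¹` normalizes this, and the hypothesis to be checked is the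
  -- product rule for `b`.
  have key := integral_eq_zero_of_wirt_log hb (hg.const_smul (-2 * Complex.I)⁻¹) p N (by
    intro y hyp
    by_cases hyK : y ∈ K
    · have hyt : y ∈ (chartAt ℂ z).target := by
        obtain ⟨q, hq, rfl⟩ := hyK
        exact (chartAt ℂ z).map_source (hTz hq)
      have hyD : (chartAt ℂ z).symm y ∉ D := by
        intro h
        obtain ⟨q, hq, rfl⟩ := hyK
        rw [(chartAt ℂ z).left_inv (hTz hq)] at h
        exact hyp (by rw [hTD q hq h])
      have hsm : ContDiffAt ℝ ∞ (inChart 𝓘(ℝ, ℂ) β z) y :=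
        (contDiffAt_inChart_iff holAtlas_surface (by rwa [extChartAt_target_plane])).2
          (hβ.smoothFormAt hyD)
      have hd : DifferentiableAt ℝ (inChart 𝓘(ℝ, ℂ) β z) y := hsm.differentiableAt (by simp)
      set β₁ : ℂ → ℂ := fun y => inChart 𝓘(ℝ, ℂ) β z y (fun _ => 1) with hβ₁
      have hd1 : DifferentiableAt ℝ β₁ y :=
        ((ContinuousAlternatingMap.apply ℝ ℂ ℂ
          (fun _ : Fin 1 => (1 : ℂ))).differentiableAt).comp y hd
      have hcα : coeff α z y = -2 * Complex.I * wirt β₁ y := by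
        rw [coeff, hα, inChart_del holAtlas_surface (by rwa [extChartAt_target_plane]) hsm,
          delAt_zero_one_apply hd]
        have hc := (chartAt ℂ z).continuousAt_symm hyt
        have hD : ∀ᶠ y in 𝓝 y, (chartAt ℂ z).symm y ∉ D :=
          hc.eventually (p := fun q => q ∉ D) (D.finite_toSet.isClosed.isOpen_compl.mem_nhds hyD)
        filter_upwards [hD, (chartAt ℂ z).open_target.mem_nhds hyt] with y h1 h2
          using inChart_type htype h2 h1
      have hbb : b =ᶠ[𝓝 y] fun y => (y - p) ^ N • β₁ y := by
        filter_upwards [(chartAt ℂ z).open_target.mem_nhds hyt, isOpen_ne.mem_nhds hyp]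
          with y h1 h2
        rw [hbe y h1 h2]; rfl
      have hpow : DifferentiableAt ℂ (fun y : ℂ => (y - p) ^ N) y := by fun_prop
      rw [wirt_congr hbb, hbb.self_of_nhds, wirt_smul (hpow.restrictScalars ℝ) hd1,
        wirt_of_holomorphic hpow, hge' y hyt hyp, hcα]
      have hder : deriv (fun y : ℂ => (y - p) ^ N) y = N * (y - p) ^ (N - 1) := by
        simp
      have hN1 : (y - p) * (N * (y - p) ^ (N - 1)) = N * (y - p) ^ N := by
        rcases N with _ | N
        · simp
        · rw [Nat.add_sub_cancel, pow_succ]; ring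
      rw [hder]
      simp only [smul_eq_mul]
      have h3 : (-2 * Complex.I)⁻¹ * ((y - p) * (-2 * Complex.I * wirt β₁ y)) =
          (y - p) * wirt β₁ y := by
        rw [mul_left_comm (y - p), ← mul_assoc, inv_mul_cancel₀ hI, one_mul]
      rw [h3, mul_add, ← mul_assoc (y - p) (_ * _), hN1]
      ring
    · have h1 : b =ᶠ[𝓝 y] fun _ => 0 := by
        filter_upwards [hKc.isClosed.isOpen_compl.mem_nhds hyK] with y hy using hb0 y hy
      rw [wirt_congr h1, hb0 y hyK, hg0 y hyK]
      simp [wirt_apply])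
  simp only [smul_comm _ ((-2 * Complex.I : ℂ)⁻¹)] at key
  rw [integral_smul, smul_eq_zero_iff_right (inv_ne_zero hI)] at key
  have hcoe : ∀ᵐ y ∂(volume.restrict (chartAt ℂ z).target), (y - p)⁻¹ • g y = coeff α z y := by
    filter_upwards [ae_restrict_of_ae (ae_ne_point p),
      ae_restrict_mem (chartAt ℂ z).open_target.measurableSet] with y h1 h2
    rw [hge' y h2 h1, smul_eq_mul, ← mul_assoc, inv_mul_cancel₀ (sub_ne_zero.2 h1), one_mul]
  have hint : Integrable fun y => (y - p)⁻¹ • g y :=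
    integrable_inv_smul hg.smooth.continuous hg.compact p
  have h := hasSurfaceIntegral_of_chart (IsLogOn.locInt hlog) (z := z)
    (fun q hq => hα0 q fun h => hq (hTz h)) (hint.integrableOn.congr hcoe)
  rw [← integral_congr_ae hcoe, setIntegral_eq_integral_of_forall_compl_eq_zero, key] at h
  · exact h
  · intro y hy
    rw [hg0 y fun h => hy ?_, smul_zero]
    obtain ⟨q, hq, rfl⟩ := h
    exact (chartAt ℂ z).map_source (hTz hq)

end Stokes

end RegInt
end

noncomputable section

namespace RegInt

open Filter MeasureTheory

/-! ### Global Stokes and independence of the decomposition. -/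

section Uniqueness

variable {S : Type*} [TopologicalSpace S] [ChartedSpace ℂ S] [IsManifold 𝓘(ℂ, ℂ) ω S]
  [T2Space S] [CompactSpace S]

theorem smoothFunAt_partition {m : ℕ} (ρ : SmoothPartitionOfUnity (Fin m) 𝓘(ℝ, ℂ) S) (j : Fin m)
    (p : S) : SmoothFunAt 𝓘(ℝ, ℂ) (fun q => ((ρ j q : ℝ) : ℂ)) p := by
  have h := ((contMDiffAt_iff (I := 𝓘(ℝ, ℂ)) (I' := 𝓘(ℝ, ℝ)) (n := ∞) (f := ρ j) (x := p)).1
    ((ρ j).contMDiff p)).2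
  simp only [extChartAt_model_space_eq_id, ModelWithCorners.range_eq_univ,
    contDiffWithinAt_univ] at h
  exact Complex.ofRealCLM.contDiff.contDiffAt.comp _ h

/-- Stokes' theorem for forms with poles. -/
theorem hasSurfaceIntegral_del {D : Finset S} {β : DForm 𝓘(ℝ, ℂ) S 1} (hβ : IsPolarOn D β)
    (htype : IsTypeZeroOneOff D β) (hlog : IsLogOn D (del 𝓘(ℝ, ℂ) β)) :
    HasSurfaceIntegral (del 𝓘(ℝ, ℂ) β) 0 := by
  classical
  -- The open set attached to `z` omits every pole except possibly `z`, so each cut-off will see at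
  -- most one pole, at the centre of its chart.
  have hVo : ∀ z : S, IsOpen ((chartAt ℂ z).source ∩ (((D.erase z : Finset S) : Set S))ᶜ) :=
    fun z => (chartAt ℂ z).open_source.inter (D.erase z).finite_toSet.isClosed.isOpen_compl
  obtain ⟨m, pt, σ, hinj, hσ⟩ := exists_partition _ hVo
    (fun z => ⟨mem_chart_source ℂ z, by simp⟩)
  have hVD : ∀ j, ∀ q ∈ tsupport (σ j), q ∈ D → q = pt j := by
    intro j q hq hD
    by_contra hne
    exact (hσ j hq).2 (Finset.mem_coe.2 (Finset.mem_erase.2 ⟨hne, hD⟩))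
  set B : Fin m → DForm 𝓘(ℝ, ℂ) S 1 := fun j q => ((σ j q : ℝ) : ℂ) • β q with hB
  have hB0 : ∀ j q, q ∉ tsupport (σ j) → B j q = 0 := by
    intro j q hq
    simp only [hB, image_eq_zero_of_notMem_tsupport hq, Complex.ofReal_zero, form_zero_smul]
  have hBev : ∀ j q, q ∉ tsupport (σ j) → B j =ᶠ[𝓝 q] 0 := by
    intro j q hq
    filter_upwards [(isClosed_tsupport (σ j)).isOpen_compl.mem_nhds hq] with r hr
    exact hB0 j r hr
  have hBpol : ∀ j, IsPolarOn D (B j) := by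
    intro j p
    obtain ⟨N, hN⟩ := hβ p
    exact ⟨N, HasPoleOn.smul (Eventually.of_forall fun q => smoothFunAt_partition σ j q) hN⟩
  have hBtype : ∀ j, IsTypeZeroOneOff D (B j) := by
    intro j q hq v
    simp only [hB, ContinuousAlternatingMap.smul_apply, htype q hq v, smul_eq_mul]
    ring
  have hsum : ∀ r, ∑ j, (σ j r : ℂ) = 1 := fun r => by
    rw [← Complex.ofReal_sum]
    have := σ.sum_eq_one (Set.mem_univ r)
    rw [finsum_eq_sum_of_fintype] at this
    rw [this, Complex.ofReal_one]
  -- Multiplying by a cut-off could raise the pole order of `∂β`, through the term `∂σ ∧ β`. This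
  -- does not happen: near the pole `pt j` all other cut-offs vanish, so `σ j = 1` there and `B j =
  -- β`; near the remaining poles `B j` vanishes.
  have hBlog : ∀ j, IsLogOn D (del 𝓘(ℝ, ℂ) (B j)) := by
    intro j q
    by_cases hqD : q ∈ D
    · by_cases hqj : q = pt j
      · have hev : ∀ᶠ r in 𝓝 q, ∀ i, i ≠ j → r ∉ tsupport (σ i) := by
          refine eventually_all.2 fun i => ?_
          by_cases hij : i = j
          · exact Eventually.of_forall fun r h => absurd hij h
          · have : q ∉ tsupport (σ i) := fun h =>
              hij (hinj (by rw [← hVD i q h hqD, hqj]))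
            filter_upwards [(isClosed_tsupport (σ i)).isOpen_compl.mem_nhds this] with r hr _
            exact hr
        have h1 : ∀ᶠ r in 𝓝 q, B j r = β r := by
          filter_upwards [hev] with r hr
          have h2 := hsum r
          rw [Finset.sum_eq_single j (fun i _ hi => by
            rw [image_eq_zero_of_notMem_tsupport (hr i hi), Complex.ofReal_zero])
            (fun h => absurd (Finset.mem_univ j) h)] at h2
          simp only [hB, h2, one_smul]
        refine HasPoleOn.congr (hlog q) ?_
        filter_upwards [h1.eventually_nhds] with r hr _
        exact (del_congr hr).symm
      · have h0 : q ∉ tsupport (σ j) := fun h => hqj (hVD j q h hqD)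
        refine hasPoleOn_of_smooth 1 ?_
        filter_upwards [(hBev j q h0).eventually_nhds] with r hr
        have h3 : SmoothFormAt 𝓘(ℝ, ℂ) (del 𝓘(ℝ, ℂ) (0 : DForm 𝓘(ℝ, ℂ) S 1)) r :=
          smoothFormAt_del holAtlas_surface (Eventually.of_forall fun q => smoothFormAt_zero q)
        refine h3.congr ?_
        filter_upwards [hr.eventually_nhds] with t ht
        exact (del_congr ht).symm
    · have hoff : ∀ᶠ r in 𝓝 q, r ∉ D := D.finite_toSet.isClosed.isOpen_compl.mem_nhds hqD
      refine hasPoleOn_of_smooth 1 ?_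
      filter_upwards [hoff.eventually_nhds] with r hr
      exact smoothFormAt_del holAtlas_surface (hr.mono fun t ht => (hBpol j).smoothFormAt ht)
  have h := HasSurfaceIntegral.sum Finset.univ (u := fun j => del 𝓘(ℝ, ℂ) (B j)) (c := fun _ => 0)
    (fun j _ => IsLogOn.locInt (hBlog j)) (fun j _ => hasSurfaceIntegral_del_of_chart (pt j)
      (isClosed_tsupport (σ j)) (fun q hq => (hσ j hq).1) (hVD j) (hB0 j) (hBpol j) (hBtype j)
      (hBlog j))
  rw [Finset.sum_const_zero] at h
  -- Additivity of `∂` is available only where the pieces are smooth, that is off `D`; the finite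
  -- set `D` does not affect the integral.
  refine h.congr D fun q hq => ?_
  rw [← del_sum Finset.univ fun j _ => (hBpol j).smoothFormAt hq]
  congr 1
  ext1 r
  exact sum_smul_partition σ β r

/-- The regularized integral does not depend on the decomposition. -/
theorem HasRegIntegral.unique {D : Finset S} {w : DForm 𝓘(ℝ, ℂ) S 2} {c c' : ℂ}
    (h : HasRegIntegral D w c) (h' : HasRegIntegral D w c') : c = c' := by
  -- Subtracting the two decompositions gives one of the zero form, with value `c - c'`. There `∂β =
  -- -α` is logarithmic, and Stokes applies.
  obtain ⟨α, β, h1, h2, h3, h4, h5⟩ :=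
    (h.add (h'.const_smul (-1))).congr (w' := 0) (D := D) (fun q _ => by
      rw [Pi.add_apply]; beta_reduce; rw [form_neg_one_smul]; exact add_neg_cancel (w q))
  have e : ∀ q, q ∉ D → del 𝓘(ℝ, ℂ) β q = (-1 : ℂ) • α q := fun q hq => by
    rw [form_neg_one_smul]
    exact (neg_eq_of_add_eq_zero_right (h4 q hq).symm).symm
  have hnl : IsLogOn D fun q => (-1 : ℂ) • α q := fun p =>
    HasPoleOn.smul (Eventually.of_forall fun q => smoothFunAt_const (-1) q) (h1 p)
  have hd : IsLogOn D (del 𝓘(ℝ, ℂ) β) := fun p =>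
    HasPoleOn.congr (hnl p) (Eventually.of_forall fun q hq => (e q hq).symm)
  have h6 := (hasSurfaceIntegral_del h2 h3 hd).congr D e
  have h7 := h6.unique (IsLogOn.locInt hnl) (h5.const_smul (IsLogOn.locInt h1) (-1))
  linear_combination h7

end Uniqueness

/-! ### Existence of the regularized integral for a single pole. -/

section PartialFractions

variable {S : Type*} [TopologicalSpace S] [ChartedSpace ℂ S] [IsManifold 𝓘(ℂ, ℂ) ω S]
  [T2Space S] [CompactSpace S]

theorem pullChart_eq_zero {k : ℕ} (z : S) {K : Set ℂ} {h : ℂ → ℂ [⋀^Fin k]→L[ℝ] ℂ}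
    (h0 : ∀ y, y ∉ K → h y = 0) {q : S} (hq : q ∉ (chartAt ℂ z).symm '' K) :
    pullChart 𝓘(ℝ, ℂ) z h q = 0 := by
  classical
  unfold pullChart
  split_ifs with hs
  · rw [h0]
    · rfl
    · intro hK
      refine hq ⟨_, hK, ?_⟩
      rw [extChartAt_source_plane] at hs
      exact (chartAt ℂ z).left_inv hs
  · rfl

theorem isClosed_symm_image {z : S} {K : Set ℂ} (hK : IsCompact K) (hKt : K ⊆ (chartAt ℂ z).target) :
    IsClosed ((chartAt ℂ z).symm '' K) :=
  (hK.image_of_continuousOn ((chartAt ℂ z).continuousOn_symm.mono hKt)).isClosed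

/-- At `d` the denominator is exactly the power of the local equation; elsewhere in the chart it is
invertible; outside the chart the form vanishes on a neighbourhood, because `h` is supported in a
compact part of the chart. -/
theorem hasPoleOn_pullChart {D : Finset S} {k : ℕ} (z : S) {d : S} (hd : d ∈ D)
    (hdz : d ∈ (chartAt ℂ z).source) {h : ℂ → ℂ [⋀^Fin k]→L[ℝ] ℂ} (hh : ContDiff ℝ ∞ h)
    {K : Set ℂ} (hK : IsCompact K) (hKt : K ⊆ (chartAt ℂ z).target) (h0 : ∀ y, y ∉ K → h y = 0)
    (N : ℕ) (q : S) : HasPoleOn D N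
      (pullChart 𝓘(ℝ, ℂ) z fun y => ((y - chartAt ℂ z d) ^ N)⁻¹ • h y) q := by
  set w := pullChart 𝓘(ℝ, ℂ) z fun y => ((y - chartAt ℂ z d) ^ N)⁻¹ • h y with hw
  by_cases hq : q ∈ (chartAt ℂ z).source
  · have hqt := (chartAt ℂ z).map_source hq
    rw [hasPoleOn_iff hq]
    by_cases hqd : q = d
    · refine ⟨h, ?_⟩
      filter_upwards [(chartAt ℂ z).open_target.mem_nhds hqt] with y hy
      refine ⟨hh.contDiffAt, fun hyD => ?_⟩
      have hne : y - chartAt ℂ z d ≠ 0 := by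
        rw [sub_ne_zero]
        rintro rfl
        rw [(chartAt ℂ z).left_inv hdz] at hyD
        exact hyD hd
      rw [hw, inChart_pullChart holAtlas_surface z _ (by rwa [extChartAt_target_plane]), hqd,
        pointEq, if_pos hd, smul_smul, mul_inv_cancel₀ (pow_ne_zero _ hne), one_smul]
    · refine ⟨fun y => pointEq D q (chartAt ℂ z q) y ^ N •
        ((y - chartAt ℂ z d) ^ N)⁻¹ • h y, ?_⟩
      have hne : chartAt ℂ z q ≠ chartAt ℂ z d := fun h => hqd ((chartAt ℂ z).injOn hq hdz h)
      filter_upwards [(chartAt ℂ z).open_target.mem_nhds hqt, isOpen_ne.mem_nhds hne] with y hy hy'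
      refine ⟨((contDiff_pointEq D q _).contDiffAt.pow _).smul
        ((((contDiffAt_id.sub contDiffAt_const).pow _).inv
          (pow_ne_zero _ (sub_ne_zero.2 hy'))).smul hh.contDiffAt), fun _ => ?_⟩
      rw [hw, inChart_pullChart holAtlas_surface z _ (by rwa [extChartAt_target_plane])]
  · refine hasPoleOn_of_smooth N ?_
    have hqK : q ∉ (chartAt ℂ z).symm '' K := by
      rintro ⟨y, hy, rfl⟩
      exact hq ((chartAt ℂ z).map_target (hKt hy))
    have hw0 : ∀ r, r ∉ (chartAt ℂ z).symm '' K → w r = 0 := fun r hr =>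
      pullChart_eq_zero z (fun y hy => by rw [h0 y hy, form_smul_zero]) hr
    filter_upwards [(isClosed_symm_image hK hKt).isOpen_compl.mem_nhds hqK |>
      fun h => eventually_mem_nhds_iff.2 h] with r hr
    refine (smoothFormAt_zero r).congr ?_
    filter_upwards [hr] with t ht
    exact (hw0 t ht).symm

theorem isLogOn_pullChart {D : Finset S} (z : S) {d : S} (hd : d ∈ D)
    (hdz : d ∈ (chartAt ℂ z).source) {h : ℂ → ℂ [⋀^Fin 2]→L[ℝ] ℂ} (hh : ContDiff ℝ ∞ h)
    {K : Set ℂ} (hK : IsCompact K) (hKt : K ⊆ (chartAt ℂ z).target) (h0 : ∀ y, y ∉ K → h y = 0) :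
    IsLogOn D (pullChart 𝓘(ℝ, ℂ) z fun y => (y - chartAt ℂ z d)⁻¹ • h y) := fun q => by
  have := hasPoleOn_pullChart z hd hdz hh hK hKt h0 1 q
  simp only [pow_one] at this
  exact this

theorem isLogOn_pullChart_smooth (D : Finset S) (z : S) {h : ℂ → ℂ [⋀^Fin 2]→L[ℝ] ℂ}
    (hh : ContDiff ℝ ∞ h) {K : Set ℂ} (hK : IsCompact K) (hKt : K ⊆ (chartAt ℂ z).target)
    (h0 : ∀ y, y ∉ K → h y = 0) : IsLogOn D (pullChart 𝓘(ℝ, ℂ) z h) := by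
  classical
  intro q
  refine hasPoleOn_of_smooth 1 (Eventually.of_forall fun r => ?_)
  -- A dummy pole at `z` with exponent `0`: the previous lemma then yields smoothness, in particular
  -- at points outside the chart domain.
  have := hasPoleOn_pullChart z (D := {z}) (Finset.mem_singleton_self z) (mem_chart_source ℂ z)
    hh hK hKt h0 0 r
  simp only [pow_zero, inv_one, one_smul] at this
  obtain ⟨f, hf⟩ := (hasPoleOn_iff (mem_chart_source ℂ r)).1 this
  by_cases hr : r ∈ (chartAt ℂ z).source
  · exact smoothFormAt_pullChart holAtlas_surface (by rwa [extChartAt_source_plane]) hh.contDiffAt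
  · exact HasPoleOn.smoothFormAt this fun h => hr (by
      rw [Finset.mem_singleton.1 h]; exact mem_chart_source ℂ z)

theorem hasSurfaceIntegral_pullChart {z : S} {u : ℂ → ℂ} {K : Set ℂ}
    (hKt : K ⊆ (chartAt ℂ z).target) (h0 : ∀ y, y ∉ K → u y = 0) (hu : Integrable u)
    (hl : LocInt (pullChart 𝓘(ℝ, ℂ) z fun y => u y • area)) :
    HasSurfaceIntegral (pullChart 𝓘(ℝ, ℂ) z fun y => u y • area) (∫ y, u y) := by
  set w := pullChart 𝓘(ℝ, ℂ) z fun y => u y • area with hw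
  have hc : ∀ y ∈ (chartAt ℂ z).target, u y = coeff w z y := fun y hy => by
    rw [coeff, hw, inChart_pullChart holAtlas_surface z _ (by rwa [extChartAt_target_plane]),
      ContinuousAlternatingMap.smul_apply, area_apply, smul_eq_mul, mul_one]
  have hm := (chartAt ℂ z).open_target.measurableSet
  have h := hasSurfaceIntegral_of_chart hl (z := z)
    (fun q hq => pullChart_apply_of_notMem _ (by rwa [extChartAt_source_plane]))
    (hu.integrableOn.congr_fun (fun y hy => hc y hy) hm)
  rw [← setIntegral_congr_fun hm hc, setIntegral_eq_integral_of_forall_compl_eq_zero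
    fun y hy => h0 y fun h => hy (hKt h)] at h
  exact h

theorem hasRegIntegral_of_isLogOn {D : Finset S} {w : DForm 𝓘(ℝ, ℂ) S 2} {c : ℂ}
    (hw : IsLogOn D w) (h : HasSurfaceIntegral w c) : HasRegIntegral D w c :=
  ⟨w, 0, hw, isPolarOn_zero D 1, fun q _ v => by simp, fun q _ => by
    rw [del_zero]; exact (add_zero _).symm, h⟩

theorem hasRegIntegral_pullChart_smooth (D : Finset S) {z : S} {g : ℂ → ℂ} (hg : IsTest g)
    (hgt : tsupport g ⊆ (chartAt ℂ z).target) :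
    HasRegIntegral D (pullChart 𝓘(ℝ, ℂ) z fun y => g y • area) (∫ y, g y) := by
  have h0 : ∀ y, y ∉ tsupport g → g y = 0 := fun y hy => image_eq_zero_of_notMem_tsupport hy
  have hl := isLogOn_pullChart_smooth D z (h := fun y => g y • area) (hg.smooth.smul contDiff_const (g := fun _ => area))
    hg.compact hgt (fun y hy => by rw [h0 y hy, form_zero_smul])
  exact hasRegIntegral_of_isLogOn hl
    (hasSurfaceIntegral_pullChart hgt h0 hg.integrable (IsLogOn.locInt hl))

theorem tsupport_wirt_subset (g : ℂ → ℂ) : tsupport (wirt g) ⊆ tsupport g := by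
  refine closure_minimal (fun y hy => ?_) (isClosed_tsupport g)
  by_contra h
  refine hy ?_
  rw [wirt_congr (notMem_tsupport_iff_eventuallyEq.1 h)]
  simp [wirt_apply]

theorem wirt_inv_pow_smul {g : ℂ → ℂ} {y p : ℂ} (hg : DifferentiableAt ℝ g y) (hy : y ≠ p) (n : ℕ) :
    wirt (fun y => ((y - p) ^ (n + 1))⁻¹ * g y) y =
      ((y - p) ^ (n + 1))⁻¹ * wirt g y - ((n : ℂ) + 1) * (((y - p) ^ (n + 2))⁻¹ * g y) := by
  have hne := sub_ne_zero.2 hy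
  have hder : HasDerivAt (fun y : ℂ => ((y - p) ^ (n + 1))⁻¹)
      (-(((n + 1 : ℕ) : ℂ) * (y - p) ^ n) / ((y - p) ^ (n + 1)) ^ 2) y := by
    have h1 := ((hasDerivAt_id y).sub_const p).pow (n + 1)
    simp only [id, Nat.add_sub_cancel, mul_one] at h1
    exact h1.inv (pow_ne_zero _ hne)
  have := wirt_smul (hder.differentiableAt.restrictScalars ℝ) hg
  simp only [smul_eq_mul] at this
  rw [this, wirt_of_holomorphic hder.differentiableAt, hder.deriv]
  push_cast
  field_simp
  ring

/-- The regularized integral of a function with a pole, times the area form of a chart. -/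
theorem hasRegIntegral_pullChart {D : Finset S} {z d : S} (hd : d ∈ D)
    (hdz : d ∈ (chartAt ℂ z).source) (n : ℕ) {g : ℂ → ℂ} (hg : IsTest g)
    (hgt : tsupport g ⊆ (chartAt ℂ z).target) :
    HasRegIntegral D (pullChart 𝓘(ℝ, ℂ) z
      fun y => (((y - chartAt ℂ z d) ^ (n + 1))⁻¹ * g y) • area) (pf n g (chartAt ℂ z d)) := by
  set p := chartAt ℂ z d
  have h0 : ∀ {g : ℂ → ℂ} y, y ∉ tsupport g → g y = 0 :=
    fun y hy => image_eq_zero_of_notMem_tsupport hy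
  induction n generalizing g with
  | zero =>
    have hl := isLogOn_pullChart z hd hdz (h := fun y => g y • area) (hg.smooth.smul contDiff_const (g := fun _ => area))
      hg.compact hgt (fun y hy => by rw [h0 y hy, form_zero_smul])
    simp only [zero_add, pow_one, pf_zero]
    have hi := integrable_inv_smul hg.smooth.continuous hg.compact p
    refine hasRegIntegral_of_isLogOn ?_ (hasSurfaceIntegral_pullChart hgt
      (fun y hy => by rw [h0 y hy, mul_zero]) hi (IsLogOn.locInt (D := D) ?_)) <;>
    · simp only [form_smul_smul] at hl
      exact hl
  | succ n ih =>
    have h1 := (ih hg.wirt ((tsupport_wirt_subset g).trans hgt)).const_smul (((n : ℂ) + 1)⁻¹)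
    -- The constant solves `2i (n+1) c = 1`. Then `∂β` supplies the term `g / (y-p)^(n+2)` with
    -- coefficient `1`, and its other term cancels the contribution `(n+1)⁻¹ ∂_z g / (y-p)^(n+1)` of
    -- the induction hypothesis.
    set c : ℂ := (2 * Complex.I * ((n : ℂ) + 1))⁻¹ with hc
    set β : DForm 𝓘(ℝ, ℂ) S 1 := pullChart 𝓘(ℝ, ℂ) z
      fun y => ((y - p) ^ (n + 1))⁻¹ • (c * g y) • dzbar with hβ
    have hbt : IsTest fun y => c * g y := hg.const_smul c
    have hpol : IsPolarOn D β := fun q => ⟨n + 1, hasPoleOn_pullChart z hd hdz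
      (h := fun y => (c * g y) • dzbar) (hbt.smooth.smul contDiff_const (g := fun _ => dzbar)) hg.compact hgt
      (fun y hy => by rw [h0 y hy, mul_zero, form_zero_smul]) (n + 1) q⟩
    have htype : IsTypeZeroOneOff D β := by
      intro q _ v
      rw [hβ]
      unfold pullChart
      split_ifs with hs
      · have hlin : DifferentiableAt ℂ (extChartAt 𝓘(ℝ, ℂ) z ∘ (extChartAt 𝓘(ℝ, ℂ) q).symm)
            (extChartAt 𝓘(ℝ, ℂ) q q) := (holAtlas_surface q z _ (mem_extChartAt_target q)
            (by rwa [extChartAt_to_inv])).differentiableAt (by simp)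
        have hI := fderiv_real_I_smul hlin v
        simp only [smul_eq_mul] at hI
        simp only [ContinuousAlternatingMap.compContinuousLinearMap_apply,
          ContinuousAlternatingMap.smul_apply, dzbar_apply, smul_eq_mul, Function.comp_apply, hI,
          map_mul, Complex.conj_I]
        ring
      · simp
    have h2 := h1.add (hasRegIntegral_del hpol htype)
    rw [add_zero] at h2
    rw [pf_succ, smul_eq_mul]
    refine h2.congr fun q hq => ?_
    by_cases hs : q ∈ (chartAt ℂ z).source
    · have hst := (chartAt ℂ z).map_source hs
      have hne : chartAt ℂ z q ≠ p := fun h => hq (by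
        rwa [(chartAt ℂ z).injOn hs hdz h])
      refine inChart_injective holAtlas_surface (p := z) (by rwa [extChartAt_source_plane]) ?_
      change inChart _ _ _ (chartAt ℂ z q) = inChart _ _ _ (chartAt ℂ z q)
      set y := chartAt ℂ z q
      have hyt : y ∈ (extChartAt 𝓘(ℝ, ℂ) z).target := by rwa [extChartAt_target_plane]
      have hsm : ContDiffAt ℝ ∞ (inChart 𝓘(ℝ, ℂ) β z) y := by
        rw [contDiffAt_inChart_iff holAtlas_surface hyt]
        refine hpol.smoothFormAt ?_
        change (chartAt ℂ z).symm (chartAt ℂ z q) ∉ D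
        rwa [(chartAt ℂ z).left_inv hs]
      have hev : inChart 𝓘(ℝ, ℂ) β z =ᶠ[𝓝 y]
          fun y => (c * (((y - p) ^ (n + 1))⁻¹ * g y)) • dzbar := by
        filter_upwards [(chartAt ℂ z).open_target.mem_nhds hst] with y hy
        rw [hβ, inChart_pullChart holAtlas_surface z _ (by rwa [extChartAt_target_plane]), smul_smul]
        congr 1
        ring
      have hd1 : DifferentiableAt ℝ (fun y : ℂ => ((y - p) ^ (n + 1))⁻¹ * g y) y := by
        refine DifferentiableAt.mul ?_ (hg.differentiable y)
        have : DifferentiableAt ℂ (fun y : ℂ => ((y - p) ^ (n + 1))⁻¹) y :=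
          DifferentiableAt.inv (by fun_prop) (pow_ne_zero _ (sub_ne_zero.2 hne))
        exact this.restrictScalars ℝ
      have hw1 := wirt_const_smul hd1 c
      simp only [smul_eq_mul] at hw1
      rw [inChart_add, inChart_smul, inChart_pullChart holAtlas_surface z _ hyt,
        inChart_pullChart holAtlas_surface z _ hyt, inChart_del holAtlas_surface hyt hsm,
        delAt_congr hev, delAt_smul_dzbar (hd1.const_mul c), hw1,
        wirt_inv_pow_smul (hg.differentiable y) hne, form_smul_smul, form_add_smul]
      congr 1
      have hn : (n : ℂ) + 1 ≠ 0 := by exact_mod_cast Nat.succ_ne_zero n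
      have hI := Complex.I_ne_zero
      rw [hc]
      field_simp
      ring
    · have hs' : q ∉ (extChartAt 𝓘(ℝ, ℂ) z).source := by rwa [extChartAt_source_plane]
      have hβ0 : β =ᶠ[𝓝 q] 0 := by
        have hqK : q ∉ (chartAt ℂ z).symm '' tsupport g := by
          rintro ⟨y, hy, rfl⟩
          exact hs ((chartAt ℂ z).map_target (hgt hy))
        filter_upwards [(isClosed_symm_image hg.compact hgt).isOpen_compl.mem_nhds hqK] with r hr
        exact pullChart_eq_zero z (fun y hy => by
          rw [h0 y hy, mul_zero, form_zero_smul, form_smul_zero]) hr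
      rw [Pi.add_apply, del_congr hβ0, del_zero, pullChart_apply_of_notMem _ hs',
        pullChart_apply_of_notMem _ hs', form_smul_zero]
      exact add_zero _

end PartialFractions

end RegInt
end

noncomputable section

namespace RegInt

open Filter MeasureTheory

/-! ### Partial fractions with parameters. -/

section Algebra

open MvPolynomial

variable {ι : Type*} [Fintype ι]

open Classical in
/-- The ordered pairs of distinct indices in `I`. -/
def pairsIn (I : Finset ι) : Finset {c : ι × ι // c.1 ≠ c.2} :=
  Finset.univ.filter fun c => c.1.1 ∈ I ∧ c.1.2 ∈ I

theorem mem_pairsIn {I : Finset ι} {c : {c : ι × ι // c.1 ≠ c.2}} :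
    c ∈ pairsIn I ↔ c.1.1 ∈ I ∧ c.1.2 ∈ I := by
  classical
  exact Finset.mem_filter.trans ⟨fun h => h.2, fun h => ⟨Finset.mem_univ _, h⟩⟩

open Classical in
-- The radical is the intersection of the primes over the ideal. Such a prime contains some `x j`
-- from the product omitting `i`, and then some `x l` with `l ≠ j` from the product omitting `j`;
-- hence it contains `x j - x l`, a factor of the discriminant.
theorem disc_mem_radical {R : Type*} [CommRing R] (x : ι → R) (I : Finset ι) (hI : I.Nonempty)
    (N : ℕ) : ∏ c ∈ pairsIn I, (x c.1.2 - x c.1.1) ∈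
      (Ideal.span ((fun i => ∏ j ∈ I.erase i, x j ^ N) '' (I : Set ι))).radical := by
  rw [Ideal.radical_eq_sInf, Ideal.mem_sInf]
  rintro P ⟨hJP, hP⟩
  have h1 : ∀ i ∈ I, ∃ j ∈ I, j ≠ i ∧ x j ∈ P := by
    intro i hi
    have h2 : ∏ j ∈ I.erase i, x j ^ N ∈ P := hJP (Ideal.subset_span ⟨i, hi, rfl⟩)
    obtain ⟨j, hj, hjP⟩ := hP.prod_mem_iff.1 h2
    exact ⟨j, Finset.mem_of_mem_erase hj, Finset.ne_of_mem_erase hj, hP.mem_of_pow_mem N hjP⟩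
  obtain ⟨i, hi⟩ := hI
  obtain ⟨j, hj, -, hjP⟩ := h1 i hi
  obtain ⟨l, hl, hlj, hlP⟩ := h1 j hj
  exact P.mem_of_dvd (Finset.dvd_prod_of_mem (fun c : {c : ι × ι // c.1 ≠ c.2} =>
    x c.1.2 - x c.1.1) (a := ⟨(l, j), hlj⟩) (mem_pairsIn.2 ⟨hl, hj⟩)) (P.sub_mem hjP hlP)

open Classical in
/-- Partial fractions with parameters: a power of the discriminant is a combination of the
products that omit one of the factors. -/
theorem exists_partial_fractions (I : Finset ι) (hI : I.Nonempty) (N : ℕ) :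
    ∃ (M : ℕ) (a : ι → MvPolynomial ι ℂ),
      (∏ c ∈ pairsIn I, (X c.1.2 - X c.1.1 : MvPolynomial ι ℂ)) ^ M =
        ∑ i ∈ I, a i * ∏ j ∈ I.erase i, X j ^ N := by
  obtain ⟨M, hM⟩ := disc_mem_radical (R := MvPolynomial ι ℂ) X I hI N
  obtain ⟨a, ha⟩ := (Submodule.mem_span_image_finset_iff_exists_fun' (MvPolynomial ι ℂ)).1 hM
  exact ⟨M, a, ha.symm⟩

theorem contDiffOn_aeval {V : Type*} [NormedAddCommGroup V] [NormedSpace ℝ V] {A : Set V}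
    {x : ι → V → ℂ} (hx : ∀ i, ContDiffOn ℝ ∞ (x i) A) (p : MvPolynomial ι ℂ) :
    ContDiffOn ℝ ∞ (fun v => aeval (fun i => x i v) p) A := by
  induction p using MvPolynomial.induction_on with
  | C a => simpa using contDiffOn_const
  | add p q hp hq => simpa using hp.add hq
  | mul_X p i hp => simpa using hp.mul (hx i)

end Algebra

/-! ### Local normal form of a form with several moving poles. -/

section NormalForm

variable {E : Type*} [NormedAddCommGroup E] [NormedSpace ℂ E] {k : ℕ}

/-- Evaluation of a form on a product with the plane at the real basis of the plane. -/
def slicePush : ((ℂ × E) [⋀^Fin (k + 2)]→L[ℝ] ℂ) →L[ℝ] (E [⋀^Fin k]→L[ℝ] ℂ) :=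
  (ContinuousAlternatingMap.compContinuousLinearMapCLM (ContinuousLinearMap.inr ℝ ℂ E)).comp
    (((ContinuousLinearMap.apply ℝ _ ((Complex.I, 0) : ℂ × E)).comp
      (ContinuousAlternatingMap.curryLeftLI (𝕜 := ℝ)).toContinuousLinearMap).comp
    ((ContinuousLinearMap.apply ℝ _ ((1, 0) : ℂ × E)).comp
      (ContinuousAlternatingMap.curryLeftLI (𝕜 := ℝ)).toContinuousLinearMap))

theorem slicePush_smul (c : ℂ) (L : (ℂ × E) [⋀^Fin (k + 2)]→L[ℝ] ℂ) :
    slicePush (c • L) = c • slicePush L := by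
  ext v; rfl

variable {S : Type*} [TopologicalSpace S] [ChartedSpace ℂ S]
  {X : Type*} [TopologicalSpace X] [ChartedSpace E X] {ι : Type*}

theorem fderiv_prodMap_chart [IsManifold 𝓘(ℂ, ℂ) ω S] [IsManifold 𝓘(ℂ, E) ω X] {z q : S} {x₀ x : X}
    {y : ℂ} {ξ : E} (hy : y ∈ (chartAt ℂ z).target) (hq : (chartAt ℂ z).symm y ∈ (chartAt ℂ q).source)
    (hξ : ξ ∈ (chartAt E x₀).target) (hx : (chartAt E x₀).symm ξ ∈ (chartAt E x).source) (a : ℂ × E) :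
    fderiv ℝ (extChartAt (𝓘(ℝ, ℂ).prod 𝓘(ℝ, E)) (q, x) ∘
      (extChartAt (𝓘(ℝ, ℂ).prod 𝓘(ℝ, E)) (z, x₀)).symm) (y, ξ) a =
      (fderiv ℝ (extChartAt 𝓘(ℝ, ℂ) q ∘ (extChartAt 𝓘(ℝ, ℂ) z).symm) y a.1,
        fderiv ℝ (extChartAt 𝓘(ℝ, E) x ∘ (extChartAt 𝓘(ℝ, E) x₀).symm) ξ a.2) := by
  have h1 := (holAtlas_surface (S := S)).differentiableAt (p := z) (q := q) (y := y)
    (by simpa [mfld_simps] using hy) (by simpa [mfld_simps] using hq)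
  have h2 := (holAtlas_of_isManifold (E := E) (X := X)).differentiableAt (p := x₀) (q := x) (y := ξ)
    (by simpa [mfld_simps] using hξ) (by simpa [mfld_simps] using hx)
  have h3 := (h1.hasFDerivAt.prodMap (y, ξ) h2.hasFDerivAt).fderiv
  have e : extChartAt (𝓘(ℝ, ℂ).prod 𝓘(ℝ, E)) (q, x) ∘
      (extChartAt (𝓘(ℝ, ℂ).prod 𝓘(ℝ, E)) (z, x₀)).symm =
      Prod.map (extChartAt 𝓘(ℝ, ℂ) q ∘ (extChartAt 𝓘(ℝ, ℂ) z).symm)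
        (extChartAt 𝓘(ℝ, E) x ∘ (extChartAt 𝓘(ℝ, E) x₀).symm) := rfl
  rw [e, h3]
  rfl

/-- Compares the contraction in product coordinates with the form on the fibre. The vectors `v` are
coordinates in the chart at `x₀`, and the derivative carries them to the chart that defines the
tangent space at the running point. -/
theorem slicePush_inChart [IsManifold 𝓘(ℂ, ℂ) ω S] [IsManifold 𝓘(ℂ, E) ω X]
    (w : DForm (𝓘(ℝ, ℂ).prod 𝓘(ℝ, E)) (S × X) (k + 2)) {z : S} {x₀ : X} {y : ℂ} {ξ : E}
    (hy : y ∈ (chartAt ℂ z).target) (hξ : ξ ∈ (chartAt E x₀).target) (v : Fin k → E) :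
    slicePush (inChart (𝓘(ℝ, ℂ).prod 𝓘(ℝ, E)) w (z, x₀) (y, ξ)) v =
      coeff (fiberTwoForm w ((chartAt E x₀).symm ξ) fun j =>
        fderiv ℝ (chartAt E ((chartAt E x₀).symm ξ) ∘ (chartAt E x₀).symm) ξ (v j)) z y := by
  have h := fderiv_prodMap_chart (S := S) (X := X) (q := (chartAt ℂ z).symm y)
    (x := (chartAt E x₀).symm ξ) hy (mem_chart_source ℂ _) hξ (mem_chart_source E _)
  change w ((chartAt ℂ z).symm y, (chartAt E x₀).symm ξ) (_ ∘ _) =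
    w ((chartAt ℂ z).symm y, (chartAt E x₀).symm ξ) _
  congr 1
  ext1 i
  refine Fin.cases ?_ (fun i => Fin.cases ?_ (fun i => ?_) i) i
  · refine (h (1, 0)).trans (Prod.ext rfl ?_)
    exact map_zero _
  · refine (h (Complex.I, 0)).trans (Prod.ext rfl ?_)
    exact map_zero _
  · refine (h (0, v i)).trans (Prod.ext ?_ rfl)
    exact map_zero _

/-- The coordinate of the `i`-th pole, as a function of the coordinates of `X` at `x₀`. -/
def polePos (s : ι → X → S) (x₀ : X) (i : ι) (ξ : E) : ℂ :=
  chartAt ℂ (s i x₀) (s i ((chartAt E x₀).symm ξ))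

/-- The domain on which the coordinates of all poles are defined. -/
def poleDomain (s : ι → X → S) (x₀ : X) : Set E :=
  {ξ | ξ ∈ (chartAt E x₀).target ∧
    ∀ i, s i ((chartAt E x₀).symm ξ) ∈ (chartAt ℂ (s i x₀)).source}

variable [IsManifold 𝓘(ℂ, ℂ) ω S] [IsManifold 𝓘(ℂ, E) ω X]

theorem differentiableAt_polePos {s : ι → X → S} (hs : ∀ i, ContMDiff 𝓘(ℂ, E) 𝓘(ℂ, ℂ) ω (s i))
    {x₀ : X} {ξ : E} (hξ : ξ ∈ poleDomain s x₀) (i : ι) :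
    DifferentiableAt ℂ (polePos s x₀ i) ξ :=
  (contDiffAt_chart_comp (hs i) x₀ (s i x₀) hξ.1 (hξ.2 i)).differentiableAt (by simp)

theorem contDiffOn_polePos {s : ι → X → S} (hs : ∀ i, ContMDiff 𝓘(ℂ, E) 𝓘(ℂ, ℂ) ω (s i))
    (x₀ : X) (i : ι) : ContDiffOn ℝ ∞ (polePos s x₀ i : E → ℂ) (poleDomain s x₀) := fun _ hξ =>
  ((contDiffAt_chart_comp (hs i) x₀ (s i x₀) hξ.1 (hξ.2 i)).restrict_scalars ℝ).contDiffWithinAt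

variable [Fintype ι]

theorem poleDomain_mem_nhds {s : ι → X → S} (hs : ∀ i, ContMDiff 𝓘(ℂ, E) 𝓘(ℂ, ℂ) ω (s i)) (x₀ : X) :
    poleDomain s x₀ ∈ 𝓝 (chartAt E x₀ x₀) := by
  have h1 : ∀ᶠ ξ in 𝓝 (chartAt E x₀ x₀), ξ ∈ (chartAt E x₀).target :=
    (chartAt E x₀).open_target.mem_nhds (mem_chart_target E x₀)
  have h2 : ∀ᶠ ξ in 𝓝 (chartAt E x₀ x₀),
      ∀ i, s i ((chartAt E x₀).symm ξ) ∈ (chartAt ℂ (s i x₀)).source := by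
    refine eventually_all.2 fun i => ?_
    have hc := (chartAt E x₀).continuousAt_symm (mem_chart_target E x₀)
    refine hc.eventually (p := fun x => s i x ∈ (chartAt ℂ (s i x₀)).source) ?_
    rw [(chartAt E x₀).left_inv (mem_chart_source E x₀)]
    exact (hs i).continuous.continuousAt.eventually
      ((chartAt ℂ (s i x₀)).open_source.mem_nhds (mem_chart_source ℂ _))
  exact h1.and h2

open Classical in
/-- The indices of the poles that pass through `z` over `x₀`. -/
def polesAt (s : ι → X → S) (x₀ : X) (z : S) : Finset ι := Finset.univ.filter fun i => s i x₀ = z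

theorem mem_polesAt {s : ι → X → S} {x₀ : X} {z : S} {i : ι} :
    i ∈ polesAt s x₀ z ↔ s i x₀ = z := by
  classical
  exact Finset.mem_filter.trans ⟨fun h => h.2, fun h => ⟨Finset.mem_univ _, h⟩⟩

open Classical in
/-- The local equation of the collision locus at `x₀`, in coordinates. -/
def collEq (s : ι → X → S) (x₀ : X) (ξ : E) : ℂ :=
  ∏ c ∈ Finset.univ.filter (fun c : {c : ι × ι // c.1 ≠ c.2} => s c.1.1 x₀ = s c.1.2 x₀),
    (polePos s x₀ c.1.1 ξ - polePos s x₀ c.1.2 ξ)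

theorem contDiffOn_collEq {s : ι → X → S} (hs : ∀ i, ContMDiff 𝓘(ℂ, E) 𝓘(ℂ, ℂ) ω (s i)) (x₀ : X) :
    ContDiffOn ℝ ∞ (collEq s x₀ : E → ℂ) (poleDomain s x₀) :=
  contDiffOn_prod fun c _ => (contDiffOn_polePos hs x₀ c.1.1).sub (contDiffOn_polePos hs x₀ c.1.2)

/-- The pairs that collide at `z` are only some of the pairs that collide over `x₀`; the factors of
the others go into `r`. One global equation thus serves for every point of the fibre. -/
theorem collEq_eq {s : ι → X → S} (hs : ∀ i, ContMDiff 𝓘(ℂ, E) 𝓘(ℂ, ℂ) ω (s i)) (x₀ : X) (z : S) :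
    ∃ r : E → ℂ, ContDiffOn ℝ ∞ r (poleDomain s x₀) ∧ ∀ ξ, collEq s x₀ ξ =
      r ξ * ∏ c ∈ pairsIn (polesAt s x₀ z), (polePos s x₀ c.1.1 ξ - polePos s x₀ c.1.2 ξ) := by
  classical
  refine ⟨fun ξ => ∏ c ∈ (Finset.univ.filter
    (fun c : {c : ι × ι // c.1 ≠ c.2} => s c.1.1 x₀ = s c.1.2 x₀)).filter (fun c => ¬ s c.1.1 x₀ = z),
    (polePos s x₀ c.1.1 ξ - polePos s x₀ c.1.2 ξ), contDiffOn_prod fun c _ =>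
      (contDiffOn_polePos hs x₀ c.1.1).sub (contDiffOn_polePos hs x₀ c.1.2), fun ξ => ?_⟩
  have e : pairsIn (polesAt s x₀ z) = (Finset.univ.filter
      (fun c : {c : ι × ι // c.1 ≠ c.2} => s c.1.1 x₀ = s c.1.2 x₀)).filter
        (fun c => s c.1.1 x₀ = z) := by
    ext c
    simp only [mem_pairsIn, mem_polesAt, Finset.mem_filter, Finset.mem_univ, true_and]
    constructor
    · rintro ⟨h1, h2⟩
      exact ⟨h1.trans h2.symm, h1⟩
    · rintro ⟨h1, h2⟩
      exact ⟨h2, h1 ▸ h2⟩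
  have := Finset.prod_filter_mul_prod_filter_not (Finset.univ.filter
    (fun c : {c : ι × ι // c.1 ≠ c.2} => s c.1.1 x₀ = s c.1.2 x₀)) (fun c => s c.1.1 x₀ = z)
    (fun c => polePos s x₀ c.1.1 ξ - polePos s x₀ c.1.2 ξ)
  rw [e, mul_comm]
  unfold collEq
  convert this.symm

theorem localEq_graphs (s : ι → X → S) (x₀ : X) (z : S) {y : ℂ} {ξ : E}
    (hy : y ∈ (chartAt ℂ z).target) :
    localEq (fun (_ : ι) (q : S × X) => q.1) (fun i q => s i q.2) (z, x₀)
      ((chartAt ℂ z).symm y, (chartAt E x₀).symm ξ) =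
      ∏ i ∈ polesAt s x₀ z, (y - polePos s x₀ i ξ) := by
  classical
  unfold localEq
  refine Finset.prod_congr ?_ fun i hi => ?_
  · ext i
    rw [mem_polesAt]
    exact Finset.mem_filter.trans ⟨fun h => h.2.symm, fun h => ⟨Finset.mem_univ _, h.symm⟩⟩
  · simp only
    rw [(chartAt ℂ z).right_inv hy, polePos, mem_polesAt.1 hi]

/-- Near a point of the fibre over `x₀`, a form with poles, multiplied by a power of the equation of
the collision locus, is a sum of forms with a single pole. -/
theorem exists_normal_form {s : ι → X → S} (hs : ∀ i, ContMDiff 𝓘(ℂ, E) 𝓘(ℂ, ℂ) ω (s i))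
    {w : DForm (𝓘(ℝ, ℂ).prod 𝓘(ℝ, E)) (S × X) (k + 2)} (hw : IsPolarAlongGraphs s w) (x₀ : X)
    (z : S) : ∃ (n M : ℕ) (O : Set ℂ) (U : Set E) (f₀ : E → ℂ → E [⋀^Fin k]→L[ℝ] ℂ)
      (f : ι → E → ℂ → E [⋀^Fin k]→L[ℝ] ℂ),
      IsOpen O ∧ chartAt ℂ z z ∈ O ∧ O ⊆ (chartAt ℂ z).target ∧
      IsOpen U ∧ chartAt E x₀ x₀ ∈ U ∧ U ⊆ poleDomain s x₀ ∧
      ContDiffOn ℝ ∞ (Function.uncurry f₀) (U ×ˢ O) ∧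
      (∀ i, ContDiffOn ℝ ∞ (Function.uncurry (f i)) (U ×ˢ O)) ∧
      ∀ ξ ∈ U, ∀ y ∈ O, (∀ i, (chartAt ℂ z).symm y ≠ s i ((chartAt E x₀).symm ξ)) →
        collEq s x₀ ξ ^ M • slicePush (inChart (𝓘(ℝ, ℂ).prod 𝓘(ℝ, E)) w (z, x₀) (y, ξ)) =
          f₀ ξ y + ∑ i ∈ polesAt s x₀ z, ((y - polePos s x₀ i ξ) ^ (n + 1))⁻¹ • f i ξ y := by
  classical
  obtain ⟨n, η, hη⟩ := hw (z, x₀)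
  have hM : HolAtlas (𝓘(ℝ, ℂ).prod 𝓘(ℝ, E)) (S × X) :=
    holAtlas_prod holAtlas_of_isManifold holAtlas_of_isManifold
  have hc : Tendsto (fun p : E × ℂ => ((chartAt ℂ z).symm p.2, (chartAt E x₀).symm p.1))
      (𝓝 (chartAt E x₀ x₀, chartAt ℂ z z)) (𝓝 (z, x₀)) := by
    have h1 := (chartAt ℂ z).continuousAt_symm (mem_chart_target ℂ z)
    have h2 := (chartAt E x₀).continuousAt_symm (mem_chart_target E x₀)
    have h1' := h1.tendsto
    have h2' := h2.tendsto
    rw [(chartAt ℂ z).left_inv (mem_chart_source ℂ z)] at h1'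
    rw [(chartAt E x₀).left_inv (mem_chart_source E x₀)] at h2'
    exact (h1'.comp (continuous_snd.tendsto _)).prodMk_nhds (h2'.comp (continuous_fst.tendsto _))
  have hev := hc.eventually hη
  obtain ⟨U₁, O₁, hU₁, hxU₁, hO₁, hzO₁, hUO⟩ := mem_nhds_prod_iff'.1 hev
  obtain ⟨U₂, hU₂s, hU₂, hxU₂⟩ := mem_nhds_iff.1 (poleDomain_mem_nhds hs x₀)
  set O := O₁ ∩ (chartAt ℂ z).target with hO
  set U := U₁ ∩ U₂ with hU
  have hUd : U ⊆ poleDomain s x₀ := fun ξ h => hU₂s h.2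
  -- The extra factor raises the exponent of the denominator from `n` to `n + 1`, matching the
  -- convention that `pf n` treats poles of order `n + 1`.
  set h : E → ℂ → E [⋀^Fin k]→L[ℝ] ℂ := fun ξ y => (∏ i ∈ polesAt s x₀ z, (y - polePos s x₀ i ξ)) •
    slicePush (inChart (𝓘(ℝ, ℂ).prod 𝓘(ℝ, E)) η (z, x₀) (y, ξ)) with hh
  have hx : ∀ i, ContDiffOn ℝ ∞ (fun p : E × ℂ => p.2 - polePos s x₀ i p.1) (U ×ˢ O) := fun i =>
    contDiffOn_snd.sub ((contDiffOn_polePos hs x₀ i).comp contDiffOn_fst fun p hp => hUd hp.1)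
  have hhs : ContDiffOn ℝ ∞ (Function.uncurry h) (U ×ˢ O) := by
    refine (contDiffOn_prod fun i _ => hx i).smul ?_
    rintro ⟨ξ, y⟩ ⟨hξ, hy⟩
    have h1 := (hUO (Set.mk_mem_prod hξ.1 hy.1)).1
    have h2 : ContDiffAt ℝ ∞ (inChart (𝓘(ℝ, ℂ).prod 𝓘(ℝ, E)) η (z, x₀)) (y, ξ) :=
      (contDiffAt_inChart_iff hM (by
        rw [extChartAt_prod]
        exact ⟨by rw [extChartAt_target_plane]; exact hy.2,
          by simpa [mfld_simps] using (hUd hξ).1⟩)).2 h1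
    have h3 : ContDiffAt ℝ ∞ (fun p : E × ℂ => inChart (𝓘(ℝ, ℂ).prod 𝓘(ℝ, E)) η (z, x₀) (p.2, p.1))
        (ξ, y) := h2.comp (f := fun p : E × ℂ => (p.2, p.1)) (ξ, y) (by fun_prop)
    exact (slicePush.contDiff.contDiffAt.comp (ξ, y) h3).contDiffWithinAt
  have heq : ∀ ξ ∈ U, ∀ y ∈ O, (∀ i, (chartAt ℂ z).symm y ≠ s i ((chartAt E x₀).symm ξ)) →
      (∏ i ∈ polesAt s x₀ z, (y - polePos s x₀ i ξ)) ^ (n + 1) •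
        slicePush (inChart (𝓘(ℝ, ℂ).prod 𝓘(ℝ, E)) w (z, x₀) (y, ξ)) = h ξ y := by
    intro ξ hξ y hy hoff
    have h1 := (hUO (Set.mk_mem_prod hξ.1 hy.1)).2 hoff
    have h2 : inChart (𝓘(ℝ, ℂ).prod 𝓘(ℝ, E)) (fun q => localEq (fun (_ : ι) (q : S × X) => q.1)
        (fun i q => s i q.2) (z, x₀) q ^ n • w q) (z, x₀) (y, ξ) =
        inChart (𝓘(ℝ, ℂ).prod 𝓘(ℝ, E)) η (z, x₀) (y, ξ) := inChart_congr_point h1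
    rw [inChart_smul] at h2
    have h3 : localEq (fun (_ : ι) (q : S × X) => q.1) (fun i q => s i q.2) (z, x₀)
        ((extChartAt (𝓘(ℝ, ℂ).prod 𝓘(ℝ, E)) (z, x₀)).symm (y, ξ)) =
          ∏ i ∈ polesAt s x₀ z, (y - polePos s x₀ i ξ) :=
      localEq_graphs s x₀ z hy.2
    rw [h3] at h2
    simp only [hh]
    rw [← h2, slicePush_smul, smul_smul, pow_succ']
  have hfac : ∀ ξ ∈ U, ∀ y ∈ O, (∀ i, (chartAt ℂ z).symm y ≠ s i ((chartAt E x₀).symm ξ)) →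
      ∀ i ∈ polesAt s x₀ z, y - polePos s x₀ i ξ ≠ 0 := by
    intro ξ hξ y hy hoff i hi h0
    refine hoff i ?_
    rw [sub_eq_zero.1 h0, polePos, mem_polesAt.1 hi, (chartAt ℂ z).left_inv]
    have := (hUd hξ).2 i
    rwa [mem_polesAt.1 hi] at this
  by_cases hI : (polesAt s x₀ z).Nonempty
  · obtain ⟨M, a, ha⟩ := exists_partial_fractions (polesAt s x₀ z) hI (n + 1)
    obtain ⟨r, hr, hcr⟩ := collEq_eq hs x₀ z
    -- The coefficients of the polynomial identity, with the variable `X j` specialized to `y -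
    -- p_j(ξ)`.
    set A : ι → E → ℂ → ℂ := fun i ξ y =>
      MvPolynomial.aeval (fun j => y - polePos s x₀ j ξ) (a i) with hA
    refine ⟨n, M, O, U, fun _ _ => 0, fun i ξ y => (r ξ ^ M * A i ξ y) • h ξ y,
      hO₁.inter (chartAt ℂ z).open_target, ⟨hzO₁, mem_chart_target ℂ z⟩, Set.inter_subset_right,
      hU₁.inter hU₂, ⟨hxU₁, hxU₂⟩, hUd, contDiffOn_const, fun i => ?_, ?_⟩
    · refine ContDiffOn.smul (ContDiffOn.mul ?_ (contDiffOn_aeval hx (a i))) hhs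
      exact ((hr.comp contDiffOn_fst fun p hp => hUd hp.1).pow M)
    · intro ξ hξ y hy hoff
      have h1 := congrArg (MvPolynomial.aeval fun j => y - polePos s x₀ j ξ) ha
      simp only [map_pow, map_prod, map_sub, MvPolynomial.aeval_X, map_sum, map_mul] at h1
      -- The coordinate `y` drops out of the differences, so the discriminant is a function of `ξ`
      -- alone.
      have h2 : ∏ c ∈ pairsIn (polesAt s x₀ z), (polePos s x₀ c.1.1 ξ - polePos s x₀ c.1.2 ξ) =
          ∏ c ∈ pairsIn (polesAt s x₀ z),
            ((y - polePos s x₀ c.1.2 ξ) - (y - polePos s x₀ c.1.1 ξ)) :=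
        Finset.prod_congr rfl fun c _ => by ring
      rw [hcr, mul_pow, h2, h1, zero_add, Finset.mul_sum, form_sum_smul]
      refine Finset.sum_congr rfl fun i hi => ?_
      beta_reduce
      rw [← heq ξ hξ y hy hoff, form_smul_smul, form_smul_smul]
      congr 1
      have h3 := hfac ξ hξ y hy hoff i hi
      rw [← Finset.mul_prod_erase _ _ hi, mul_pow, Finset.prod_pow]
      have h4 := pow_ne_zero (n + 1) h3
      simp only [hA]
      field_simp
  · rw [Finset.not_nonempty_iff_eq_empty] at hI
    -- No pole passes through `z`: the form itself is smooth, and no power of the collision equation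
    -- is needed.
    refine ⟨n, 0, O, U, h, fun _ _ _ => 0,
      hO₁.inter (chartAt ℂ z).open_target, ⟨hzO₁, mem_chart_target ℂ z⟩, Set.inter_subset_right,
      hU₁.inter hU₂, ⟨hxU₁, hxU₂⟩, hUd, hhs, fun i => contDiffOn_const, ?_⟩
    intro ξ hξ y hy hoff
    have h1 := heq ξ hξ y hy hoff
    rw [hI] at h1 ⊢
    rw [Finset.prod_empty, one_pow] at h1
    rw [pow_zero, Finset.sum_empty, add_zero, h1]

end NormalForm

end RegInt
end

noncomputable section

namespace RegInt

open Filter MeasureTheory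

/-- Evaluation of a complex-valued form, as a complex-linear map. -/
def evalC {V : Type*} [NormedAddCommGroup V] [NormedSpace ℝ V] {k : ℕ} (v : Fin k → V) :
    (V [⋀^Fin k]→L[ℝ] ℂ) →L[ℂ] ℂ where
  toFun A := A v
  map_add' _ _ := rfl
  map_smul' _ _ := rfl
  cont := (ContinuousAlternatingMap.apply ℝ V ℂ v).continuous

/-! ### Regularized integrals assembled from a partition of unity. -/

section LocalSum

variable {S : Type*} [TopologicalSpace S] [ChartedSpace ℂ S] [IsManifold 𝓘(ℂ, ℂ) ω S]
  [T2Space S] [CompactSpace S]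

/-- The support of a cut-off function in a chart. -/
abbrev chartSupp {m : ℕ} (pt : Fin m → S) (σ : SmoothPartitionOfUnity (Fin m) 𝓘(ℝ, ℂ) S)
    (j : Fin m) : Set ℂ := chartAt ℂ (pt j) '' tsupport (σ j)

variable {m : ℕ} {pt : Fin m → S} {σ : SmoothPartitionOfUnity (Fin m) 𝓘(ℝ, ℂ) S}

theorem isCompact_chartSupp (hσ : σ.IsSubordinate fun j => (chartAt ℂ (pt j)).source) (j : Fin m) :
    IsCompact (chartSupp pt σ j) :=
  (isClosed_tsupport (σ j)).isCompact.image_of_continuousOn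
    ((chartAt ℂ (pt j)).continuousOn.mono (hσ j))

theorem chartSupp_subset (hσ : σ.IsSubordinate fun j => (chartAt ℂ (pt j)).source) (j : Fin m) :
    chartSupp pt σ j ⊆ (chartAt ℂ (pt j)).target := by
  rintro _ ⟨q, hq, rfl⟩
  exact (chartAt ℂ (pt j)).map_source (hσ j hq)

theorem contDiffAt_partition (σ : SmoothPartitionOfUnity (Fin m) 𝓘(ℝ, ℂ) S) (j : Fin m) {z : S}
    {y : ℂ} (hy : y ∈ (chartAt ℂ z).target) :
    ContDiffAt ℝ ∞ (fun y => ((σ j ((chartAt ℂ z).symm y) : ℝ) : ℂ)) y := by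
  have := isManifold_real (S := S)
  have h1 : ContMDiffAt 𝓘(ℝ, ℂ) 𝓘(ℝ, ℂ) ∞ (chartAt ℂ z).symm y :=
    (contMDiffOn_chart_symm (n := ∞) (I := 𝓘(ℝ, ℂ)) (x := z)).contMDiffAt
      ((chartAt ℂ z).open_target.mem_nhds hy)
  have h2 := (((σ j).contMDiff ((chartAt ℂ z).symm y)).comp y h1).contDiffAt
  exact Complex.ofRealCLM.contDiff.contDiffAt.comp y h2

/-- The regularized integral of a form that is, in the charts of a partition of unity, a sum of
functions with a single pole. -/
theorem hasRegIntegral_of_local {D : Finset S}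
    (hσ : σ.IsSubordinate fun j => (chartAt ℂ (pt j)).source) {τ : Type*} (T : Fin m → Finset τ)
    (n : Fin m → τ → ℕ) (d : τ → S)
    (hd : ∀ j, ∀ t ∈ T j, d t ∈ D ∧ d t ∈ (chartAt ℂ (pt j)).source)
    (g₀ : Fin m → ℂ → ℂ) (g : Fin m → τ → ℂ → ℂ) (hg₀ : ∀ j, IsTest (g₀ j))
    (hg : ∀ j t, IsTest (g j t)) (h₀ : ∀ j, ∀ y ∉ chartSupp pt σ j, g₀ j y = 0)
    (h : ∀ j t, ∀ y ∉ chartSupp pt σ j, g j t y = 0) (W : DForm 𝓘(ℝ, ℂ) S 2)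
    (hW : ∀ j, ∀ y ∈ chartSupp pt σ j, (chartAt ℂ (pt j)).symm y ∉ D →
      (σ j ((chartAt ℂ (pt j)).symm y) : ℂ) * coeff W (pt j) y = g₀ j y +
        ∑ t ∈ T j, ((y - chartAt ℂ (pt j) (d t)) ^ (n j t + 1))⁻¹ * g j t y) :
    HasRegIntegral D W (∑ j, ((∫ y, g₀ j y) +
      ∑ t ∈ T j, pf (n j t) (g j t) (chartAt ℂ (pt j) (d t)))) := by
  have hts : ∀ {j} {u : ℂ → ℂ}, (∀ y ∉ chartSupp pt σ j, u y = 0) →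
      tsupport u ⊆ (chartAt ℂ (pt j)).target := by
    intro j u hu
    refine (closure_minimal (fun y hy => ?_) (isCompact_chartSupp hσ j).isClosed).trans
      (chartSupp_subset hσ j)
    by_contra hn
    exact hy (hu y hn)
  have h1 := HasRegIntegral.sum (D := D) Finset.univ fun j _ =>
    (hasRegIntegral_pullChart_smooth D (z := pt j) (hg₀ j) (hts (h₀ j))).add
      (HasRegIntegral.sum (T j) fun t ht => hasRegIntegral_pullChart (hd j t ht).1 (hd j t ht).2
        (n j t) (hg j t) (hts (h j t)))
  refine h1.congr fun q hq => ?_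
  rw [← sum_smul_partition σ W q]
  refine Finset.sum_congr rfl fun j _ => ?_
  by_cases hqs : q ∈ tsupport (σ j)
  · have hs := hσ j hqs
    have hst := (chartAt ℂ (pt j)).map_source hs
    have hy : chartAt ℂ (pt j) q ∈ chartSupp pt σ j := ⟨q, hqs, rfl⟩
    have hyt : chartAt ℂ (pt j) q ∈ (extChartAt 𝓘(ℝ, ℂ) (pt j)).target := by
      rwa [extChartAt_target_plane]
    refine inChart_injective holAtlas_surface (p := pt j)
      (w := pullChart 𝓘(ℝ, ℂ) (pt j) (fun y => g₀ j y • area) + fun q => ∑ t ∈ T j,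
        pullChart 𝓘(ℝ, ℂ) (pt j) (fun y =>
          (((y - chartAt ℂ (pt j) (d t)) ^ (n j t + 1))⁻¹ * g j t y) • area) q)
      (w' := fun q => ((σ j q : ℝ) : ℂ) • W q) (by rwa [extChartAt_source_plane]) ?_
    change inChart _ _ _ (chartAt ℂ (pt j) q) = inChart _ _ _ (chartAt ℂ (pt j) q)
    rw [inChart_add, inChart_sum, inChart_pullChart holAtlas_surface _ _ hyt,
      Finset.sum_congr rfl fun t _ => inChart_pullChart holAtlas_surface (pt j) _ hyt,
      ← form_sum_smul, form_add_smul, ← hW j _ hy (by rwa [(chartAt ℂ (pt j)).left_inv hs]),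
      ← form_smul_smul, coeff, ← eq_smul_area]
    rfl
  · have hy : ∀ u : ℂ → ℂ, (∀ y ∉ chartSupp pt σ j, u y = 0) →
        pullChart 𝓘(ℝ, ℂ) (pt j) (fun y => u y • area) q = 0 := by
      intro u hu
      refine pullChart_eq_zero _ (fun y hy => by rw [hu y hy, form_zero_smul]) ?_
      rintro ⟨y, ⟨r, hr, rfl⟩, hrq⟩
      rw [(chartAt ℂ (pt j)).left_inv (hσ j hr)] at hrq
      exact hqs (hrq ▸ hr)
    rw [image_eq_zero_of_notMem_tsupport hqs, Complex.ofReal_zero, form_zero_smul, Pi.add_apply,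
      hy _ (h₀ j), Finset.sum_eq_zero fun t _ => hy _ fun y hy' => by rw [h j t y hy', mul_zero]]
    exact add_zero _

end LocalSum

/-! ### Decomposition over a neighbourhood of a point of `X`. -/

section Family

variable {E : Type*} [NormedAddCommGroup E] [NormedSpace ℂ E] {k : ℕ}
  {S : Type*} [TopologicalSpace S] [ChartedSpace ℂ S] [T2Space S] [CompactSpace S]
  {X : Type*} [TopologicalSpace X] [ChartedSpace E X] {ι : Type*} [Fintype ι]

/-- A decomposition, over a neighbourhood of `x₀`, of a form with poles on `S × X`. -/
structure FiberFamily (s : ι → X → S) (w : DForm (𝓘(ℝ, ℂ).prod 𝓘(ℝ, E)) (S × X) (k + 2))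
    (x₀ : X) where
  m : ℕ
  pt : Fin m → S
  σ : SmoothPartitionOfUnity (Fin m) 𝓘(ℝ, ℂ) S
  sub : σ.IsSubordinate fun j => (chartAt ℂ (pt j)).source
  U : Set E
  isOpen : IsOpen U
  mem : chartAt E x₀ x₀ ∈ U
  subset : U ⊆ poleDomain s x₀
  M : ℕ
  n : Fin m → ℕ
  g₀ : Fin m → E → ℂ → E [⋀^Fin k]→L[ℝ] ℂ
  g : Fin m → ι → E → ℂ → E [⋀^Fin k]→L[ℝ] ℂ
  fam₀ : ∀ j, IsFamily U (chartSupp pt σ j) (g₀ j)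
  fam : ∀ j i, IsFamily U (chartSupp pt σ j) (g j i)
  eq : ∀ ξ ∈ U, ∀ j, ∀ y ∈ chartSupp pt σ j,
    (∀ i, (chartAt ℂ (pt j)).symm y ≠ s i ((chartAt E x₀).symm ξ)) →
    (σ j ((chartAt ℂ (pt j)).symm y) : ℂ) • collEq s x₀ ξ ^ M •
      slicePush (inChart (𝓘(ℝ, ℂ).prod 𝓘(ℝ, E)) w (pt j, x₀) (y, ξ)) =
      g₀ j ξ y + ∑ i ∈ polesAt s x₀ (pt j), ((y - polePos s x₀ i ξ) ^ (n j + 1))⁻¹ • g j i ξ y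

/-- Extension by zero is jointly smooth because the cut-off already vanishes on the part of `O`
outside its support, so the two definitions agree near the boundary of the support. -/
theorem isFamily_cut [IsManifold 𝓘(ℂ, ℂ) ω S] {m : ℕ} {pt : Fin m → S}
    {σ : SmoothPartitionOfUnity (Fin m) 𝓘(ℝ, ℂ) S}
    (hσ : σ.IsSubordinate fun j => (chartAt ℂ (pt j)).source) (j : Fin m) {U : Set E} {O : Set ℂ}
    (hU : IsOpen U) (hO : IsOpen O) (hOt : O ⊆ (chartAt ℂ (pt j)).target)
    (hK : chartSupp pt σ j ⊆ O) {F : Type*} [NormedAddCommGroup F] [NormedSpace ℝ F]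
    [NormedSpace ℂ F] [IsScalarTower ℝ ℂ F] {f : E → ℂ → F}
    (hf : ContDiffOn ℝ ∞ (Function.uncurry f) (U ×ˢ O)) :
    ∃ g : E → ℂ → F, IsFamily U (chartSupp pt σ j) g ∧
      ∀ ξ, ∀ y ∈ chartSupp pt σ j, g ξ y = (σ j ((chartAt ℂ (pt j)).symm y) : ℂ) • f ξ y := by
  classical
  have hKc := isCompact_chartSupp hσ j
  have hKt := chartSupp_subset hσ j
  have h0 : ∀ y ∈ O, y ∉ chartSupp pt σ j → σ j ((chartAt ℂ (pt j)).symm y) = 0 := by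
    intro y hy hyK
    refine image_eq_zero_of_notMem_tsupport fun h => hyK ⟨_, h, ?_⟩
    exact (chartAt ℂ (pt j)).right_inv (hOt hy)
  set g : E → ℂ → F := fun ξ y =>
    if y ∈ chartSupp pt σ j then (σ j ((chartAt ℂ (pt j)).symm y) : ℂ) • f ξ y else 0 with hg
  refine ⟨g, ⟨?_, fun ξ _ y hy => if_neg hy⟩, fun ξ y hy => if_pos hy⟩
  rintro ⟨ξ, y⟩ ⟨hξ, -⟩
  refine ContDiffAt.contDiffWithinAt ?_
  by_cases hy : y ∈ chartSupp pt σ j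
  · have hσ' : ContDiffAt ℝ ∞ (fun y => ((σ j ((chartAt ℂ (pt j)).symm y) : ℝ) : ℂ)) y :=
      contDiffAt_partition σ j (hKt hy)
    have h1 : ContDiffAt ℝ ∞ (fun p : E × ℂ => ((σ j ((chartAt ℂ (pt j)).symm p.2) : ℝ) : ℂ) •
        f p.1 p.2) (ξ, y) :=
      (hσ'.comp (ξ, y) contDiffAt_snd).smul (hf.contDiffAt ((hU.prod hO).mem_nhds ⟨hξ, hK hy⟩))
    refine h1.congr_of_eventuallyEq ?_
    filter_upwards [(continuous_snd.tendsto (ξ, y)).eventually (hO.mem_nhds (hK hy))] with p hp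
    simp only [Function.uncurry, hg]
    split_ifs with h
    · rfl
    · rw [h0 _ hp h, Complex.ofReal_zero, zero_smul]
  · refine (contDiffAt_const (c := (0 : F))).congr_of_eventuallyEq ?_
    filter_upwards [(continuous_snd.tendsto (ξ, y)).eventually
      (hKc.isClosed.isOpen_compl.mem_nhds hy)] with p hp
    exact if_neg hp

variable [IsManifold 𝓘(ℂ, ℂ) ω S] [IsManifold 𝓘(ℂ, E) ω X]

theorem exists_fiberFamily {s : ι → X → S} (hs : ∀ i, ContMDiff 𝓘(ℂ, E) 𝓘(ℂ, ℂ) ω (s i))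
    {w : DForm (𝓘(ℝ, ℂ).prod 𝓘(ℝ, E)) (S × X) (k + 2)} (hw : IsPolarAlongGraphs s w) (x₀ : X) :
    Nonempty (FiberFamily s w x₀) := by
  classical
  choose n M O U f₀ f hO hzO hOt hU hxU hUs hf₀ hf heq using
    fun z => exists_normal_form hs hw x₀ z
  -- The cut-offs are subordinate to the sets on which the normal form at their centre is valid;
  -- finitely many of them leave a common neighbourhood of `x₀`.
  obtain ⟨m, pt, σ, -, hσ⟩ := exists_partition
    (fun z : S => (chartAt ℂ z).source ∩ chartAt ℂ z ⁻¹' O z)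
    (fun z => (chartAt ℂ z).isOpen_inter_preimage (hO z))
    (fun z => ⟨mem_chart_source ℂ z, hzO z⟩)
  have hsub : σ.IsSubordinate fun j => (chartAt ℂ (pt j)).source := fun j q hq => (hσ j hq).1
  have hKO : ∀ j, chartSupp pt σ j ⊆ O (pt j) := by
    rintro j _ ⟨q, hq, rfl⟩
    exact (hσ j hq).2
  obtain ⟨U₀, hU₀s, hU₀, hxU₀⟩ := mem_nhds_iff.1 (poleDomain_mem_nhds hs x₀)
  set V : Set E := U₀ ∩ ⋂ j, U (pt j) with hV
  have hVo : IsOpen V := hU₀.inter (isOpen_iInter_of_finite fun j => hU (pt j))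
  have hVU : ∀ j, V ⊆ U (pt j) := fun j ξ h => Set.mem_iInter.1 h.2 j
  have hVs : V ⊆ poleDomain s x₀ := fun ξ h => hU₀s h.1
  -- A common exponent for all charts; the missing powers of the collision equation are absorbed
  -- into the smooth coefficients.
  set M₀ := Finset.univ.sup fun j => M (pt j)
  have hM : ∀ j, M (pt j) ≤ M₀ := fun j => Finset.le_sup (f := fun j => M (pt j)) (Finset.mem_univ j)
  have hcoll : ∀ j, ContDiffOn ℝ ∞ (fun p : E × ℂ => collEq s x₀ p.1 ^ (M₀ - M (pt j)))
      (V ×ˢ O (pt j)) := fun j =>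
    ((contDiffOn_collEq hs x₀).comp contDiffOn_fst fun p hp => hVs hp.1).pow _
  have hF₀ := fun j => isFamily_cut hsub j hVo (hO (pt j)) (hOt (pt j)) (hKO j)
    (f := fun ξ y => collEq s x₀ ξ ^ (M₀ - M (pt j)) • f₀ (pt j) ξ y)
    ((hcoll j).smul ((hf₀ (pt j)).mono (Set.prod_mono_left (hVU j))))
  have hF := fun j i => isFamily_cut hsub j hVo (hO (pt j)) (hOt (pt j)) (hKO j)
    (f := fun ξ y => collEq s x₀ ξ ^ (M₀ - M (pt j)) • f (pt j) i ξ y)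
    ((hcoll j).smul ((hf (pt j) i).mono (Set.prod_mono_left (hVU j))))
  choose g₀ hg₀ hg₀e using hF₀
  choose g hg hge using hF
  refine ⟨⟨m, pt, σ, hsub, V, hVo, ⟨hxU₀, Set.mem_iInter.2 fun j => hxU (pt j)⟩, hVs, M₀,
    fun j => n (pt j), g₀, g, hg₀, hg, fun ξ hξ j y hy hoff => ?_⟩⟩
  have h1 := heq (pt j) ξ (hVU j hξ) y (hKO j hy) hoff
  have h2 : collEq s x₀ ξ ^ M₀ = collEq s x₀ ξ ^ (M₀ - M (pt j)) * collEq s x₀ ξ ^ M (pt j) := by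
    rw [← pow_add, Nat.sub_add_cancel (hM j)]
  rw [h2, mul_smul, h1, hg₀e j ξ y hy, smul_add, smul_add, Finset.smul_sum, Finset.smul_sum]
  congr 1
  refine Finset.sum_congr rfl fun i _ => ?_
  rw [hge j i ξ y hy, form_smul_smul, form_smul_smul, form_smul_smul, form_smul_smul]
  congr 1
  ring

namespace FiberFamily

variable {s : ι → X → S} {w : DForm (𝓘(ℝ, ℂ).prod 𝓘(ℝ, E)) (S × X) (k + 2)} {x₀ : X}

/-- The fibrewise regularized integral of the family. -/
def total (𝓕 : FiberFamily s w x₀) (ξ : E) : E [⋀^Fin k]→L[ℝ] ℂ :=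
  ∑ j, ((∫ y, 𝓕.g₀ j ξ y) +
    ∑ i ∈ polesAt s x₀ (𝓕.pt j), pf (𝓕.n j) (𝓕.g j i ξ) (polePos s x₀ i ξ))

theorem compact (𝓕 : FiberFamily s w x₀) (j : Fin 𝓕.m) : IsCompact (chartSupp 𝓕.pt 𝓕.σ j) :=
  isCompact_chartSupp 𝓕.sub j

/-- Smooth across the collision locus as well, since every summand involves only one moving pole. -/
theorem contDiffOn_total (𝓕 : FiberFamily s w x₀)
    (hs : ∀ i, ContMDiff 𝓘(ℂ, E) 𝓘(ℂ, ℂ) ω (s i)) : ContDiffOn ℝ ∞ 𝓕.total 𝓕.U :=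
  ContDiffOn.sum fun j _ => ((𝓕.fam₀ j).contDiffOn_integral 𝓕.isOpen (𝓕.compact j)).add
    (ContDiffOn.sum fun i _ => (𝓕.fam j i).contDiffOn_pf 𝓕.isOpen (𝓕.compact j)
      ((contDiffOn_polePos hs x₀ i).mono 𝓕.subset) (𝓕.n j))

end FiberFamily

theorem mem_fiberPoles {s : ι → X → S} {x : X} {q : S} :
    q ∈ fiberPoles s x ↔ ∃ i, s i x = q := by
  classical
  unfold fiberPoles
  exact Finset.mem_image.trans ⟨fun ⟨i, _, h⟩ => ⟨i, h⟩, fun ⟨i, h⟩ => ⟨i, Finset.mem_univ i, h⟩⟩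

theorem notMem_fiberPoles {s : ι → X → S} {x : X} {q : S} :
    q ∉ fiberPoles s x ↔ ∀ i, q ≠ s i x := by
  rw [mem_fiberPoles, not_exists]
  exact forall_congr' fun i => ⟨fun h h' => h h'.symm, fun h h' => h h'.symm⟩

theorem polePos_spec {s : ι → X → S} {x₀ : X} {ξ : E} (hξ : ξ ∈ poleDomain s x₀) {z : S} {i : ι}
    (hi : i ∈ polesAt s x₀ z) :
    (s i ((chartAt E x₀).symm ξ) ∈ fiberPoles s ((chartAt E x₀).symm ξ) ∧
      s i ((chartAt E x₀).symm ξ) ∈ (chartAt ℂ z).source) ∧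
      chartAt ℂ z (s i ((chartAt E x₀).symm ξ)) = polePos s x₀ i ξ := by
  have h := hξ.2 i
  rw [mem_polesAt.1 hi] at h
  exact ⟨⟨mem_fiberPoles.2 ⟨i, rfl⟩, h⟩, by rw [polePos, mem_polesAt.1 hi]⟩

/-- Applies the summation over charts on each nearby fibre, including fibres over the collision
locus. There is one index `i` per section rather than per point, so coinciding poles cause no
trouble. -/
theorem FiberFamily.hasRegIntegral {s : ι → X → S}
    {w : DForm (𝓘(ℝ, ℂ).prod 𝓘(ℝ, E)) (S × X) (k + 2)} {x₀ : X} (𝓕 : FiberFamily s w x₀) {ξ : E}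
    (hξ : ξ ∈ 𝓕.U) (v : Fin k → E) :
    HasRegIntegral (fiberPoles s ((chartAt E x₀).symm ξ))
      (fun q => collEq s x₀ ξ ^ 𝓕.M • fiberTwoForm w ((chartAt E x₀).symm ξ) (fun j =>
        fderiv ℝ (chartAt E ((chartAt E x₀).symm ξ) ∘ (chartAt E x₀).symm) ξ (v j)) q)
      (𝓕.total ξ v) := by
  have hξd := 𝓕.subset hξ
  have ht₀ := fun j => (𝓕.fam₀ j).isTest 𝓕.isOpen (𝓕.compact j) hξ
  have ht := fun j i => (𝓕.fam j i).isTest 𝓕.isOpen (𝓕.compact j) hξ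
  have h := hasRegIntegral_of_local (D := fiberPoles s ((chartAt E x₀).symm ξ)) 𝓕.sub
    (fun j => polesAt s x₀ (𝓕.pt j)) (fun j _ => 𝓕.n j) (fun i => s i ((chartAt E x₀).symm ξ))
    (fun j i hi => (polePos_spec hξd hi).1) (fun j y => 𝓕.g₀ j ξ y v) (fun j i y => 𝓕.g j i ξ y v)
    (fun j => (ht₀ j).clm_comp ((evalC v).restrictScalars ℝ))
    (fun j i => (ht j i).clm_comp ((evalC v).restrictScalars ℝ))
    (fun j y hy => by rw [(𝓕.fam₀ j).zero ξ hξ y hy]; rfl)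
    (fun j i y hy => by rw [(𝓕.fam j i).zero ξ hξ y hy]; rfl)
    (fun q => collEq s x₀ ξ ^ 𝓕.M • fiberTwoForm w ((chartAt E x₀).symm ξ) (fun j =>
        fderiv ℝ (chartAt E ((chartAt E x₀).symm ξ) ∘ (chartAt E x₀).symm) ξ (v j)) q) ?_
  · convert h using 1
    rw [FiberFamily.total, ContinuousAlternatingMap.sum_apply]
    refine Finset.sum_congr rfl fun j _ => ?_
    rw [ContinuousAlternatingMap.add_apply, ContinuousAlternatingMap.sum_apply]
    congr 1
    · exact ((evalC v).integral_comp_comm (ht₀ j).integrable).symm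
    · refine Finset.sum_congr rfl fun i hi => ?_
      rw [(polePos_spec hξd hi).2]
      exact pf_clm (evalC v) (ht j i) _ _
  · intro j y hy hoff
    have h1 := 𝓕.eq ξ hξ j y hy (notMem_fiberPoles.1 hoff)
    have h2 := congrArg (evalC v) h1
    rw [map_smul, map_smul, map_add, map_sum] at h2
    simp only [map_smul] at h2
    have h3 := slicePush_inChart w (chartSupp_subset 𝓕.sub j hy) hξd.1 v
    have h4 : evalC v (slicePush (inChart (𝓘(ℝ, ℂ).prod 𝓘(ℝ, E)) w (𝓕.pt j, x₀) (y, ξ))) = _ := h3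
    rw [h4] at h2
    refine Eq.trans ?_ (h2.trans ?_)
    · rfl
    · refine congrArg₂ _ rfl (Finset.sum_congr rfl fun i hi => ?_)
      rw [(polePos_spec hξd hi).2]
      rfl

end Family

end RegInt
end

noncomputable section

namespace RegInt

open Filter MeasureTheory

/-! ### Directional derivatives of type `(1,0)` on products and of negative powers. -/

section DirDel

variable {E : Type*} [NormedAddCommGroup E] [NormedSpace ℂ E] [NormedSpace ℝ E]
  [IsScalarTower ℝ ℂ E] {F : Type*} [NormedAddCommGroup F] [NormedSpace ℂ F] [NormedSpace ℝ F]
  [IsScalarTower ℝ ℂ F] {F' : Type*} [NormedAddCommGroup F'] [NormedSpace ℂ F'] [NormedSpace ℝ F']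
  [IsScalarTower ℝ ℂ F']

theorem dirDel_clm (A : F →L[ℂ] F') {G : E → F} {y : E} (hG : DifferentiableAt ℝ G y) (a : E) :
    dirDel (fun y => A (G y)) a y = A (dirDel G a y) := by
  have h : fderiv ℝ (fun y => A (G y)) y = (A.restrictScalars ℝ).comp (fderiv ℝ G y) :=
    ((A.restrictScalars ℝ).hasFDerivAt.comp y hG.hasFDerivAt).fderiv
  rw [dirDel, dirDel, h, complexLinearPart_clm_comp (A.restrictScalars ℝ) fun x => A.map_smul _ x]
  rfl

variable {E' : Type*} [NormedAddCommGroup E'] [NormedSpace ℂ E'] [NormedSpace ℝ E']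
  [IsScalarTower ℝ ℂ E']

theorem dirDel_prod_right {G : E' × E → F} {y : E'} {ξ : E} (hG : DifferentiableAt ℝ G (y, ξ))
    (a : E) : dirDel (fun ξ => G (y, ξ)) a ξ = dirDel G (0, a) (y, ξ) := by
  have h : fderiv ℝ (fun ξ => G (y, ξ)) ξ =
      (fderiv ℝ G (y, ξ)).comp (ContinuousLinearMap.inr ℝ E' E) :=
    (hG.hasFDerivAt.comp ξ (hasFDerivAt_prodMk_right y ξ)).fderiv
  rw [dirDel, dirDel, h, complexLinearPart_comp_clm _ _ (fun v => by simp)]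
  simp

theorem dirDel_prod_left {G : E' × E → F} {y : E'} {ξ : E} (hG : DifferentiableAt ℝ G (y, ξ))
    (a : E') : dirDel (fun y => G (y, ξ)) a y = dirDel G (a, 0) (y, ξ) := by
  have h : fderiv ℝ (fun y => G (y, ξ)) y =
      (fderiv ℝ G (y, ξ)).comp (ContinuousLinearMap.inl ℝ E' E) :=
    (hG.hasFDerivAt.comp y (hasFDerivAt_prodMk_left y ξ)).fderiv
  rw [dirDel, dirDel, h, complexLinearPart_comp_clm _ _ (fun v => by simp)]
  simp

theorem dirDel_inv_pow {p : E → ℂ} {ξ : E} (hp : DifferentiableAt ℂ p ξ) {y : ℂ} (hy : y ≠ p ξ)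
    (n : ℕ) (a : E) : dirDel (fun ξ => ((y - p ξ) ^ (n + 1))⁻¹) a ξ =
      ((y - p ξ) ^ (n + 2))⁻¹ * (((n : ℂ) + 1) * fderiv ℝ p ξ a) := by
  have hne := sub_ne_zero.2 hy
  have h1 : HasDerivAt (fun u : ℂ => ((y - u) ^ (n + 1))⁻¹)
      (-(((n + 1 : ℕ) : ℂ) * (y - p ξ) ^ n * -1) / ((y - p ξ) ^ (n + 1)) ^ 2) (p ξ) := by
    have h2 := ((hasDerivAt_id (p ξ)).const_sub y).pow (n + 1)
    simp only [id, Nat.add_sub_cancel] at h2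
    exact h2.inv (pow_ne_zero _ hne)
  have h3 := h1.comp_hasFDerivAt ξ hp.hasFDerivAt
  have h4 : DifferentiableAt ℂ (fun ξ => ((y - p ξ) ^ (n + 1))⁻¹) ξ := h3.differentiableAt
  rw [dirDel_of_holomorphic a h4, fderiv_real_eq h4, fderiv_real_eq hp]
  have h5 : fderiv ℂ (fun ξ => ((y - p ξ) ^ (n + 1))⁻¹) ξ = _ := h3.fderiv
  rw [h5]
  simp only [ContinuousLinearMap.coe_restrictScalars', _root_.smul_apply, smul_eq_mul]
  push_cast
  field_simp
  ring

end DirDel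

/-! ### Differentiation of the fibre integral off the collision locus. -/

section Derivative

variable {E : Type*} [NormedAddCommGroup E] [NormedSpace ℂ E] {k : ℕ}
  {S : Type*} [TopologicalSpace S] [ChartedSpace ℂ S] [T2Space S] [CompactSpace S]
  {X : Type*} [TopologicalSpace X] [ChartedSpace E X] {ι : Type*} [Fintype ι]

/-- No pair of sections meets at `x₀`, so the product is empty; this holds at every `ξ`, which
permits differentiation at `x₀`. -/
theorem collEq_eq_one {s : ι → X → S} {x₀ : X} (hx₀ : x₀ ∉ collisionLocus s) (ξ : E) :
    collEq s x₀ ξ = 1 := by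
  classical
  unfold collEq
  refine Finset.prod_eq_one fun c hc => ?_
  exact absurd ⟨c.1.1, c.1.2, c.2, (Finset.mem_filter.1 hc).2⟩ hx₀

/-- The contraction of a vector of `X` with the derivative of `w` in the direction of `X`, as a
`2`-form on the fibre. -/
def fiberDeriv (w : DForm (𝓘(ℝ, ℂ).prod 𝓘(ℝ, E)) (S × X) (k + 2)) (x₀ : X) (a : E)
    (v : Fin k → E) : DForm 𝓘(ℝ, ℂ) S 2 := fun q =>
  sliceTwoForm (dirDel (inChart (𝓘(ℝ, ℂ).prod 𝓘(ℝ, E)) w (q, x₀)) (0, a)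
    (chartAt ℂ q q, chartAt E x₀ x₀)) v

/-- The vectors `(b, 0), (c, 0), (0, v₀), …` of the product. -/
abbrev fiberVec (b c : ℂ) (v : Fin k → E) : Fin (k + 2) → ℂ × E :=
  Fin.cons (b, 0) (Fin.cons (c, 0) fun j => (0, v j))

variable [IsManifold 𝓘(ℂ, ℂ) ω S] [IsManifold 𝓘(ℂ, E) ω X]

theorem holAtlas_total : HolAtlas (𝓘(ℝ, ℂ).prod 𝓘(ℝ, E)) (S × X) :=
  holAtlas_prod holAtlas_of_isManifold holAtlas_of_isManifold

theorem IsPolarAlongGraphs.smoothFormAt {s : ι → X → S}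
    (hs : ∀ i, ContMDiff 𝓘(ℂ, E) 𝓘(ℂ, ℂ) ω (s i))
    {w : DForm (𝓘(ℝ, ℂ).prod 𝓘(ℝ, E)) (S × X) k} (hw : IsPolarAlongGraphs s w) {q : S} {x : X}
    (hq : ∀ i, q ≠ s i x) : SmoothFormAt (𝓘(ℝ, ℂ).prod 𝓘(ℝ, E)) w (q, x) := by
  obtain ⟨N, η, hη⟩ := hw (q, x)
  have ha : ∀ i : ι, Continuous fun q : S × X => q.1 := fun _ => continuous_fst
  have hb : ∀ i : ι, Continuous fun q : S × X => s i q.2 := fun i =>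
    (hs i).continuous.comp continuous_snd
  refine smoothFormAt_of_pole (smoothFunAt_localEq_graphs hs (q, x)).self_of_nhds
    hη.self_of_nhds.1 ((localEq_ne_zero ha hb (q, x)).self_of_nhds hq) (N := N) ?_
  filter_upwards [hη, eventually_off ha hb (q := (q, x)) hq] with r h1 h2 using h1.2 h2

theorem contDiffAt_inChart_total {s : ι → X → S} (hs : ∀ i, ContMDiff 𝓘(ℂ, E) 𝓘(ℂ, ℂ) ω (s i))
    {w : DForm (𝓘(ℝ, ℂ).prod 𝓘(ℝ, E)) (S × X) k} (hw : IsPolarAlongGraphs s w) {z : S} {x₀ : X}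
    {y : ℂ} {ξ : E} (hy : y ∈ (chartAt ℂ z).target) (hξ : ξ ∈ (chartAt E x₀).target)
    (hq : ∀ i, (chartAt ℂ z).symm y ≠ s i ((chartAt E x₀).symm ξ)) :
    ContDiffAt ℝ ∞ (inChart (𝓘(ℝ, ℂ).prod 𝓘(ℝ, E)) w (z, x₀)) (y, ξ) := by
  refine (contDiffAt_inChart_iff holAtlas_total (by
    rw [extChartAt_prod]
    exact ⟨by rw [extChartAt_target_plane]; exact hy, by simpa [mfld_simps] using hξ⟩)).2 ?_
  exact hw.smoothFormAt hs hq

/-- Only the chart of the surface changes; that of `X` stays fixed at `x₀`, so the parameter `ξ` and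
the vectors of `X` are untouched. -/
theorem evalC_inChart_change (w : DForm (𝓘(ℝ, ℂ).prod 𝓘(ℝ, E)) (S × X) k) {z : S} {x₀ : X}
    {y : ℂ} {ξ : E} (hy : y ∈ (chartAt ℂ z).target) (hξ : ξ ∈ (chartAt E x₀).target)
    (e : Fin k → ℂ × E) :
    inChart (𝓘(ℝ, ℂ).prod 𝓘(ℝ, E)) w (z, x₀) (y, ξ) e =
      inChart (𝓘(ℝ, ℂ).prod 𝓘(ℝ, E)) w ((chartAt ℂ z).symm y, x₀)
        (trans z ((chartAt ℂ z).symm y) y, ξ)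
        (fun i => (fderiv ℝ (trans z ((chartAt ℂ z).symm y)) y (e i).1, (e i).2)) := by
  have hξt : ξ ∈ (extChartAt 𝓘(ℝ, E) x₀).target := by simpa [mfld_simps] using hξ
  have hξs : (chartAt E x₀).symm ξ ∈ (chartAt E x₀).source := (chartAt E x₀).map_target hξ
  have h1 := inChart_change (holAtlas_total (S := S) (X := X) (E := E)) w (p := (z, x₀))
    (q := ((chartAt ℂ z).symm y, x₀)) (y := (y, ξ)) (by
      rw [extChartAt_prod]
      exact ⟨by rw [extChartAt_target_plane]; exact hy, hξt⟩) (by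
      rw [extChartAt_prod]
      exact ⟨mem_extChartAt_source (I := 𝓘(ℝ, ℂ)) _, by rw [extChartAt_source]; exact hξs⟩)
  have h2 : (extChartAt (𝓘(ℝ, ℂ).prod 𝓘(ℝ, E)) ((chartAt ℂ z).symm y, x₀) ∘
      (extChartAt (𝓘(ℝ, ℂ).prod 𝓘(ℝ, E)) (z, x₀)).symm) (y, ξ) =
      (trans z ((chartAt ℂ z).symm y) y, ξ) :=
    Prod.ext rfl ((chartAt E x₀).right_inv hξ)
  rw [h1, h2, ContinuousAlternatingMap.compContinuousLinearMap_apply]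
  congr 1
  ext1 i
  refine (fderiv_prodMap_chart (S := S) (X := X) hy (mem_chart_source ℂ _) hξ hξs (e i)).trans ?_
  rw [fderiv_chart_self x₀ hξt]
  rfl

/-- The transition map of the surface does not depend on `ξ`, so differentiation in `ξ` commutes
with it. This makes the forms given pointwise by `fiberDeriv` computable in any chart of the fibre.
-/
theorem coeff_fiberDeriv {s : ι → X → S} (hs : ∀ i, ContMDiff 𝓘(ℂ, E) 𝓘(ℂ, ℂ) ω (s i))
    {w : DForm (𝓘(ℝ, ℂ).prod 𝓘(ℝ, E)) (S × X) (k + 2)} (hw : IsPolarAlongGraphs s w) {z : S}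
    {x₀ : X} {y : ℂ} (hy : y ∈ (chartAt ℂ z).target) (hq : ∀ i, (chartAt ℂ z).symm y ≠ s i x₀)
    (a : E) (v : Fin k → E) :
    coeff (fiberDeriv w x₀ a v) z y =
      dirDel (fun ξ => inChart (𝓘(ℝ, ℂ).prod 𝓘(ℝ, E)) w (z, x₀) (y, ξ)
        (fiberVec 1 Complex.I v)) a (chartAt E x₀ x₀) := by
  set q := (chartAt ℂ z).symm y with hqdef
  have hξt := mem_chart_target E x₀
  have hτ : trans z q y = chartAt ℂ q q := by simp [trans, hqdef]
  have hd : DifferentiableAt ℝ (inChart (𝓘(ℝ, ℂ).prod 𝓘(ℝ, E)) w (q, x₀))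
      (chartAt ℂ q q, chartAt E x₀ x₀) :=
    (contDiffAt_inChart_total hs hw (mem_chart_target ℂ q) hξt (by
      rwa [(chartAt ℂ q).left_inv (mem_chart_source ℂ q),
        (chartAt E x₀).left_inv (mem_chart_source E x₀)])).differentiableAt (by simp)
  have hd' : DifferentiableAt ℝ (fun ξ => inChart (𝓘(ℝ, ℂ).prod 𝓘(ℝ, E)) w (q, x₀)
      (chartAt ℂ q q, ξ)) (chartAt E x₀ x₀) :=
    hd.comp (chartAt E x₀ x₀) (by fun_prop : DifferentiableAt ℝ (fun ξ : E => (chartAt ℂ q q, ξ)) _)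
  have e : (fun ξ => inChart (𝓘(ℝ, ℂ).prod 𝓘(ℝ, E)) w (z, x₀) (y, ξ) (fiberVec 1 Complex.I v))
      =ᶠ[𝓝 (chartAt E x₀ x₀)] fun ξ => evalC (fiberVec (fderiv ℝ (trans z q) y 1)
        (fderiv ℝ (trans z q) y Complex.I) v)
        (inChart (𝓘(ℝ, ℂ).prod 𝓘(ℝ, E)) w (q, x₀) (chartAt ℂ q q, ξ)) := by
    filter_upwards [(chartAt E x₀).open_target.mem_nhds hξt] with ξ hξ
    rw [evalC_inChart_change w hy hξ, ← hqdef, hτ]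
    change _ = inChart _ w (q, x₀) (chartAt ℂ q q, ξ) _
    congr 1
    ext1 i
    refine Fin.cases ?_ (fun i => Fin.cases ?_ (fun i => ?_) i) i
    · rfl
    · rfl
    · exact Prod.ext (map_zero _) rfl
  rw [dirDel_congr a e, dirDel_clm _ hd', dirDel_prod_right hd]
  unfold coeff inChart fiberDeriv
  rw [ContinuousAlternatingMap.compContinuousLinearMap_apply]
  rfl

/-- Differentiation under the regularized integral. The normal form and its finite parts are
differentiated term by term; `dirDel_inv_pow` on one side and `IsFamily.dirDel_pf` on the other
produce the same pole of order one higher with the same coefficient. -/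
theorem FiberFamily.hasRegIntegral_fiberDeriv {s : ι → X → S}
    (hs : ∀ i, ContMDiff 𝓘(ℂ, E) 𝓘(ℂ, ℂ) ω (s i))
    {w : DForm (𝓘(ℝ, ℂ).prod 𝓘(ℝ, E)) (S × X) (k + 2)} (hw : IsPolarAlongGraphs s w) {x₀ : X}
    (hx₀ : x₀ ∉ collisionLocus s) (𝓕 : FiberFamily s w x₀) (a : E) (v : Fin k → E) :
    HasRegIntegral (fiberPoles s x₀) (fiberDeriv w x₀ a v)
      (dirDel 𝓕.total a (chartAt E x₀ x₀) v) := by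
  set ξ₀ := chartAt E x₀ x₀ with hξ₀
  have hξU : ξ₀ ∈ 𝓕.U := 𝓕.mem
  have hξd := 𝓕.subset hξU
  have hinv : (chartAt E x₀).symm ξ₀ = x₀ := (chartAt E x₀).left_inv (mem_chart_source E x₀)
  have ht₀ := fun j => ((𝓕.fam₀ j).dirDel 𝓕.isOpen a).isTest 𝓕.isOpen (𝓕.compact j) hξU
  have ht := fun j i => ((𝓕.fam j i).dirDel 𝓕.isOpen a).isTest 𝓕.isOpen (𝓕.compact j) hξU
  have ht' := fun j i => (𝓕.fam j i).isTest 𝓕.isOpen (𝓕.compact j) hξU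
  have hp := fun i => differentiableAt_polePos hs hξd i
  have hpc := fun i => (contDiffOn_polePos hs x₀ i).mono 𝓕.subset
  have hspec := fun j i (hi : i ∈ polesAt s x₀ (𝓕.pt j)) => polePos_spec hξd hi
  simp only [← hξ₀, hinv] at hspec
  have h := hasRegIntegral_of_local (D := fiberPoles s x₀) 𝓕.sub
    -- Each pole occurs twice: the left copy carries the derivative of the numerator, with the old
    -- exponent; the right copy carries the derivative of the denominator, with the exponent raised
    -- by one.
    (fun j => (polesAt s x₀ (𝓕.pt j)).disjSum (polesAt s x₀ (𝓕.pt j)))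
    (fun j => Sum.elim (fun _ => 𝓕.n j) (fun _ => 𝓕.n j + 1))
    (Sum.elim (fun i => s i x₀) (fun i => s i x₀))
    (fun j t ht => by
      rcases t with i | i
      · exact (hspec j i (Finset.inl_mem_disjSum.1 ht)).1
      · exact (hspec j i (Finset.inr_mem_disjSum.1 ht)).1)
    (fun j y => evalC v (dirDel (fun ξ => 𝓕.g₀ j ξ y) a ξ₀))
    (fun j => Sum.elim (fun i y => evalC v (dirDel (fun ξ => 𝓕.g j i ξ y) a ξ₀))
      (fun i y => (((𝓕.n j : ℂ) + 1) * fderiv ℝ (polePos s x₀ i) ξ₀ a) * evalC v (𝓕.g j i ξ₀ y)))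
    (fun j => (ht₀ j).clm_comp ((evalC v).restrictScalars ℝ))
    (fun j t => by
      rcases t with i | i
      · exact (ht j i).clm_comp ((evalC v).restrictScalars ℝ)
      · exact ((ht' j i).clm_comp ((evalC v).restrictScalars ℝ)).const_smul _)
    (fun j y hy => by
      rw [((𝓕.fam₀ j).dirDel 𝓕.isOpen a).zero ξ₀ hξU y hy, map_zero])
    (fun j t y hy => by
      rcases t with i | i
      · simp only [Sum.elim_inl]
        rw [((𝓕.fam j i).dirDel 𝓕.isOpen a).zero ξ₀ hξU y hy, map_zero]
      · simp only [Sum.elim_inr]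
        rw [(𝓕.fam j i).zero ξ₀ hξU y hy, map_zero, mul_zero])
    (fiberDeriv w x₀ a v) ?_
  · convert h using 1
    have hdi := fun j => ((((𝓕.fam₀ j).contDiffOn_integral 𝓕.isOpen (𝓕.compact j)).contDiffAt
      (𝓕.isOpen.mem_nhds hξU)).differentiableAt (by simp))
    have hdp := fun j i => (((𝓕.fam j i).contDiffOn_pf 𝓕.isOpen (𝓕.compact j) (hpc i)
      (𝓕.n j)).contDiffAt (𝓕.isOpen.mem_nhds hξU)).differentiableAt (by simp)
    have hds := fun j => DifferentiableAt.fun_sum (u := polesAt s x₀ (𝓕.pt j)) fun i _ => hdp j i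
    have e1 : dirDel 𝓕.total a ξ₀ = ∑ j, (dirDel (fun ξ => ∫ y, 𝓕.g₀ j ξ y) a ξ₀ +
        ∑ i ∈ polesAt s x₀ (𝓕.pt j),
          dirDel (fun ξ => pf (𝓕.n j) (𝓕.g j i ξ) (polePos s x₀ i ξ)) a ξ₀) := by
      unfold FiberFamily.total
      rw [dirDel_sum Finset.univ a fun j _ => (hdi j).fun_add (hds j)]
      refine Finset.sum_congr rfl fun j _ => ?_
      rw [dirDel_add a (hdi j) (hds j), dirDel_sum _ a fun i _ => hdp j i]
    rw [e1, ContinuousAlternatingMap.sum_apply]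
    refine Finset.sum_congr rfl fun j _ => ?_
    rw [ContinuousAlternatingMap.add_apply, ContinuousAlternatingMap.sum_apply, Finset.sum_disjSum,
      ← Finset.sum_add_distrib, (𝓕.fam₀ j).dirDel_integral 𝓕.isOpen (𝓕.compact j) hξU a]
    congr 1
    · exact ((evalC v).integral_comp_comm (ht₀ j).integrable).symm
    · refine Finset.sum_congr rfl fun i hi => ?_
      rw [(𝓕.fam j i).dirDel_pf 𝓕.isOpen (𝓕.compact j) hξU (hpc i) (hp i) a (𝓕.n j),
        ContinuousAlternatingMap.add_apply]
      simp only [Sum.elim_inl, Sum.elim_inr]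
      rw [(hspec j i hi).2]
      congr 1
      · exact pf_clm (evalC v) (ht j i) _ _
      · rw [ContinuousAlternatingMap.smul_apply]
        have h3 := pf_const_smul (fun y => evalC v (𝓕.g j i ξ₀ y))
          ((ht' j i).clm_comp ((evalC v).restrictScalars ℝ)) (𝓕.n j + 1) (polePos s x₀ i ξ₀)
          (((𝓕.n j : ℂ) + 1) * fderiv ℝ (polePos s x₀ i) ξ₀ a)
        simp only [smul_eq_mul] at h3 ⊢
        rw [h3, ← pf_clm (evalC v) (ht' j i)]
        rfl
  · intro j y hy hoff
    have hoff' := notMem_fiberPoles.1 hoff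
    have hyt := chartSupp_subset 𝓕.sub j hy
    rw [coeff_fiberDeriv hs hw hyt hoff']
    have hcd := contDiffAt_inChart_total hs hw (z := 𝓕.pt j) (x₀ := x₀) (ξ := ξ₀) hyt
      (mem_chart_target E x₀) (by rwa [hinv])
    have hdW : DifferentiableAt ℝ (fun ξ => inChart (𝓘(ℝ, ℂ).prod 𝓘(ℝ, E)) w (𝓕.pt j, x₀) (y, ξ)
        (fiberVec 1 Complex.I v)) ξ₀ := by
      have h1 : DifferentiableAt ℝ (fun ξ => inChart (𝓘(ℝ, ℂ).prod 𝓘(ℝ, E)) w (𝓕.pt j, x₀) (y, ξ))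
          ξ₀ := (hcd.differentiableAt (by simp)).comp ξ₀
            (by fun_prop : DifferentiableAt ℝ (fun ξ : E => (y, ξ)) ξ₀)
      exact ((evalC (fiberVec 1 Complex.I v)).restrictScalars ℝ).differentiableAt.comp ξ₀ h1
    have hd₀ : DifferentiableAt ℝ (fun ξ => 𝓕.g₀ j ξ y) ξ₀ :=
      DifferentiableAt.comp (g := Function.uncurry (𝓕.g₀ j)) ξ₀
        (((𝓕.fam₀ j).contDiffAt 𝓕.isOpen hξU y).differentiableAt (by simp))
        (by fun_prop : DifferentiableAt ℝ (fun ξ : E => (ξ, y)) ξ₀)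
    have hd : ∀ i, DifferentiableAt ℝ (fun ξ => 𝓕.g j i ξ y) ξ₀ := fun i =>
      DifferentiableAt.comp (g := Function.uncurry (𝓕.g j i)) ξ₀
        (((𝓕.fam j i).contDiffAt 𝓕.isOpen hξU y).differentiableAt (by simp))
        (by fun_prop : DifferentiableAt ℝ (fun ξ : E => (ξ, y)) ξ₀)
    have hev₀ : DifferentiableAt ℝ (fun ξ => evalC v (𝓕.g₀ j ξ y)) ξ₀ :=
      ((evalC v).restrictScalars ℝ).differentiableAt.comp ξ₀ hd₀
    have hev : ∀ i, DifferentiableAt ℝ (fun ξ => evalC v (𝓕.g j i ξ y)) ξ₀ := fun i =>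
      ((evalC v).restrictScalars ℝ).differentiableAt.comp ξ₀ (hd i)
    have hne : ∀ i ∈ polesAt s x₀ (𝓕.pt j), y ≠ polePos s x₀ i ξ₀ := by
      intro i hi h0
      refine hoff' i ?_
      rw [h0, ← (hspec j i hi).2, (chartAt ℂ (𝓕.pt j)).left_inv (hspec j i hi).1.2]
    have hinvd : ∀ i ∈ polesAt s x₀ (𝓕.pt j),
        DifferentiableAt ℝ (fun ξ => ((y - polePos s x₀ i ξ) ^ (𝓕.n j + 1))⁻¹) ξ₀ := fun i hi =>
      ((((differentiableAt_const y).sub (hp i)).pow _).inv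
        (pow_ne_zero _ (sub_ne_zero.2 (hne i hi)))).restrictScalars ℝ
    -- For fixed `y` off the poles the normal form holds for all `ξ` near `ξ₀`, the sections being
    -- continuous, and may be differentiated there.
    have hev2 : (fun ξ => (𝓕.σ j ((chartAt ℂ (𝓕.pt j)).symm y) : ℂ) •
        inChart (𝓘(ℝ, ℂ).prod 𝓘(ℝ, E)) w (𝓕.pt j, x₀) (y, ξ) (fiberVec 1 Complex.I v))
        =ᶠ[𝓝 ξ₀] fun ξ => evalC v (𝓕.g₀ j ξ y) + ∑ i ∈ polesAt s x₀ (𝓕.pt j),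
          ((y - polePos s x₀ i ξ) ^ (𝓕.n j + 1))⁻¹ • evalC v (𝓕.g j i ξ y) := by
      have hc : ∀ᶠ ξ in 𝓝 ξ₀, ∀ i, (chartAt ℂ (𝓕.pt j)).symm y ≠ s i ((chartAt E x₀).symm ξ) := by
        refine eventually_all.2 fun i => ?_
        have h1 : ContinuousAt (fun ξ => s i ((chartAt E x₀).symm ξ)) ξ₀ :=
          ContinuousAt.comp (hs i).continuous.continuousAt
            ((chartAt E x₀).continuousAt_symm (mem_chart_target E x₀))
        have h2 := h1.eventually_ne (y := (chartAt ℂ (𝓕.pt j)).symm y) (by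
          rw [hinv]; exact (hoff' i).symm)
        filter_upwards [h2] with ξ hξ using hξ.symm
      filter_upwards [hc, 𝓕.isOpen.mem_nhds hξU] with ξ h1 h2
      have h3 := 𝓕.eq ξ h2 j y hy h1
      rw [collEq_eq_one hx₀, one_pow, one_smul] at h3
      have h4 := congrArg (evalC v) h3
      rw [map_smul, map_add, map_sum] at h4
      simp only [map_smul] at h4
      exact h4
    have h5 := dirDel_congr a hev2
    rw [dirDel_const_smul a hdW, dirDel_add a hev₀
      (DifferentiableAt.fun_sum fun i hi => (hinvd i hi).fun_smul (hev i)),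
      dirDel_sum _ a fun i hi => (hinvd i hi).fun_smul (hev i), dirDel_clm _ hd₀] at h5
    rw [← smul_eq_mul, h5, Finset.sum_disjSum, ← Finset.sum_add_distrib]
    congr 1
    refine Finset.sum_congr rfl fun i hi => ?_
    rw [dirDel_smul a (hinvd i hi) (hev i), dirDel_clm _ (hd i), dirDel_inv_pow (hp i) (hne i hi)]
    simp only [Sum.elim_inl, Sum.elim_inr, (hspec j i hi).2, smul_eq_mul]
    ring

end Derivative

end RegInt
end

noncomputable section

namespace RegInt

open Filter MeasureTheory

/-! ### The push-forward and its poles along the collision locus. -/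

section PushForward

variable {E : Type*} [NormedAddCommGroup E] [NormedSpace ℂ E] {k : ℕ}
  {S : Type*} [TopologicalSpace S] [ChartedSpace ℂ S] [T2Space S] [CompactSpace S]
  {X : Type*} [TopologicalSpace X] [ChartedSpace E X] {ι : Type*} [Fintype ι]
  [IsManifold 𝓘(ℂ, ℂ) ω S] [IsManifold 𝓘(ℂ, E) ω X]

theorem FiberFamily.hasRegIntegral_center {s : ι → X → S}
    {w : DForm (𝓘(ℝ, ℂ).prod 𝓘(ℝ, E)) (S × X) (k + 2)} {x₀ : X} (hx₀ : x₀ ∉ collisionLocus s)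
    (𝓕 : FiberFamily s w x₀) (v : Fin k → E) :
    HasRegIntegral (fiberPoles s x₀) (fiberTwoForm w x₀ v) (𝓕.total (chartAt E x₀ x₀) v) := by
  have h := 𝓕.hasRegIntegral 𝓕.mem v
  have hd : fderiv ℝ (chartAt E x₀ ∘ (chartAt E x₀).symm) (chartAt E x₀ x₀) =
      ContinuousLinearMap.id ℝ E :=
    fderiv_chart_self (I := 𝓘(ℝ, E)) x₀ (mem_extChartAt_target (I := 𝓘(ℝ, E)) x₀)
  rw [(chartAt E x₀).left_inv (mem_chart_source E x₀), hd] at h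
  refine h.congr fun q _ => ?_
  rw [collEq_eq_one hx₀, one_pow, one_smul]
  rfl

theorem hasRegIntegral_fiberIntegral {s : ι → X → S}
    (hs : ∀ i, ContMDiff 𝓘(ℂ, E) 𝓘(ℂ, ℂ) ω (s i))
    {w : DForm (𝓘(ℝ, ℂ).prod 𝓘(ℝ, E)) (S × X) (k + 2)} (hw : IsPolarAlongGraphs s w) {x : X}
    (hx : x ∉ collisionLocus s) (v : Fin k → E) :
    HasRegIntegral (fiberPoles s x) (fiberTwoForm w x v) (fiberIntegral s w x v) := by
  obtain ⟨𝓕⟩ := exists_fiberFamily hs hw x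
  have h : ∃ L : E [⋀^Fin k]→L[ℝ] ℂ, ∀ v : Fin k → E,
      HasRegIntegral (fiberPoles s x) (fiberTwoForm w x v) (L v) :=
    ⟨_, 𝓕.hasRegIntegral_center hx⟩
  rw [fiberIntegral, dif_pos h]
  exact h.choose_spec v

theorem hasRegIntegral_fiberTwoForm_iff {s : ι → X → S}
    (hs : ∀ i, ContMDiff 𝓘(ℂ, E) 𝓘(ℂ, ℂ) ω (s i))
    {w : DForm (𝓘(ℝ, ℂ).prod 𝓘(ℝ, E)) (S × X) (k + 2)} (hw : IsPolarAlongGraphs s w) {x : X}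
    (hx : x ∉ collisionLocus s) (v : Fin k → E) (c : ℂ) :
    HasRegIntegral (fiberPoles s x) (fiberTwoForm w x v) c ↔ c = fiberIntegral s w x v :=
  ⟨fun h => h.unique (hasRegIntegral_fiberIntegral hs hw hx v),
    fun h => h ▸ hasRegIntegral_fiberIntegral hs hw hx v⟩

/-- Both sides, evaluated on vectors, are regularized integrals of the same form on the fibre, so
uniqueness applies. This transfers the smoothness of `total` to the push-forward. -/
theorem FiberFamily.smul_inChart_fiberIntegral {s : ι → X → S}
    (hs : ∀ i, ContMDiff 𝓘(ℂ, E) 𝓘(ℂ, ℂ) ω (s i))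
    {w : DForm (𝓘(ℝ, ℂ).prod 𝓘(ℝ, E)) (S × X) (k + 2)} (hw : IsPolarAlongGraphs s w) {x₀ : X}
    (𝓕 : FiberFamily s w x₀) {ξ : E} (hξ : ξ ∈ 𝓕.U)
    (hc : (chartAt E x₀).symm ξ ∉ collisionLocus s) :
    collEq s x₀ ξ ^ 𝓕.M • inChart 𝓘(ℝ, E) (fiberIntegral s w) x₀ ξ = 𝓕.total ξ := by
  ext v
  exact ((hasRegIntegral_fiberIntegral hs hw hc _).const_smul _).unique (𝓕.hasRegIntegral hξ v)

theorem localEq_collisions (s : ι → X → S) (x₀ x : X) (hx : x ∈ (chartAt E x₀).source) :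
    (open Classical in localEq (fun (c : {c : ι × ι // c.1 ≠ c.2}) => s c.1.1)
      (fun (c : {c : ι × ι // c.1 ≠ c.2}) => s c.1.2) x₀ x) = collEq s x₀ (chartAt E x₀ x) := by
  classical
  unfold localEq collEq polePos
  rw [(chartAt E x₀).left_inv hx]
  refine Finset.prod_congr ?_ fun c hc => ?_
  · congr
  · beta_reduce
    rw [(Finset.mem_filter.1 hc).2]

theorem isPolarAlongCollisions_fiberIntegral {s : ι → X → S}
    (hs : ∀ i, ContMDiff 𝓘(ℂ, E) 𝓘(ℂ, ℂ) ω (s i))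
    {w : DForm (𝓘(ℝ, ℂ).prod 𝓘(ℝ, E)) (S × X) (k + 2)} (hw : IsPolarAlongGraphs s w) :
    IsPolarAlongCollisions s (fiberIntegral s w) := by
  classical
  intro x₀
  obtain ⟨𝓕⟩ := exists_fiberFamily hs hw x₀
  have hM : HolAtlas 𝓘(ℝ, E) X := holAtlas_of_isManifold
  refine ⟨𝓕.M, pullChart 𝓘(ℝ, E) x₀ 𝓕.total, ?_⟩
  have h1 := (chartAt E x₀).open_source.mem_nhds (mem_chart_source E x₀)
  have h2 := ((chartAt E x₀).continuousAt (mem_chart_source E x₀)).preimage_mem_nhds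
    (𝓕.isOpen.mem_nhds 𝓕.mem)
  filter_upwards [h1, h2] with x hx hxU
  have hx' : x ∈ (extChartAt 𝓘(ℝ, E) x₀).source := by rwa [extChartAt_source]
  refine ⟨smoothFormAt_pullChart hM hx'
    ((𝓕.contDiffOn_total hs).contDiffAt (𝓕.isOpen.mem_nhds hxU)), fun hoff => ?_⟩
  have hc : x ∉ collisionLocus s := fun ⟨i, j, hij, h⟩ => hoff ⟨(i, j), hij⟩ h
  have h3 := 𝓕.smul_inChart_fiberIntegral hs hw hxU (by rwa [(chartAt E x₀).left_inv hx])
  refine inChart_injective hM (w := fun q => localEq _ _ x₀ x ^ 𝓕.M • fiberIntegral s w q) hx' ?_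
  rw [inChart_pullChart hM x₀ _ ((extChartAt 𝓘(ℝ, E) x₀).map_source hx'), inChart_smul]
  refine Eq.trans ?_ h3
  rw [← localEq_collisions s x₀ x hx]
  rfl

/-- The collision locus is closed and the collision equation at `x₀` is constantly `1`, so no power
of it remains; derivatives of the push-forward at `x₀` are those of `total`. -/
theorem FiberFamily.inChart_fiberIntegral_eventuallyEq {s : ι → X → S}
    (hs : ∀ i, ContMDiff 𝓘(ℂ, E) 𝓘(ℂ, ℂ) ω (s i))
    {w : DForm (𝓘(ℝ, ℂ).prod 𝓘(ℝ, E)) (S × X) (k + 2)} (hw : IsPolarAlongGraphs s w) {x₀ : X}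
    (hx₀ : x₀ ∉ collisionLocus s) (𝓕 : FiberFamily s w x₀) :
    inChart 𝓘(ℝ, E) (fiberIntegral s w) x₀ =ᶠ[𝓝 (chartAt E x₀ x₀)] 𝓕.total := by
  have hcl : IsClosed (collisionLocus s) := by
    have : collisionLocus s = ⋃ i, ⋃ j, {x | i ≠ j ∧ s i x = s j x} := by
      ext x; simp [collisionLocus]
    rw [this]
    refine isClosed_iUnion_of_finite fun i => isClosed_iUnion_of_finite fun j => ?_
    by_cases hij : i = j
    · simp [hij]
    · simpa [hij] using isClosed_eq (hs i).continuous (hs j).continuous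
  have h1 : ∀ᶠ ξ in 𝓝 (chartAt E x₀ x₀), (chartAt E x₀).symm ξ ∉ collisionLocus s :=
    ((chartAt E x₀).continuousAt_symm (mem_chart_target E x₀)).eventually
      (p := fun x => x ∉ collisionLocus s) (by
        rw [(chartAt E x₀).left_inv (mem_chart_source E x₀)]
        exact hcl.isOpen_compl.mem_nhds hx₀)
  filter_upwards [h1, 𝓕.isOpen.mem_nhds 𝓕.mem] with ξ h2 h3
  have h4 := 𝓕.smul_inChart_fiberIntegral hs hw h3 h2
  rwa [collEq_eq_one hx₀, one_pow, one_smul] at h4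

theorem FiberFamily.del_fiberIntegral_apply {s : ι → X → S}
    (hs : ∀ i, ContMDiff 𝓘(ℂ, E) 𝓘(ℂ, ℂ) ω (s i))
    {w : DForm (𝓘(ℝ, ℂ).prod 𝓘(ℝ, E)) (S × X) (k + 2)} (hw : IsPolarAlongGraphs s w) {x₀ : X}
    (hx₀ : x₀ ∉ collisionLocus s) (𝓕 : FiberFamily s w x₀) (v : Fin (k + 1) → E) :
    del 𝓘(ℝ, E) (fiberIntegral s w) x₀ v =
      ∑ j : Fin (k + 1), (-1) ^ (j : ℕ) * dirDel 𝓕.total (v j) (chartAt E x₀ x₀) (j.removeNth v) := by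
  rw [del_eq_delAt]
  change delAt _ (chartAt E x₀ x₀) v = _
  rw [delAt_congr (𝓕.inChart_fiberIntegral_eventuallyEq hs hw hx₀), delAt,
    ContinuousAlternatingMap.alternatizeUncurryFin_apply]
  refine Finset.sum_congr rfl fun j _ => ?_
  rw [zsmul_eq_mul]
  push_cast
  rfl

end PushForward

end RegInt
end

noncomputable section

namespace RegInt

open Filter MeasureTheory

/-! ### The `dz̄`-coefficient of a contracted form. -/

section Slice

variable {E : Type*} [NormedAddCommGroup E] [NormedSpace ℂ E] {k : ℕ}

/-- The vectors `(b, 0), (0, v₀), …` of the product. -/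
abbrev sliceVec (b : ℂ) (v : Fin k → E) : Fin (k + 1) → ℂ × E := Fin.cons (b, 0) fun j => (0, v j)

/-- The coefficient of `dz̄` in the `1`-form `L(·, v₀, …)` on `ℂ`. -/
def sliceCoeff (v : Fin k → E) : ((ℂ × E) [⋀^Fin (k + 1)]→L[ℝ] ℂ) →L[ℂ] ℂ :=
  (1 / 2 : ℂ) • (evalC (sliceVec 1 v) + Complex.I • evalC (sliceVec Complex.I v))

theorem sliceCoeff_apply (v : Fin k → E) (L : (ℂ × E) [⋀^Fin (k + 1)]→L[ℝ] ℂ) :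
    sliceCoeff v L = 1 / 2 * (L (sliceVec 1 v) + Complex.I * L (sliceVec Complex.I v)) := rfl

theorem map_sliceVec (v : Fin k → E) (L : (ℂ × E) [⋀^Fin (k + 1)]→L[ℝ] ℂ) (c : ℂ) :
    L (sliceVec c v) = c.re * L (sliceVec 1 v) + c.im * L (sliceVec Complex.I v) := by
  have h : ((c, 0) : ℂ × E) = c.re • ((1, 0) : ℂ × E) + c.im • ((Complex.I, 0) : ℂ × E) := by
    ext
    · simp
    · simp
  have h1 := L.toMultilinearMap.cons_add (fun j => ((0, v j) : ℂ × E)) (c.re • ((1, 0) : ℂ × E))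
    (c.im • ((Complex.I, 0) : ℂ × E))
  rw [L.toMultilinearMap.cons_smul, L.toMultilinearMap.cons_smul, ← h] at h1
  simpa using h1

/-- The coefficient of `dz̄` transforms by the conjugate of the multiplier under multiplication by a
complex number. -/
theorem map_sliceVec_mul (v : Fin k → E) (L : (ℂ × E) [⋀^Fin (k + 1)]→L[ℝ] ℂ) (c : ℂ) :
    1 / 2 * (L (sliceVec c v) + Complex.I * L (sliceVec (c * Complex.I) v)) =
      (starRingEnd ℂ) c * sliceCoeff v L := by
  have hc : (starRingEnd ℂ) c = c.re - c.im * Complex.I := by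
    apply Complex.ext <;> simp
  rw [sliceCoeff_apply, map_sliceVec v L c, map_sliceVec v L (c * Complex.I), hc]
  simp only [Complex.mul_re, Complex.mul_im, Complex.I_re, Complex.I_im, mul_zero, mul_one, zero_sub,
    add_zero]
  push_cast
  linear_combination (1 / 2 * c.im * L (sliceVec Complex.I v)) * Complex.I_sq

theorem removeNth_fiberVec (b c : ℂ) (v : Fin (k + 1) → E) (j : Fin (k + 1)) :
    j.succ.succ.removeNth (fiberVec b c v) = fiberVec b c (j.removeNth v) := by
  ext1 i
  refine Fin.cases ?_ (fun i => Fin.cases ?_ (fun i => ?_) i) i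
  · rfl
  · rfl
  · simp [Fin.removeNth]

end Slice

/-! ### Splitting `∂` into fibre and base directions. -/

section Contraction

variable {E : Type*} [NormedAddCommGroup E] [NormedSpace ℂ E] {k : ℕ}
  {S : Type*} [TopologicalSpace S] [ChartedSpace ℂ S]
  {X : Type*} [TopologicalSpace X] [ChartedSpace E X] {ι : Type*}

/-- The `(0,1)`-part of the contraction of a form with vectors of `X`, restricted to the fibre. -/
def fiberBar (w : DForm (𝓘(ℝ, ℂ).prod 𝓘(ℝ, E)) (S × X) (k + 1)) (x : X) (v : Fin k → E) :
    DForm 𝓘(ℝ, ℂ) S 1 := fun q => sliceCoeff v (w (q, x)) • dzbar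

theorem isTypeZeroOneOff_fiberBar (D : Finset S)
    (w : DForm (𝓘(ℝ, ℂ).prod 𝓘(ℝ, E)) (S × X) (k + 1)) (x : X) (v : Fin k → E) :
    IsTypeZeroOneOff D (fiberBar w x v) := fun q _ u => by
  simp only [fiberBar, ContinuousAlternatingMap.smul_apply, dzbar_apply, map_mul, Complex.conj_I,
    smul_eq_mul]
  ring

variable [T2Space S] [CompactSpace S] [IsManifold 𝓘(ℂ, ℂ) ω S] [IsManifold 𝓘(ℂ, E) ω X]

theorem inChart_fiberBar (w : DForm (𝓘(ℝ, ℂ).prod 𝓘(ℝ, E)) (S × X) (k + 1)) (x₀ : X)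
    (v : Fin k → E) {z : S} {y : ℂ} (hy : y ∈ (chartAt ℂ z).target) :
    inChart 𝓘(ℝ, ℂ) (fiberBar w x₀ v) z y = sliceCoeff v
      (inChart (𝓘(ℝ, ℂ).prod 𝓘(ℝ, E)) w (z, x₀) (y, chartAt E x₀ x₀)) • dzbar := by
  set q := (chartAt ℂ z).symm y with hq
  have hyD : y ∈ transDomain z q := ⟨hy, mem_chart_source ℂ q⟩
  have hd : DifferentiableAt ℂ (trans z q) y := (contDiffAt_trans hyD).differentiableAt (by simp)
  have hL : ∀ u, fderiv ℝ (trans z q) y u = fderiv ℝ (trans z q) y 1 * u := by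
    intro u
    rw [fderiv_real_eq hd]
    have := (fderiv ℂ (trans z q) y).map_smul u 1
    simp only [smul_eq_mul, mul_one] at this
    simp only [ContinuousLinearMap.coe_restrictScalars', this, mul_comm]
  set c := fderiv ℝ (trans z q) y 1 with hc
  have hτ : trans z q y = chartAt ℂ q q := by simp [trans, hq]
  have hself : inChart (𝓘(ℝ, ℂ).prod 𝓘(ℝ, E)) w (q, x₀) (chartAt ℂ q q, chartAt E x₀ x₀) =
      w (q, x₀) := inChart_self w (q, x₀)
  have hV : ∀ b : ℂ, inChart (𝓘(ℝ, ℂ).prod 𝓘(ℝ, E)) w (z, x₀) (y, chartAt E x₀ x₀) (sliceVec b v) =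
      w (q, x₀) (sliceVec (c * b) v) := by
    intro b
    rw [evalC_inChart_change w hy (mem_chart_target E x₀), ← hq, hτ, hself]
    congr 1
    ext1 i
    refine Fin.cases ?_ (fun i => ?_) i
    · exact Prod.ext (hL b) rfl
    · exact Prod.ext (map_zero _) rfl
  rw [sliceCoeff_apply, hV, hV, mul_one, map_sliceVec_mul]
  ext u
  change sliceCoeff v (w (q, x₀)) • dzbar (fun i => fderiv ℝ (trans z q) y (u i)) = _
  rw [ContinuousAlternatingMap.smul_apply, dzbar_apply, dzbar_apply, hL, map_mul, smul_eq_mul,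
    smul_eq_mul]
  ring

variable [Fintype ι]

/-- Off the collision locus at most one section passes through `z` over `x₀`, so the equation of the
graphs restricts on the fibre to the reduced equation of the set of poles. -/
theorem prod_polesAt {s : ι → X → S} {x₀ : X} (hx₀ : x₀ ∉ collisionLocus s) (z : S) (y : ℂ) :
    ∏ i ∈ polesAt s x₀ z, (y - polePos s x₀ i (chartAt E x₀ x₀)) =
      pointEq (fiberPoles s x₀) z (chartAt ℂ z z) y := by
  classical
  unfold pointEq
  split_ifs with h
  · obtain ⟨i, hi⟩ := mem_fiberPoles.1 h
    have e : polesAt s x₀ z = {i} := by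
      ext j
      rw [mem_polesAt, Finset.mem_singleton]
      refine ⟨fun hj => ?_, fun hj => hj ▸ hi⟩
      by_contra hne
      exact hx₀ ⟨j, i, hne, hj.trans hi.symm⟩
    rw [e, Finset.prod_singleton, polePos, (chartAt E x₀).left_inv (mem_chart_source E x₀), hi]
  · refine Finset.prod_eq_one fun i hi => absurd (mem_fiberPoles.2 ⟨i, mem_polesAt.1 hi⟩) h

theorem isPolarOn_fiberBar {s : ι → X → S}
    {w : DForm (𝓘(ℝ, ℂ).prod 𝓘(ℝ, E)) (S × X) (k + 1)} (hw : IsPolarAlongGraphs s w) {x₀ : X}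
    (hx₀ : x₀ ∉ collisionLocus s) (v : Fin k → E) :
    IsPolarOn (fiberPoles s x₀) (fiberBar w x₀ v) := by
  intro z
  obtain ⟨N, η, hη⟩ := hw (z, x₀)
  refine ⟨N, (hasPoleOn_iff (mem_chart_source ℂ z)).2 ⟨fun y => sliceCoeff v
    (inChart (𝓘(ℝ, ℂ).prod 𝓘(ℝ, E)) η (z, x₀) (y, chartAt E x₀ x₀)) • dzbar, ?_⟩⟩
  have hinv := (chartAt E x₀).left_inv (mem_chart_source E x₀)
  have hc : Tendsto (fun y : ℂ => ((chartAt ℂ z).symm y, x₀)) (𝓝 (chartAt ℂ z z)) (𝓝 (z, x₀)) := by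
    have h1 := ((chartAt ℂ z).continuousAt_symm (mem_chart_target ℂ z)).tendsto
    rw [(chartAt ℂ z).left_inv (mem_chart_source ℂ z)] at h1
    exact h1.prodMk_nhds tendsto_const_nhds
  filter_upwards [hc.eventually hη, (chartAt ℂ z).open_target.mem_nhds (mem_chart_target ℂ z)]
    with y h1 hy
  have hmem : (y, chartAt E x₀ x₀) ∈ (extChartAt (𝓘(ℝ, ℂ).prod 𝓘(ℝ, E)) (z, x₀)).target := by
    rw [extChartAt_prod]
    exact ⟨by rw [extChartAt_target_plane]; exact hy, mem_extChartAt_target (I := 𝓘(ℝ, E)) x₀⟩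
  have hpt : (extChartAt (𝓘(ℝ, ℂ).prod 𝓘(ℝ, E)) (z, x₀)).symm (y, chartAt E x₀ x₀) =
      ((chartAt ℂ z).symm y, x₀) := Prod.ext rfl hinv
  refine ⟨?_, fun hoff => ?_⟩
  · have h2 : ContDiffAt ℝ ∞ (inChart (𝓘(ℝ, ℂ).prod 𝓘(ℝ, E)) η (z, x₀)) (y, chartAt E x₀ x₀) :=
      (contDiffAt_inChart_iff holAtlas_total hmem).2 (by rw [hpt]; exact h1.1)
    have h3 : ContDiffAt ℝ ∞ (fun y => inChart (𝓘(ℝ, ℂ).prod 𝓘(ℝ, E)) η (z, x₀)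
        (y, chartAt E x₀ x₀)) y := h2.comp (f := fun y : ℂ => (y, chartAt E x₀ x₀)) y (by fun_prop)
    exact (((sliceCoeff v).restrictScalars ℝ).contDiff.contDiffAt.comp y h3).smul contDiffAt_const
  · rw [inChart_fiberBar w x₀ v hy]
    have h2 := h1.2 (notMem_fiberPoles.1 hoff)
    have h3 := localEq_graphs s x₀ z (ξ := chartAt E x₀ x₀) hy
    rw [hinv, prod_polesAt hx₀] at h3
    rw [h3] at h2
    have h4 := inChart_congr_point (I := 𝓘(ℝ, ℂ).prod 𝓘(ℝ, E)) (p := (z, x₀))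
      (y := (y, chartAt E x₀ x₀)) (w := fun q => pointEq (fiberPoles s x₀) z (chartAt ℂ z z) y ^ N •
        w q) (w' := η) (by rw [hpt]; exact h2)
    rw [inChart_smul] at h4
    rw [← h4, map_smul, smul_smul, smul_eq_mul]

/-- In the alternating sum for `∂w` the first two terms differentiate along the fibre. They see only
the `(0,1)`-part of `w(·, v)`, because `dz ∧ dz = 0`, and form its `∂`. The remaining terms
differentiate along the vectors `v j`; moving past two fibre directions does not change the sign. -/
theorem sliceTwoForm_del_apply {s : ι → X → S} (hs : ∀ i, ContMDiff 𝓘(ℂ, E) 𝓘(ℂ, ℂ) ω (s i))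
    {w : DForm (𝓘(ℝ, ℂ).prod 𝓘(ℝ, E)) (S × X) (k + 1)} (hw : IsPolarAlongGraphs s w) {x₀ : X}
    (v : Fin k → E) {q : S} (hq : ∀ i, q ≠ s i x₀) :
    fiberTwoForm (del (𝓘(ℝ, ℂ).prod 𝓘(ℝ, E)) w) x₀ v q ![1, Complex.I] =
      del 𝓘(ℝ, ℂ) (fiberBar w x₀ v) q ![1, Complex.I] + ∑ j : Fin k, (-1) ^ (j : ℕ) *
        dirDel (inChart (𝓘(ℝ, ℂ).prod 𝓘(ℝ, E)) w (q, x₀)) (0, v j)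
          (chartAt ℂ q q, chartAt E x₀ x₀) (j.succ.succ.removeNth (fiberVec 1 Complex.I v)) := by
  set W := inChart (𝓘(ℝ, ℂ).prod 𝓘(ℝ, E)) w (q, x₀) with hW
  set y₀ := chartAt ℂ q q
  set ξ₀ := chartAt E x₀ x₀
  have hcd : ∀ y ∈ (chartAt ℂ q).target, (∀ i, (chartAt ℂ q).symm y ≠ s i x₀) →
      ContDiffAt ℝ ∞ W (y, ξ₀) := fun y hy h =>
    contDiffAt_inChart_total hs hw hy (mem_chart_target E x₀) (by
      rwa [(chartAt E x₀).left_inv (mem_chart_source E x₀)])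
  have hd : DifferentiableAt ℝ W (y₀, ξ₀) := (hcd y₀ (mem_chart_target ℂ q) (by
    rwa [(chartAt ℂ q).left_inv (mem_chart_source ℂ q)])).differentiableAt (by simp)
  have hdy : DifferentiableAt ℝ (fun y => W (y, ξ₀)) y₀ :=
    DifferentiableAt.comp (g := W) y₀ hd
      (by fun_prop : DifferentiableAt ℝ (fun y : ℂ => (y, ξ₀)) y₀)
  have hdb : DifferentiableAt ℝ (fun y => sliceCoeff v (W (y, ξ₀))) y₀ :=
    ((sliceCoeff v).restrictScalars ℝ).differentiableAt.comp y₀ hdy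
  have hB : inChart 𝓘(ℝ, ℂ) (fiberBar w x₀ v) q =ᶠ[𝓝 y₀]
      fun y => sliceCoeff v (W (y, ξ₀)) • dzbar := by
    filter_upwards [(chartAt ℂ q).open_target.mem_nhds (mem_chart_target ℂ q)] with y hy
    exact inChart_fiberBar w x₀ v hy
  -- The derivative is of type `(1,0)`, so both fibre terms reduce to the derivative in the
  -- direction `1`.
  have hT : dirDel W (Complex.I, 0) (y₀, ξ₀) = Complex.I • dirDel W (1, 0) (y₀, ξ₀) := by
    rw [dirDel, dirDel, ← complexLinearPart_I_smul]
    congr 1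
    ext <;> simp
  have h1 : del 𝓘(ℝ, ℂ) (fiberBar w x₀ v) q ![1, Complex.I] =
      -2 * Complex.I * sliceCoeff v (dirDel W (1, 0) (y₀, ξ₀)) := by
    rw [del_eq_delAt]
    change delAt _ y₀ _ = _
    rw [delAt_congr hB, delAt_smul_dzbar_apply hdb, ← dirDel_prod_left hd, ← dirDel_clm _ hdy]
    rfl
  have h2 : fiberTwoForm (del (𝓘(ℝ, ℂ).prod 𝓘(ℝ, E)) w) x₀ v q ![1, Complex.I] =
      ContinuousAlternatingMap.alternatizeUncurryFin (complexLinearPart (fderiv ℝ W (y₀, ξ₀)))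
        (fiberVec 1 Complex.I v) := rfl
  rw [h1, h2, ContinuousAlternatingMap.alternatizeUncurryFin_apply, Fin.sum_univ_succ,
    Fin.sum_univ_succ, ← add_assoc, sliceCoeff_apply]
  congr 1
  · have e0 : (0 : Fin (k + 2)).removeNth (fiberVec 1 Complex.I v) = sliceVec Complex.I v := rfl
    have e1 : ((0 : Fin (k + 1)).succ).removeNth (fiberVec 1 Complex.I v) = sliceVec 1 v := by
      ext1 i
      refine Fin.cases rfl (fun i => rfl) i
    rw [e0, e1]
    change (-1 : ℤ) ^ 0 • dirDel W (1, 0) (y₀, ξ₀) _ + (-1 : ℤ) ^ 1 •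
      dirDel W (Complex.I, 0) (y₀, ξ₀) _ = _
    rw [hT, ContinuousAlternatingMap.smul_apply]
    simp only [smul_eq_mul, pow_zero, pow_one, one_smul, neg_smul]
    linear_combination (dirDel W (1, 0) (y₀, ξ₀) (sliceVec Complex.I v)) * (Complex.I_sq)
  · refine Finset.sum_congr rfl fun j _ => ?_
    rw [zsmul_eq_mul]
    simp only [Fin.val_succ, pow_succ]
    push_cast
    simp only [mul_neg_one, neg_neg]
    rfl

/-- The fibre terms form an exact form with regularized integral zero; the base terms integrate to
the derivatives of the push-forward, with the signs of the alternating sum. Uniqueness of the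
regularized integral identifies the two sides. -/
theorem fiberIntegral_del {s : ι → X → S} (hs : ∀ i, ContMDiff 𝓘(ℂ, E) 𝓘(ℂ, ℂ) ω (s i))
    {w : DForm (𝓘(ℝ, ℂ).prod 𝓘(ℝ, E)) (S × X) (k + 2)} (hw : IsPolarAlongGraphs s w) {x₀ : X}
    (hx₀ : x₀ ∉ collisionLocus s) :
    fiberIntegral s (del (𝓘(ℝ, ℂ).prod 𝓘(ℝ, E)) w) x₀ = del 𝓘(ℝ, E) (fiberIntegral s w) x₀ := by
  obtain ⟨𝓕⟩ := exists_fiberFamily hs hw x₀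
  ext v
  rw [𝓕.del_fiberIntegral_apply hs hw hx₀]
  refine ((hasRegIntegral_fiberTwoForm_iff hs (isPolarAlongGraphs_del hs hw) hx₀ v _).1 ?_).symm
  have h := (hasRegIntegral_del (isPolarOn_fiberBar hw hx₀ v)
    (isTypeZeroOneOff_fiberBar _ w x₀ v)).add (HasRegIntegral.sum Finset.univ fun j _ =>
      (𝓕.hasRegIntegral_fiberDeriv hs hw hx₀ (v j) (j.removeNth v)).const_smul ((-1) ^ (j : ℕ)))
  rw [zero_add] at h
  refine h.congr fun q hq => ?_
  refine alternating_two_ext ?_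
  rw [sliceTwoForm_del_apply hs hw v (notMem_fiberPoles.1 hq), Pi.add_apply,
    ContinuousAlternatingMap.add_apply, ContinuousAlternatingMap.sum_apply]
  congr 1
  refine Finset.sum_congr rfl fun j _ => ?_
  rw [ContinuousAlternatingMap.smul_apply, smul_eq_mul, removeNth_fiberVec]
  rfl

/-- With no vector of `X` to contract, only the exact fibre term remains. -/
theorem fiberIntegral_del_of_degree_one {s : ι → X → S}
    (hs : ∀ i, ContMDiff 𝓘(ℂ, E) 𝓘(ℂ, ℂ) ω (s i))
    {w : DForm (𝓘(ℝ, ℂ).prod 𝓘(ℝ, E)) (S × X) 1} (hw : IsPolarAlongGraphs s w) {x₀ : X}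
    (hx₀ : x₀ ∉ collisionLocus s) :
    fiberIntegral s (del (𝓘(ℝ, ℂ).prod 𝓘(ℝ, E)) w) x₀ = 0 := by
  ext v
  refine ((hasRegIntegral_fiberTwoForm_iff hs (isPolarAlongGraphs_del hs hw) hx₀ v 0).1 ?_).symm
  refine (hasRegIntegral_del (isPolarOn_fiberBar hw hx₀ v)
    (isTypeZeroOneOff_fiberBar _ w x₀ v)).congr fun q hq => ?_
  refine alternating_two_ext ?_
  rw [sliceTwoForm_del_apply hs hw v (notMem_fiberPoles.1 hq), Finset.univ_eq_empty,
    Finset.sum_empty, add_zero]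

end Contraction

end RegInt
end

theorem theorem2p18
    {E : Type*} [NormedAddCommGroup E] [NormedSpace ℂ E] [FiniteDimensional ℂ E]
    {S : Type*} [TopologicalSpace S] [T2Space S] [CompactSpace S]
    [ChartedSpace ℂ S] [IsManifold 𝓘(ℂ, ℂ) ω S]
    {X : Type*} [TopologicalSpace X] [T2Space X]
    [ChartedSpace E X] [IsManifold 𝓘(ℂ, E) ω X]
    {ι : Type*} [Fintype ι] (s : ι → X → S)
    (hs : ∀ i, ContMDiff 𝓘(ℂ, E) 𝓘(ℂ, ℂ) ω (s i)) (hinj : Function.Injective s) :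
    -- `∂` preserves forms with poles along the graphs
    (∀ (k : ℕ) (w : RegInt.DForm (𝓘(ℝ, ℂ).prod 𝓘(ℝ, E)) (S × X) k),
      RegInt.IsPolarAlongGraphs s w → RegInt.IsPolarAlongGraphs s (RegInt.del (𝓘(ℝ, ℂ).prod 𝓘(ℝ, E)) w)) ∧
    -- the push-forward is well defined, with values in forms with poles along the collision locus
    (∀ (k : ℕ) (w : RegInt.DForm (𝓘(ℝ, ℂ).prod 𝓘(ℝ, E)) (S × X) (k + 2)),
      RegInt.IsPolarAlongGraphs s w →
      (∀ x, x ∉ RegInt.collisionLocus s → ∀ (v : Fin k → E) (c : ℂ),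
        RegInt.HasRegIntegral (RegInt.fiberPoles s x) (RegInt.fiberTwoForm w x v) c ↔
          c = RegInt.fiberIntegral s w x v) ∧
      RegInt.IsPolarAlongCollisions s (RegInt.fiberIntegral s w)) ∧
    -- it intertwines the holomorphic de Rham differentials
    (∀ (k : ℕ) (w : RegInt.DForm (𝓘(ℝ, ℂ).prod 𝓘(ℝ, E)) (S × X) (k + 2)),
      RegInt.IsPolarAlongGraphs s w → ∀ x, x ∉ RegInt.collisionLocus s →
        RegInt.fiberIntegral s (RegInt.del (𝓘(ℝ, ℂ).prod 𝓘(ℝ, E)) w) x = RegInt.del 𝓘(ℝ, E) (RegInt.fiberIntegral s w) x) ∧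
    -- in degree one, where the push-forward of `w` itself is zero
    (∀ w : RegInt.DForm (𝓘(ℝ, ℂ).prod 𝓘(ℝ, E)) (S × X) 1,
      RegInt.IsPolarAlongGraphs s w → ∀ x, x ∉ RegInt.collisionLocus s →
        RegInt.fiberIntegral s (RegInt.del (𝓘(ℝ, ℂ).prod 𝓘(ℝ, E)) w) x = 0) := by
  exact ⟨fun k w hw => RegInt.isPolarAlongGraphs_del hs hw,
    fun k w hw => ⟨fun x hx v c => RegInt.hasRegIntegral_fiberTwoForm_iff hs hw hx v c,
      RegInt.isPolarAlongCollisions_fiberIntegral hs hw⟩,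
    fun k w hw x hx => RegInt.fiberIntegral_del hs hw hx,
    fun w hw x hx => RegInt.fiberIntegral_del_of_degree_one hs hw hx⟩
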